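/- Let $k$ be a commutative ring, and $\mathscr T$ a small dg-category over $k$ (enriched in cochain complexes). A left (right) $\mathscr T$-module is a dg-functor from $\mathscr T$ ($\mathscr T^{op}$) to complexes of $k$-modules. A morphism of modules is a closed natural transformation of degree $0$; $f\simeq f'$ means that $f-f'=ds+sd$ for a natural transformation $s$ of degree $-1$; $H^0(\mathscr A\text{-Mod})$ is the category of $\mathscr A$-modules with morphisms taken up to $\simeq$, and $Ho(\mathscr A\text{-Mod})$ its localization at the quasi-isomorphisms. A module is cofibrant if it has the left lifting property against surjective quasi-isomorphisms, and perfect if it is cofibrant and compact in the homotopy category. Unadorned tensor products are the ordinary (non-derived) tensor products of dg-modules. A *2-fold bimodule* $\Gamma$ is a $\mathscr T\otimes\mathscr T\otimes\mathscr T^{op}$-module, with two covariant variables and one contravariant one. For right modules $X,Y$ let $X\boxtimes Y=\Gamma\otimes X\otimes Y$ be the right module obtained by tensoring $\Gamma$ over $\mathscr T$ with $X$ in its first and $Y$ in its second covariant variable. A *pseudo dg-tensor structure* on $\mathscr T$ consists of a 2-fold bimodule $\Gamma$, a right module $U$, and closed degree $0$ morphisms of (multi-)bimodules, written as dg-natural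 families over right modules, $$\alpha_{X,Y,Z}:X\boxtimes(Y\boxtimes Z)\to(X\boxtimes Y)\boxtimes Z,\quad \ell_X:U\boxtimes X\to X,\quad r_X:X\boxtimes U\to X,\quad c_{X,Y}:X\boxtimes Y\to Y\boxtimes X,$$ which are quasi-isomorphisms for all cofibrant $X,Y,Z$, together with dg-natural morphisms $\eta,\mu,\sigma,\kappa,\lambda$ of degree $-1$ (that is, degree $-1$ morphisms of multi-bimodules) such that $$\alpha_{X\boxtimes Y,Z,W}\,\alpha_{X,Y,Z\boxtimes W}-(\alpha_{X,Y,Z}\boxtimes W)\,\alpha_{X,Y\boxtimes Z,W}\,(X\boxtimes\alpha_{Y,Z,W})=d\eta,$$ $$(r_X\boxtimes Y)\,\alpha_{X,U,Y}-X\boxtimes\ell_Y=d\mu,\qquad c_{Y,X}\,c_{X,Y}-\mathrm{id}=d\sigma,\qquad \ell_X\,c_{X,U}-r_X=d\kappa,$$ $$(c_{X,Z}\boxtimes Y)\,\alpha_{X,Z,Y}\,(X\boxtimes c_{Y,Z})-\alpha_{Z,X,Y}\,c_{X\boxtimes Y,Z}\,\alpha_{X,Y,Z}=d\lambda .$$ It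 is *perfect* if for all objects $x,y$ of $\mathscr T$ the right module $\Gamma(x,y;-)$, and for all perfect right modules $X,Y$ the right module $X\boxtimes Y$, is isomorphic in $Ho(\mathscr T^{op}\text{-Mod})$ to a perfect module. For a morphism $f$ of left modules let $f\otimes\Gamma$ be the morphism of $\mathscr T\otimes\mathscr T$-modules obtained by tensoring with $\Gamma$ over its contravariant variable. For a morphism $g$ of right modules let $\Gamma\otimes g$ be the morphism of $\mathscr T\otimes\mathscr T^{op}$-modules obtained by tensoring $g$ with $\Gamma$ over one of its two covariant variables; the claims below hold for either choice. **Theorem.** Let $\Gamma$ be a perfect pseudo dg-tensor structure on $\mathscr T$. (A) Let $f$ be a morphism between cofibrant left $\mathscr T$-modules, and $H^0(-)$ the passage to the homotopy category $H^0(\text{Mod})$. Then 1. $f\otimes\Gamma\simeq 0$ if and only if $f\simeq 0$; 2. $H^0(f\otimes\Gamma)$ is an isomorphism if and only if $H^0(f)$ is; 3. $H^0(f\otimes\Gamma)$ is an epimorphism if and only if $H^0(f)$ is. For a morphism $g$ between cofibrant right $\mathscr T$-modules the same three equivalences hold with $\Gamma\otimes g$ and $g$ in place of $f\otimes\Gamma$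 and $f$. (B) Suppose that $U$ is cofibrant. Let $f:M\to N$ be an arbitrary morphism of left $\mathscr T$-modules, $P\to M$ and $Q\to N$ quasi-isomorphisms with $P,Q$ cofibrant, and $\tilde f:P\to Q$ a morphism for which the square with $f$ commutes up to homotopy. Then in the derived categories $Ho$: $\tilde f\otimes\Gamma=0$ if and only if $f=0$; $\tilde f\otimes\Gamma$ is an isomorphism if and only if $f$ is; $\tilde f\otimes\Gamma$ is an epimorphism if and only if $f$ is. The same holds for arbitrary morphisms $g$ of right $\mathscr T$-modules and $\Gamma\otimes\tilde g$. -/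

import Mathlib

open CategoryTheory Limits

universe u

namespace DG

noncomputable section

/-- Cochain complexes of `k`-modules. -/
abbrev Cplx (k : Type u) [CommRing k] := CochainComplex (ModuleCat.{u} k) ℤ

variable {k : Type u} [CommRing k]

/-- The differential `K^n → K^(n+1)`. -/
def dif (K : Cplx k) (n : ℤ) : K.X n →ₗ[k] K.X (n + 1) := (K.d n (n + 1)).hom

lemma dif_dif (K : Cplx k) (n : ℤ) (x : K.X n) : dif K (n + 1) (dif K n x) = 0 := by
  have := K.d_comp_d n (n + 1) (n + 1 + 1)
  exact congrArg (fun f => f.hom x) this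

/-- The sign `(-1)^n` in `k`. -/
def sgn (k : Type u) [CommRing k] (n : ℤ) : k := ((n.negOnePow : ℤˣ) : ℤ)

lemma sgn_add (m n : ℤ) : sgn k (m + n) = sgn k m * sgn k n := by
  simp [sgn, Int.negOnePow_add]

lemma sgn_mul_self (n : ℤ) : sgn k n * sgn k n = 1 := by
  rw [sgn, ← Int.cast_mul, ← Units.val_mul, Int.units_mul_self, Units.val_one, Int.cast_one]

@[simp] lemma sgn_zero : sgn k 0 = 1 := by simp [sgn]

@[simp] lemma sgn_one : sgn k 1 = -1 := by simp [sgn]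

/-- The tensor product over `k` of complexes, with differential
`d (a ⊗ b) = da ⊗ b + (-1)^|a| a ⊗ db`. -/
abbrev tens (K L : Cplx k) : Cplx k := HomologicalComplex.tensorObj K L

/-- The homogeneous tensor `a ⊗ b`. -/
def tmul {K L : Cplx k} {p q n : ℤ} (h : p + q = n) :
    K.X p →ₗ[k] L.X q →ₗ[k] (tens K L).X n :=
  (TensorProduct.mk k (K.X p) (L.X q)).compr₂ (HomologicalComplex.ιTensorObj K L p q n h).hom

/-- Linear maps out of `(K ⊗ L)^n` from families of bilinear maps. -/
def tlift {K L : Cplx k} {n : ℤ} {V : Type u} [AddCommGroup V] [Module k V]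
    (φ : ∀ p q : ℤ, p + q = n → (K.X p →ₗ[k] L.X q →ₗ[k] V)) : (tens K L).X n →ₗ[k] V :=
  (HomologicalComplex.mapBifunctorDesc (A := ModuleCat.of k V)
    (fun p q h => ModuleCat.ofHom (TensorProduct.lift (φ p q h)))).hom

@[simp] lemma tlift_tmul {K L : Cplx k} {n : ℤ} {V : Type u} [AddCommGroup V] [Module k V]
    (φ : ∀ p q : ℤ, p + q = n → (K.X p →ₗ[k] L.X q →ₗ[k] V)) {p q : ℤ} (h : p + q = n)
    (a : K.X p) (b : L.X q) : tlift φ (tmul h a b) = φ p q h a b := by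
  have := HomologicalComplex.ι_mapBifunctorDesc (K₁ := K) (K₂ := L)
    (F := MonoidalCategory.curriedTensor (ModuleCat.{u} k))
    (c := ComplexShape.up ℤ) (A := ModuleCat.of k V)
    (fun p q h => ModuleCat.ofHom (TensorProduct.lift (φ p q h))) p q h
  have h2 := congrArg (fun f => f.hom (a ⊗ₜ[k] b)) this
  exact h2

lemma tens_ext {K L : Cplx k} {n : ℤ} {V : Type u} [AddCommGroup V] [Module k V]
    {f g : (tens K L).X n →ₗ[k] V}
    (H : ∀ p q (h : p + q = n) (a : K.X p) (b : L.X q), f (tmul h a b) = g (tmul h a b)) :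
    f = g := by
  have : ModuleCat.ofHom f = ModuleCat.ofHom g := by
    apply HomologicalComplex.mapBifunctor.hom_ext
    intro p q h
    apply ModuleCat.hom_ext
    apply TensorProduct.ext'
    intro a b
    exact H p q h a b
  exact congrArg ModuleCat.Hom.hom this

lemma dif_tmul {K L : Cplx k} {p q n : ℤ} (h : p + q = n) (a : K.X p) (b : L.X q) :
    dif (tens K L) n (tmul h a b) =
      tmul (by omega) (dif K p a) b + sgn k p • tmul (by omega) a (dif L q b) := by
  have h1 : HomologicalComplex.ιTensorObj K L p q n h ≫ (tens K L).d n (n + 1) =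
      HomologicalComplex.mapBifunctor.d₁ K L
        (MonoidalCategory.curriedTensor (ModuleCat.{u} k)) (ComplexShape.up ℤ) p q (n + 1) +
      HomologicalComplex.mapBifunctor.d₂ K L
        (MonoidalCategory.curriedTensor (ModuleCat.{u} k)) (ComplexShape.up ℤ) p q (n + 1) := by
    rw [HomologicalComplex.mapBifunctor.d_eq, Preadditive.comp_add,
      HomologicalComplex.mapBifunctor.ι_D₁, HomologicalComplex.mapBifunctor.ι_D₂]
  rw [HomologicalComplex.mapBifunctor.d₁_eq K L
      (MonoidalCategory.curriedTensor (ModuleCat.{u} k)) (ComplexShape.up ℤ)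
      (show (ComplexShape.up ℤ).Rel p (p + 1) from rfl) q (n + 1) (show p + 1 + q = n + 1 by omega),
    HomologicalComplex.mapBifunctor.d₂_eq K L
      (MonoidalCategory.curriedTensor (ModuleCat.{u} k)) (ComplexShape.up ℤ) p
      (show (ComplexShape.up ℤ).Rel q (q + 1) from rfl) (n + 1)
      (show p + (q + 1) = n + 1 by omega)] at h1
  have h2 := congrArg (fun f => f.hom (a ⊗ₜ[k] b)) h1
  refine h2.trans ?_
  change ((1 : ℤˣ) • tmul _ (dif K p a) b) + (p.negOnePow • tmul _ a (dif L q b)) = _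
  rw [one_smul, Units.smul_def, sgn, Int.cast_smul_eq_zsmul]
  

/-- A small dg-category over `k`: a category enriched in cochain complexes of `k`-modules.
`comp h g f` is the composite `g ∘ f`. -/
structure DGCat (k : Type u) [CommRing k] where
  Obj : Type u
  Hom : Obj → Obj → Cplx k
  one : ∀ x, (Hom x x).X 0
  comp : ∀ {x y z : Obj} {i j n : ℤ}, i + j = n →
    ((Hom y z).X i →ₗ[k] (Hom x y).X j →ₗ[k] (Hom x z).X n)
  dif_one : ∀ x, dif (Hom x x) 0 (one x) = 0
  dif_comp : ∀ {x y z : Obj} {i j n : ℤ} (h : i + j = n) (g : (Hom y z).X i) (f : (Hom x y).X j),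
    dif (Hom x z) n (comp h g f) =
      comp (by omega) (dif (Hom y z) i g) f + sgn k i • comp (by omega) g (dif (Hom x y) j f)
  one_comp : ∀ {x y : Obj} {j : ℤ} (f : (Hom x y).X j), comp (zero_add j) (one y) f = f
  comp_one : ∀ {x y : Obj} {j : ℤ} (f : (Hom x y).X j), comp (add_zero j) f (one x) = f
  assoc : ∀ {w x y z : Obj} {a b c ab bc n : ℤ} (h₁ : a + b = ab) (h₂ : ab + c = n)
    (h₃ : b + c = bc) (h₄ : a + bc = n) (f : (Hom y z).X a) (g : (Hom x y).X b)
    (e : (Hom w x).X c), comp h₂ (comp h₁ f g) e = comp h₄ f (comp h₃ g e)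

/-- The opposite dg-category: `f ∘ᵒᵖ g = (-1)^(|f||g|) g ∘ f`. -/
abbrev DGCat.op (A : DGCat k) : DGCat k where
  Obj := A.Obj
  Hom x y := A.Hom y x
  one x := A.one x
  comp {x y z i j n} h := sgn k (i * j) • (A.comp (show j + i = n by omega)).flip
  dif_one := A.dif_one
  dif_comp {x y z i j n} h g f := by
    simp only [LinearMap.smul_apply, LinearMap.flip_apply, map_smul, A.dif_comp, smul_add,
      smul_smul]
    have e1 : sgn k (i * j) * sgn k j = sgn k ((i + 1) * j) := by rw [add_mul, sgn_add, one_mul]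
    have e2 : sgn k i * sgn k (i * (j + 1)) = sgn k (i * j) := by
      rw [mul_add, sgn_add, mul_one, mul_comm, mul_assoc, sgn_mul_self, mul_one]
    rw [e1, e2, add_comm (sgn k (i * j) • _)]
  one_comp {x y j} f := by simp [A.comp_one]
  comp_one {x y j} f := by simp [A.one_comp]
  assoc {w x y z a b c ab bc n} h₁ h₂ h₃ h₄ f g e := by
    simp only [LinearMap.smul_apply, LinearMap.flip_apply, map_smul, smul_smul]
    rw [A.assoc (show c + b = bc by omega) (show bc + a = n by omega) (show b + a = ab by omega)
      (show c + ab = n by omega)]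
    subst h₁ h₃
    congr 1
    simp only [add_mul, mul_add, sgn_add]
    ring

/-- Composition in the tensor product of dg-categories:
`(g ⊗ g') ∘ (f ⊗ f') = (-1)^(|g'||f|) (g ∘ f) ⊗ (g' ∘ f')`. -/
def tensorComp (A B : DGCat k) {x y z : A.Obj × B.Obj} {i j n : ℤ} (h : i + j = n) :
    (tens (A.Hom y.1 z.1) (B.Hom y.2 z.2)).X i →ₗ[k] (tens (A.Hom x.1 y.1) (B.Hom x.2 y.2)).X j
      →ₗ[k] (tens (A.Hom x.1 z.1) (B.Hom x.2 z.2)).X n :=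
  tlift fun p p' hp =>
    LinearMap.mk₂ k (fun g g' => tlift fun q q' hq =>
      LinearMap.mk₂ k (fun f f' => sgn k (p' * q) •
          tmul (show (p + q) + (p' + q') = n by omega) (A.comp rfl g f) (B.comp rfl g' f'))
        (fun _ _ _ => by simp only [map_add, LinearMap.add_apply, smul_add])
        (fun _ _ _ => by simp only [map_smul, LinearMap.smul_apply, smul_comm (sgn k (p' * q))])
        (fun _ _ _ => by simp only [map_add, smul_add])
        (fun _ _ _ => by simp only [map_smul, smul_comm (sgn k (p' * q))]))
      (fun _ _ _ => by
        apply tens_ext; intros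
        simp only [tlift_tmul, LinearMap.mk₂_apply, map_add, LinearMap.add_apply, smul_add])
      (fun _ _ _ => by
        apply tens_ext; intros
        simp only [tlift_tmul, LinearMap.mk₂_apply, map_smul, LinearMap.smul_apply]
        rw [smul_comm])
      (fun _ _ _ => by
        apply tens_ext; intros
        simp only [tlift_tmul, LinearMap.mk₂_apply, map_add, LinearMap.add_apply, smul_add])
      (fun _ _ _ => by
        apply tens_ext; intros
        simp only [tlift_tmul, LinearMap.mk₂_apply, map_smul, LinearMap.smul_apply]
        rw [smul_comm])

lemma tensorComp_tmul (A B : DGCat k) {x y z : A.Obj × B.Obj} {i j n p p' q q' r r' : ℤ}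
    (h : i + j = n) (hp : p + p' = i) (hq : q + q' = j) (hr : p + q = r) (hr' : p' + q' = r')
    (g : (A.Hom y.1 z.1).X p) (g' : (B.Hom y.2 z.2).X p')
    (f : (A.Hom x.1 y.1).X q) (f' : (B.Hom x.2 y.2).X q') :
    tensorComp A B h (tmul hp g g') (tmul hq f f') =
      sgn k (p' * q) • tmul (by omega) (A.comp hr g f) (B.comp hr' g' f') := by
  subst hr hr'
  simp only [tensorComp, tlift_tmul, LinearMap.mk₂_apply]

/-- Bilinear maps out of two tensor products agree when they agree on pure tensors. -/
lemma tens_ext₂ {K L K' L' : Cplx k} {i j : ℤ} {V : Type u} [AddCommGroup V] [Module k V]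
    {F G : (tens K L).X i →ₗ[k] (tens K' L').X j →ₗ[k] V}
    (H : ∀ p q (h : p + q = i) p' q' (h' : p' + q' = j) (a : K.X p) (b : L.X q) (a' : K'.X p')
      (b' : L'.X q'), F (tmul h a b) (tmul h' a' b') = G (tmul h a b) (tmul h' a' b')) :
    F = G :=
  tens_ext fun p q h a b => tens_ext fun p' q' h' a' b' => H p q h p' q' h' a b a' b'

/-- Elements of a tensor product satisfy any property closed under sums
which holds for pure tensors. -/
lemma tens_induction {K L : Cplx k} {n : ℤ} {P : (tens K L).X n → Prop}
    (h0 : P 0) (hadd : ∀ x y, P x → P y → P (x + y))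
    (H : ∀ p q (h : p + q = n) (a : K.X p) (b : L.X q), P (tmul h a b)) (x) : P x := by
  let S : Submodule k ((tens K L).X n) := Submodule.span k
    {x | ∃ p q, ∃ (h : p + q = n) (a : K.X p) (b : L.X q), x = tmul h a b}
  have hS : S.mkQ = 0 := tens_ext fun p q h a b => by
    have : tmul h a b ∈ S := Submodule.subset_span ⟨p, q, h, a, b, rfl⟩
    simpa using this
  have hx : x ∈ S := by
    have := LinearMap.congr_fun hS x
    simpa using this
  induction hx using Submodule.closure_induction with
  | zero => exact h0
  | add x y _ _ h1 h2 => exact hadd x y h1 h2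
  | smul_mem r x hx =>
    obtain ⟨p, q, h, a, b, rfl⟩ := hx
    have := H p q h (r • a) b
    simpa using this

/-- The tensor product `A ⊗ B` of dg-categories. -/
abbrev DGCat.tensor (A B : DGCat k) : DGCat k where
  Obj := A.Obj × B.Obj
  Hom x y := tens (A.Hom x.1 y.1) (B.Hom x.2 y.2)
  one x := tmul (zero_add 0) (A.one x.1) (B.one x.2)
  comp h := tensorComp A B h
  dif_one x := by
    rw [dif_tmul, A.dif_one, B.dif_one]
    simp
  dif_comp {x y z i j n} h g f := by
    induction g using tens_induction with
    | h0 => simp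
    | hadd g₁ g₂ h₁ h₂ =>
      simp only [map_add, LinearMap.add_apply, smul_add, h₁, h₂]
      abel
    | H p p' hp g g' =>
    induction f using tens_induction with
    | h0 => simp
    | hadd g₁ g₂ h₁ h₂ =>
      simp only [map_add, smul_add, h₁, h₂]
      abel
    | H q q' hq f f' =>
    rw [tensorComp_tmul A B h hp hq rfl rfl]
    simp only [dif_tmul, map_smul, map_add, LinearMap.add_apply, LinearMap.smul_apply,
      A.dif_comp, B.dif_comp, smul_add, smul_smul]
    rw [tensorComp_tmul A B _ _ hq (show p + 1 + q = p + q + 1 by omega) rfl,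
      tensorComp_tmul A B _ _ hq rfl (show p' + 1 + q' = p' + q' + 1 by omega),
      tensorComp_tmul A B _ hp _ (show p + (q + 1) = p + q + 1 by omega) rfl,
      tensorComp_tmul A B _ hp _ rfl (show p' + (q' + 1) = p' + q' + 1 by omega)]
    have hi : sgn k i = sgn k p * sgn k p' := by rw [← hp, sgn_add]
    simp only [smul_smul, add_mul, mul_add, sgn_add, one_mul, mul_one, hi]
    have e1 : sgn k p * sgn k p' * (sgn k (p' * q) * sgn k p') =
        sgn k (p' * q) * sgn k p := by
      linear_combination (sgn k p * sgn k (p' * q)) * sgn_mul_self (k := k) p'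
    simp only [e1]
    match_scalars <;> ring
  one_comp {x y j} f := by
    induction f using tens_induction with
    | h0 => simp
    | hadd g₁ g₂ h₁ h₂ => rw [map_add, h₁, h₂]
    | H q q' hq f f' =>
    rw [tensorComp_tmul A B _ _ hq (zero_add q) (zero_add q'), A.one_comp, B.one_comp]
    simp
  comp_one {x y j} f := by
    induction f using tens_induction with
    | h0 => simp
    | hadd g₁ g₂ h₁ h₂ => rw [map_add, LinearMap.add_apply, h₁, h₂]
    | H q q' hq f f' =>
    rw [tensorComp_tmul A B _ hq _ (add_zero q) (add_zero q'), A.comp_one, B.comp_one]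
    simp
  assoc {w x y z a b c ab bc n} h₁ h₂ h₃ h₄ f g e := by
    induction f using tens_induction with
    | h0 => simp
    | hadd g₁ g₂ h₁ h₂ => simp only [map_add, LinearMap.add_apply, h₁, h₂]
    | H p p' hp f f' =>
    induction g using tens_induction with
    | h0 => simp
    | hadd g₁ g₂ h₁ h₂ => simp only [map_add, LinearMap.add_apply, h₁, h₂]
    | H q q' hq g g' =>
    induction e using tens_induction with
    | h0 => simp
    | hadd g₁ g₂ h₁ h₂ => simp only [map_add, h₁, h₂]
    | H r r' hr e e' =>
    rw [tensorComp_tmul A B _ hp hq rfl rfl, tensorComp_tmul A B _ hq hr rfl rfl]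
    simp only [map_smul, LinearMap.smul_apply]
    rw [tensorComp_tmul A B _ _ hr rfl rfl,
      tensorComp_tmul A B _ hp _ (show p + (q + r) = p + q + r by omega)
        (show p' + (q' + r') = p' + q' + r' by omega),
      A.assoc _ _ rfl (show p + (q + r) = p + q + r by omega),
      B.assoc _ _ rfl (show p' + (q' + r') = p' + q' + r' by omega)]
    simp only [smul_smul, add_mul, mul_add, sgn_add]
    congr 1
    ring

/-- A dg-functor. -/
structure DGFunctor (A B : DGCat k) where
  obj : A.Obj → B.Obj
  map : ∀ {x y : A.Obj} {n : ℤ}, (A.Hom x y).X n →ₗ[k] (B.Hom (obj x) (obj y)).X n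
  map_dif : ∀ {x y : A.Obj} {n : ℤ} (f : (A.Hom x y).X n),
    map (dif (A.Hom x y) n f) = dif (B.Hom (obj x) (obj y)) n (map f)
  map_one : ∀ x, map (A.one x) = B.one (obj x)
  map_comp : ∀ {x y z : A.Obj} {i j n : ℤ} (h : i + j = n) (g : (A.Hom y z).X i)
    (f : (A.Hom x y).X j), map (A.comp h g f) = B.comp h (map g) (map f)

namespace DGFunctor

/-- Composition of dg-functors. -/
abbrev comp {A B C : DGCat k} (G : DGFunctor B C) (F : DGFunctor A B) : DGFunctor A C where
  obj x := G.obj (F.obj x)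
  map := G.map ∘ₗ F.map
  map_dif f := by simp only [LinearMap.comp_apply, F.map_dif, G.map_dif]
  map_one x := by simp only [LinearMap.comp_apply, F.map_one, G.map_one]
  map_comp h g f := by simp only [LinearMap.comp_apply, F.map_comp, G.map_comp]

/-- The identification of the double opposite with the original dg-category. -/
abbrev fromOpOp (A : DGCat k) : DGFunctor A.op.op A where
  obj x := x
  map := LinearMap.id
  map_dif _ := rfl
  map_one _ := rfl
  map_comp {x y z i j n} h g f := by
    change sgn k (i * j) • sgn k (j * i) • A.comp _ g f = _
    rw [smul_smul, mul_comm j i, sgn_mul_self, one_smul]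
    rfl

/-- `a ↦ a ⊗ 1_b` on morphisms. -/
def inlMap (A B : DGCat k) (b : B.Obj) {x y : A.Obj} (n : ℤ) :
    (A.Hom x y).X n →ₗ[k] (tens (A.Hom x y) (B.Hom b b)).X n :=
  (tmul (add_zero n)).flip (B.one b)

lemma inlMap_apply (A B : DGCat k) (b : B.Obj) {x y : A.Obj} {n : ℤ} (f : (A.Hom x y).X n) :
    inlMap A B b n f = tmul (add_zero n) f (B.one b) := rfl

lemma inlMap_dif (A B : DGCat k) (b : B.Obj) {x y : A.Obj} {n : ℤ} (f : (A.Hom x y).X n) :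
    inlMap A B b (n + 1) (dif (A.Hom x y) n f) =
      dif (tens (A.Hom x y) (B.Hom b b)) n (inlMap A B b n f) := by
  rw [inlMap_apply, inlMap_apply, dif_tmul, B.dif_one]
  simp

/-- `b ↦ 1_a ⊗ b` on morphisms. -/
def inrMap (A B : DGCat k) (a : A.Obj) {x y : B.Obj} (n : ℤ) :
    (B.Hom x y).X n →ₗ[k] (tens (A.Hom a a) (B.Hom x y)).X n :=
  tmul (zero_add n) (A.one a)

lemma inrMap_apply (A B : DGCat k) (a : A.Obj) {x y : B.Obj} {n : ℤ} (f : (B.Hom x y).X n) :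
    inrMap A B a n f = tmul (zero_add n) (A.one a) f := rfl

lemma inrMap_dif (A B : DGCat k) (a : A.Obj) {x y : B.Obj} {n : ℤ} (f : (B.Hom x y).X n) :
    inrMap A B a (n + 1) (dif (B.Hom x y) n f) =
      dif (tens (A.Hom a a) (B.Hom x y)) n (inrMap A B a n f) := by
  rw [inrMap_apply, inrMap_apply, dif_tmul, A.dif_one]
  simp

lemma inrMap_comp (A B : DGCat k) (a : A.Obj) {x y z : B.Obj} {i j n : ℤ} (h : i + j = n)
    (g : (B.Hom y z).X i) (f : (B.Hom x y).X j) :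
    inrMap A B a n (B.comp h g f) = tensorComp A B (x := (a, x)) (y := (a, y)) (z := (a, z)) h
      (inrMap A B a i g) (inrMap A B a j f) := by
  rw [inrMap_apply, inrMap_apply, inrMap_apply]
  rw [tensorComp_tmul A B h _ _ (add_zero 0) h]
  rw [A.one_comp]
  simp

/-- `a ↦ a ⊗ 1_b`. -/
abbrev inl (A B : DGCat k) (b : B.Obj) : DGFunctor A (A.tensor B) where
  obj x := (x, b)
  map {x y n} := inlMap A B b n
  map_dif f := inlMap_dif A B b f
  map_one _ := rfl
  map_comp {x y z i j n} h g f := by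
    rw [inlMap_apply, inlMap_apply, inlMap_apply]
    rw [tensorComp_tmul A B h _ _ h (add_zero 0)]
    rw [B.one_comp]
    simp

/-- `b ↦ 1_a ⊗ b`. -/
abbrev inr (A B : DGCat k) (a : A.Obj) : DGFunctor B (A.tensor B) where
  obj x := (a, x)
  map {x y n} := inrMap A B a n
  map_dif f := inrMap_dif A B a f
  map_one _ := rfl
  map_comp h g f := inrMap_comp A B a h g f

/-- The symmetry `a ⊗ b ↦ (-1)^(|a||b|) b ⊗ a`. -/
abbrev swap (A B : DGCat k) : DGFunctor (A.tensor B) (B.tensor A) where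
  obj x := (x.2, x.1)
  map {x y n} := tlift fun p q h => sgn k (p * q) • (tmul (show q + p = n by omega)).flip
  map_dif {x y n} f := by
    induction f using tens_induction with
    | h0 => simp
    | hadd g₁ g₂ h₁ h₂ => simp only [map_add, h₁, h₂]
    | H p q h a b =>
    simp only [dif_tmul, tlift_tmul, map_add, map_smul, LinearMap.smul_apply,
      LinearMap.flip_apply, smul_add, smul_smul, add_mul, mul_add, sgn_add, one_mul, mul_one]
    have e1 : sgn k p * (sgn k (p * q) * sgn k p) = sgn k (p * q) := by
      linear_combination sgn k (p * q) * sgn_mul_self (k := k) p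
    rw [e1]
    exact add_comm _ _
  map_one x := by
    simp only [tlift_tmul, LinearMap.smul_apply, LinearMap.flip_apply]
    simp
  map_comp {x y z i j n} h g f := by
    induction g using tens_induction with
    | h0 => simp
    | hadd g₁ g₂ h₁ h₂ => simp only [map_add, LinearMap.add_apply, h₁, h₂]
    | H p p' hp g g' =>
    induction f using tens_induction with
    | h0 => simp
    | hadd g₁ g₂ h₁ h₂ => simp only [map_add, h₁, h₂]
    | H q q' hq f f' =>
    simp only [tlift_tmul, LinearMap.smul_apply, LinearMap.flip_apply, map_smul]
    rw [tensorComp_tmul A B h hp hq rfl rfl, tensorComp_tmul B A h _ _ rfl rfl]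
    simp only [map_smul, tlift_tmul, LinearMap.smul_apply, LinearMap.flip_apply, smul_smul,
      add_mul, mul_add, sgn_add]
    congr 1
    rw [mul_comm q p']
    linear_combination (sgn k (p * p') * sgn k (p * q') * sgn k (q * q')) *
      sgn_mul_self (k := k) (p' * q)

/-- The associativity isomorphism `(a ⊗ b) ⊗ c ↦ a ⊗ (b ⊗ c)`. -/
def assocMap (K L M : Cplx k) (n : ℤ) : (tens (tens K L) M).X n →ₗ[k] (tens K (tens L M)).X n :=
  tlift fun p r h => tlift fun q q' h' => LinearMap.mk₂ k
    (fun a b => (tmul (show q + (q' + r) = n by omega) a) ∘ₗ (tmul rfl b))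
    (fun _ _ _ => by ext; simp) (fun _ _ _ => by ext; simp)
    (fun _ _ _ => by ext; simp) (fun _ _ _ => by ext; simp)

lemma assocMap_tmul {K L M : Cplx k} {n p q r pq qr : ℤ} (h : p + q = pq) (h' : pq + r = n)
    (h'' : q + r = qr) (a : K.X p) (b : L.X q) (c : M.X r) :
    assocMap K L M n (tmul h' (tmul h a b) c) = tmul (by omega) a (tmul h'' b c) := by
  subst h''
  simp only [assocMap, tlift_tmul, LinearMap.mk₂_apply, LinearMap.comp_apply]

set_option maxHeartbeats 1000000 in
lemma assoc_comp_tmul (A B C : DGCat k) {x y z : (A.Obj × B.Obj) × C.Obj}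
    {i j n s p q r s' p' q' r' : ℤ} (h : i + j = n)
    (hs : s + r = i) (hp : p + q = s) (hs' : s' + r' = j) (hp' : p' + q' = s')
    (a : (A.Hom y.1.1 z.1.1).X p) (b : (B.Hom y.1.2 z.1.2).X q) (c : (C.Hom y.2 z.2).X r)
    (a' : (A.Hom x.1.1 y.1.1).X p') (b' : (B.Hom x.1.2 y.1.2).X q') (c' : (C.Hom x.2 y.2).X r') :
    assocMap (A.Hom x.1.1 z.1.1) (B.Hom x.1.2 z.1.2) (C.Hom x.2 z.2) n
      (tensorComp (A.tensor B) C (x := x) (y := y) (z := z) h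
        (tmul hs (tmul hp a b) c) (tmul hs' (tmul hp' a' b') c')) =
    tensorComp A (B.tensor C) (x := (x.1.1, (x.1.2, x.2))) (y := (y.1.1, (y.1.2, y.2)))
      (z := (z.1.1, (z.1.2, z.2))) h
      (assocMap (A.Hom y.1.1 z.1.1) (B.Hom y.1.2 z.1.2) (C.Hom y.2 z.2) i
        (tmul hs (tmul hp a b) c))
      (assocMap (A.Hom x.1.1 y.1.1) (B.Hom x.1.2 y.1.2) (C.Hom x.2 y.2) j
        (tmul hs' (tmul hp' a' b') c')) := by
  rw [assocMap_tmul hp hs rfl a b c, assocMap_tmul hp' hs' rfl a' b' c']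
  have e1 := tensorComp_tmul (A.tensor B) C (x := x) (y := y) (z := z) h hs hs' rfl rfl
    (tmul hp a b) c (tmul hp' a' b') c'
  have e2 := tensorComp_tmul A (B.tensor C) (x := (x.1.1, (x.1.2, x.2)))
    (y := (y.1.1, (y.1.2, y.2))) (z := (z.1.1, (z.1.2, z.2))) h
    (show p + (q + r) = i by omega) (show p' + (q' + r') = j by omega) rfl rfl
    a (tmul rfl b c) a' (tmul rfl b' c')
  have e3 : (A.tensor B).comp (x := x.1) (y := y.1) (z := z.1) (rfl : s + s' = s + s')
    (tmul hp a b) (tmul hp' a' b') = _ := tensorComp_tmul A B (x := x.1) (y := y.1) (z := z.1) (rfl : s + s' = s + s')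
    hp hp' rfl rfl a b a' b'
  have e4 : (B.tensor C).comp (x := (x.1.2, x.2)) (y := (y.1.2, y.2)) (z := (z.1.2, z.2))
    (rfl : q + r + (q' + r') = q + r + (q' + r')) (tmul rfl b c) (tmul rfl b' c') = _ :=
    tensorComp_tmul B C (x := (x.1.2, x.2)) (y := (y.1.2, y.2)) (z := (z.1.2, z.2))
    (rfl : q + r + (q' + r') = q + r + (q' + r')) rfl rfl rfl rfl b c b' c'
  rw [e1, e2, e3, e4]
  simp only [map_smul, LinearMap.smul_apply]
  rw [assocMap_tmul _ _ (show q + q' + (r + r') = q + r + (q' + r') by omega)]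
  have hs2 : s' = p' + q' := hp'.symm
  have e5 : sgn k (r * s') = sgn k (r * p') * sgn k (r * q') := by
    rw [hs2, mul_add, sgn_add]
  simp only [smul_smul, e5, add_mul, sgn_add]
  congr 1
  ring

/-- The associativity isomorphism `(a ⊗ b) ⊗ c ↦ a ⊗ (b ⊗ c)`. -/
abbrev assoc (A B C : DGCat k) :
    DGFunctor ((A.tensor B).tensor C) (A.tensor (B.tensor C)) where
  obj x := (x.1.1, (x.1.2, x.2))
  map {x y n} := assocMap _ _ _ n
  map_dif {x y n} f := by
    induction f using tens_induction with
    | h0 => simp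
    | hadd g₁ g₂ h₁ h₂ => simp only [map_add, h₁, h₂]
    | H p' r h e c =>
    induction e using tens_induction with
    | h0 => simp
    | hadd g₁ g₂ h₁ h₂ => simp only [map_add, LinearMap.add_apply, h₁, h₂]
    | H p q hp a b =>
    rw [assocMap_tmul hp h rfl]
    simp only [dif_tmul, map_add, map_smul, LinearMap.add_apply, LinearMap.smul_apply]
    rw [assocMap_tmul _ _ rfl, assocMap_tmul _ _ (show q + 1 + r = q + r + 1 by omega),
      assocMap_tmul _ _ (show q + (r + 1) = q + r + 1 by omega)]
    have hpq : sgn k p' = sgn k p * sgn k q := by rw [← hp, sgn_add]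
    simp only [smul_add, smul_smul, add_assoc, hpq]
  map_one x := by
    rw [assocMap_tmul _ _ (add_zero 0)]
  map_comp {x y z i j n} h g f := by
    induction g using tens_induction with
    | h0 => simp
    | hadd g₁ g₂ h₁ h₂ => simp only [map_add, LinearMap.add_apply, h₁, h₂]
    | H p r hp e c =>
    induction e using tens_induction with
    | h0 => simp
    | hadd g₁ g₂ h₁ h₂ => simp only [map_add, LinearMap.add_apply, h₁, h₂]
    | H p q hpq a b =>
    induction f using tens_induction with
    | h0 => simp
    | hadd g₁ g₂ h₁ h₂ => simp only [map_add, h₁, h₂]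
    | H p' r' hp' e' c' =>
    induction e' using tens_induction with
    | h0 => simp
    | hadd g₁ g₂ h₁ h₂ => simp only [map_add, LinearMap.add_apply, h₁, h₂]
    | H p' q' hpq' a' b' =>
    exact assoc_comp_tmul A B C h hp hpq hp' hpq' a b c a' b' c'

/-- The dg-functor `1 ⊗ F`. -/
abbrev whiskerLeft (A : DGCat k) {B B' : DGCat k} (F : DGFunctor B B') :
    DGFunctor (A.tensor B) (A.tensor B') where
  obj x := (x.1, F.obj x.2)
  map {x y n} := tlift fun p q h => (tmul h).compl₂ F.map
  map_dif {x y n} f := by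
    induction f using tens_induction with
    | h0 => simp
    | hadd g₁ g₂ h₁ h₂ => simp only [map_add, h₁, h₂]
    | H p q h a b =>
    simp only [dif_tmul, tlift_tmul, map_add, map_smul, LinearMap.compl₂_apply,
      F.map_dif]
  map_one x := by
    simp only [tlift_tmul, LinearMap.compl₂_apply, F.map_one]
  map_comp {x y z i j n} h g f := by
    induction g using tens_induction with
    | h0 => simp
    | hadd g₁ g₂ h₁ h₂ => simp only [map_add, LinearMap.add_apply, h₁, h₂]
    | H p p' hp g g' =>
    induction f using tens_induction with
    | h0 => simp
    | hadd g₁ g₂ h₁ h₂ => simp only [map_add, h₁, h₂]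
    | H q q' hq f f' =>
    simp only [tlift_tmul, LinearMap.compl₂_apply]
    rw [tensorComp_tmul A B h hp hq rfl rfl, tensorComp_tmul A B' h hp hq rfl rfl]
    simp only [map_smul, tlift_tmul, LinearMap.compl₂_apply, F.map_comp]

/-- The permutation `c ⊗ (a ⊗ b) ↦ ± a ⊗ (b ⊗ c)`. -/
abbrev rotate (A B C : DGCat k) : DGFunctor (C.tensor (A.tensor B)) (A.tensor (B.tensor C)) :=
  (assoc A B C).comp (swap C (A.tensor B))

/-- The permutation `b ⊗ (a ⊗ c) ↦ ± a ⊗ (b ⊗ c)`. -/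
abbrev exchange (A B C : DGCat k) : DGFunctor (B.tensor (A.tensor C)) (A.tensor (B.tensor C)) :=
  (whiskerLeft A (swap C B)).comp (rotate A C B)

end DGFunctor

/-- A (left) dg-module over `A`: a dg-functor from `A` to complexes of `k`-modules, given by
complexes `M(x)` and actions `A(x,y) ⊗ M(x) → M(y)`. Right dg-modules over `A` are dg-modules
over `A.op`. -/
structure DGMod (A : DGCat k) where
  obj : A.Obj → Cplx k
  act : ∀ {x y : A.Obj} {i j n : ℤ}, i + j = n →
    ((A.Hom x y).X i →ₗ[k] (obj x).X j →ₗ[k] (obj y).X n)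
  dif_act : ∀ {x y : A.Obj} {i j n : ℤ} (h : i + j = n) (a : (A.Hom x y).X i) (m : (obj x).X j),
    dif (obj y) n (act h a m) =
      act (by omega) (dif (A.Hom x y) i a) m + sgn k i • act (by omega) a (dif (obj x) j m)
  one_act : ∀ {x : A.Obj} {j : ℤ} (m : (obj x).X j), act (zero_add j) (A.one x) m = m
  comp_act : ∀ {x y z : A.Obj} {a b c ab bc n : ℤ} (h₁ : a + b = ab) (h₂ : ab + c = n)
    (h₃ : b + c = bc) (h₄ : a + bc = n) (f : (A.Hom y z).X a) (g : (A.Hom x y).X b)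
    (m : (obj x).X c), act h₂ (A.comp h₁ f g) m = act h₄ f (act h₃ g m)

namespace DGMod

variable {A : DGCat k}

/-- A morphism of dg-modules: a closed natural transformation of degree `0`. -/
@[ext] structure Hom (M N : DGMod A) where
  app : ∀ x, M.obj x ⟶ N.obj x
  comm : ∀ {x y : A.Obj} {i j n : ℤ} (h : i + j = n) (a : (A.Hom x y).X i) (m : (M.obj x).X j),
    ((app y).f n).hom (M.act h a m) = N.act h a (((app x).f j).hom m)

/-- The category of dg-modules and closed morphisms of degree `0`. -/
instance : Category (DGMod A) where
  Hom := Hom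
  id M := { app := fun x => 𝟙 _, comm := fun _ _ _ => rfl }
  comp f g :=
    { app := fun x => f.app x ≫ g.app x
      comm := fun h a m => by
        simp only [HomologicalComplex.comp_f, ModuleCat.hom_comp, LinearMap.comp_apply, f.comm,
          g.comm] }

@[ext] lemma hom_ext {M N : DGMod A} {f g : M ⟶ N} (h : ∀ x, Hom.app f x = Hom.app g x) : f = g :=
  Hom.ext (funext h)

@[simp] lemma id_app (M : DGMod A) (x : A.Obj) : Hom.app (𝟙 M) x = 𝟙 _ := rfl

@[simp] lemma comp_app {M N P : DGMod A} (f : M ⟶ N) (g : N ⟶ P) (x : A.Obj) :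
    Hom.app (f ≫ g) x = Hom.app f x ≫ Hom.app g x := rfl

/-- The value of a morphism on an element. -/
def Hom.ap {M N : DGMod A} (f : M ⟶ N) (x : A.Obj) (n : ℤ) : (M.obj x).X n →ₗ[k] (N.obj x).X n :=
  ((Hom.app f x).f n).hom

lemma ap_act {M N : DGMod A} (f : M ⟶ N) {x y : A.Obj} {i j n : ℤ} (h : i + j = n)
    (a : (A.Hom x y).X i) (m : (M.obj x).X j) :
    Hom.ap f y n (M.act h a m) = N.act h a (Hom.ap f x j m) := Hom.comm f h a m

lemma ap_dif {M N : DGMod A} (f : M ⟶ N) (x : A.Obj) (n : ℤ) (m : (M.obj x).X n) :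
    Hom.ap f x (n + 1) (dif (M.obj x) n m) = dif (N.obj x) n (Hom.ap f x n m) := by
  have := (Hom.app f x).comm n (n + 1)
  exact (congrArg (fun t => t.hom m) this).symm

@[simp] lemma ap_comp {M N P : DGMod A} (f : M ⟶ N) (g : N ⟶ P) (x : A.Obj) (n : ℤ)
    (m : (M.obj x).X n) : Hom.ap (f ≫ g) x n m = Hom.ap g x n (Hom.ap f x n m) := rfl

@[simp] lemma ap_id (M : DGMod A) (x : A.Obj) (n : ℤ) (m : (M.obj x).X n) :
    Hom.ap (𝟙 M) x n m = m := rfl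

/-- Construct a morphism of dg-modules from its effect on elements. -/
def mkHom {M N : DGMod A} (φ : ∀ x n, (M.obj x).X n →ₗ[k] (N.obj x).X n)
    (hd : ∀ x n m, φ x (n + 1) (dif (M.obj x) n m) = dif (N.obj x) n (φ x n m))
    (ha : ∀ {x y : A.Obj} {i j n : ℤ} (h : i + j = n) (a : (A.Hom x y).X i) (m : (M.obj x).X j),
      φ y n (M.act h a m) = N.act h a (φ x j m)) : M ⟶ N :=
  Hom.mk
    (fun x =>
      { f := fun n => ModuleCat.ofHom (φ x n)
        comm' := by
          rintro i j rfl
          apply ModuleCat.hom_ext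
          ext m
          exact (hd x i m).symm })
    ha

@[simp] lemma mkHom_ap {M N : DGMod A} (φ : ∀ x n, (M.obj x).X n →ₗ[k] (N.obj x).X n)
    (hd) (ha) (x : A.Obj) (n : ℤ) : Hom.ap (mkHom (M := M) (N := N) φ hd ha) x n = φ x n := rfl

lemma hom_ext_ap {M N : DGMod A} {f g : M ⟶ N}
    (h : ∀ x n m, Hom.ap f x n m = Hom.ap g x n m) : f = g := by
  ext x n m
  exact h x n m

section Preadditive

variable {M N : DGMod A}

instance : Zero (M ⟶ N) := ⟨Hom.mk (fun _ => 0) (fun _ _ _ => by simp)⟩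
instance : Add (M ⟶ N) := ⟨fun f g => Hom.mk (fun x => Hom.app f x + Hom.app g x)
  (fun h a m => by
    simp only [HomologicalComplex.add_f_apply, ModuleCat.hom_add, LinearMap.add_apply, map_add,
      Hom.comm])⟩
instance : Neg (M ⟶ N) := ⟨fun f => Hom.mk (fun x => -Hom.app f x)
  (fun h a m => by
    simp only [HomologicalComplex.neg_f_apply, ModuleCat.hom_neg, LinearMap.neg_apply, map_neg,
      Hom.comm])⟩
instance : Sub (M ⟶ N) := ⟨fun f g => Hom.mk (fun x => Hom.app f x - Hom.app g x)
  (fun h a m => by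
    simp only [HomologicalComplex.sub_f_apply, ModuleCat.hom_sub, LinearMap.sub_apply, map_sub,
      Hom.comm])⟩
instance : SMul ℕ (M ⟶ N) := ⟨fun r f => Hom.mk (fun x => r • Hom.app f x)
  (fun h a m => by
    simp only [HomologicalComplex.nsmul_f_apply, ModuleCat.hom_nsmul, LinearMap.smul_apply,
      map_nsmul, Hom.comm])⟩
instance : SMul ℤ (M ⟶ N) := ⟨fun r f => Hom.mk (fun x => r • Hom.app f x)
  (fun h a m => by
    simp only [HomologicalComplex.zsmul_f_apply, ModuleCat.hom_zsmul, LinearMap.smul_apply,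
      map_zsmul, Hom.comm])⟩

instance : AddCommGroup (M ⟶ N) :=
  Function.Injective.addCommGroup (fun f : M ⟶ N => fun x => Hom.app f x)
    (fun _ _ h => hom_ext (fun x => congrFun h x)) rfl (fun _ _ => rfl) (fun _ => rfl)
    (fun _ _ => rfl) (fun _ _ => rfl) (fun _ _ => rfl)

lemma add_app (f g : M ⟶ N) (x : A.Obj) : Hom.app (f + g) x = Hom.app f x + Hom.app g x := rfl

@[simp] lemma ap_add (f g : M ⟶ N) (x : A.Obj) (n : ℤ) (m : (M.obj x).X n) :
    Hom.ap (f + g) x n m = Hom.ap f x n m + Hom.ap g x n m := rfl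

@[simp] lemma ap_zero (x : A.Obj) (n : ℤ) (m : (M.obj x).X n) :
    Hom.ap (0 : M ⟶ N) x n m = 0 := rfl

end Preadditive

instance : Preadditive (DGMod A) where
  add_comp _ _ _ f g h := by
    refine hom_ext fun x => ?_
    simp only [comp_app, add_app, Preadditive.add_comp]
  comp_add _ _ _ f g h := by
    refine hom_ext fun x => ?_
    simp only [comp_app, add_app, Preadditive.comp_add]

/-- A morphism of dg-modules of degree `d` (not necessarily closed): linear maps
`M(x)^i → N(x)^(i+d)` with `φ (a m) = (-1)^(d|a|) a φ(m)`. -/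
@[ext] structure GHom (M N : DGMod A) (d : ℤ) where
  app : ∀ (x : A.Obj) {i j : ℤ}, i + d = j → ((M.obj x).X i →ₗ[k] (N.obj x).X j)
  comm : ∀ {x y : A.Obj} {i j s t u : ℤ} (h : i + j = s) (hs : s + d = t) (hj : j + d = u)
    (ht : i + u = t) (a : (A.Hom x y).X i) (m : (M.obj x).X j),
    app y hs (M.act h a m) = sgn k (d * i) • N.act ht a (app x hj m)

/-- A closed morphism as a morphism of degree `0`. -/
def Hom.toGHom {M N : DGMod A} (f : M ⟶ N) : GHom M N 0 where
  app x i j h := by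
    obtain rfl : i = j := by omega
    exact Hom.ap f x i
  comm {x y i j s t u} h hs hj ht a m := by
    obtain rfl : s = t := by omega
    obtain rfl : j = u := by omega
    simp [ap_act]

@[simp] lemma toGHom_app {M N : DGMod A} (f : M ⟶ N) (x : A.Obj) (i : ℤ) (h : i + 0 = i) :
    (Hom.toGHom f).app x h = Hom.ap f x i := rfl

/-- Composition of homogeneous morphisms. -/
def GHom.comp {M N P : DGMod A} {d e n : ℤ} (h : d + e = n) (ψ : GHom N P e) (φ : GHom M N d) :
    GHom M P n where
  app x i j hj := (ψ.app x (show i + d + e = j by omega)) ∘ₗ φ.app x rfl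
  comm {x y i j s t u} h' hs hj ht a m := by
    have e1 : sgn k (n * i) = sgn k (d * i) * sgn k (e * i) := by rw [← sgn_add, ← h, add_mul]
    simp only [LinearMap.comp_apply]
    rw [φ.comm h' rfl rfl (show i + (j + d) = s + d by omega), map_smul,
      ψ.comm _ _ (show j + d + e = u by omega) ht, smul_smul, e1]

instance {M N : DGMod A} {d : ℤ} : SMul k (GHom M N d) where
  smul r φ :=
    { app := fun x _ _ h => r • φ.app x h
      comm := fun h hs hj ht a m => by
        simp only [LinearMap.smul_apply, map_smul]
        rw [φ.comm h hs hj ht, smul_comm] }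

/-- `s` is a homotopy from `g` to `f`: `f - g = d s + s d`, that is, `f - g` is the differential
of the degree `-1` morphism `s`. -/
def GHom.IsHomotopy {M N : DGMod A} (s : GHom M N (-1)) (f g : M ⟶ N) : Prop :=
  ∀ (x : A.Obj) (n : ℤ) (m : (M.obj x).X (n + 1)),
    Hom.ap f x (n + 1) m - Hom.ap g x (n + 1) m =
      dif (N.obj x) n (s.app x (by omega) m) +
        s.app x (show n + 1 + 1 + -1 = n + 1 by omega) (dif (M.obj x) (n + 1) m)

/-- Two morphisms of dg-modules are homotopic. -/
def Homotopic : HomRel (DGMod A) := fun _ _ f g => ∃ s, GHom.IsHomotopy s f g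

/-- The homotopy category `H⁰(A-Mod)`. -/
abbrev H0 (A : DGCat k) := Quotient (Homotopic (A := A))

/-- The functor from dg-modules to their homotopy category. -/
abbrev toH0 (A : DGCat k) : DGMod A ⥤ H0 A := Quotient.functor _

/-- A quasi-isomorphism of dg-modules. -/
def quasiIso (A : DGCat k) : MorphismProperty (DGMod A) :=
  fun _ _ f => ∀ x, QuasiIso (Hom.app f x)

/-- `Ho(A-Mod)`, that is, the derived category `D(A)`: the localization of the category of
dg-modules at the quasi-isomorphisms. -/
abbrev Ho (A : DGCat k) := (quasiIso A).Localization

/-- The localization functor. -/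
abbrev toHo (A : DGCat k) : DGMod A ⥤ Ho A := (quasiIso A).Q

/-- A cofibrant dg-module: one with the left lifting property against surjective
quasi-isomorphisms. (Every dg-module is fibrant.) -/
def IsCofibrant (P : DGMod A) : Prop :=
  ∀ ⦃E B : DGMod A⦄ (p : E ⟶ B), quasiIso A p →
    (∀ x n, Function.Surjective (Hom.ap p x n)) → ∀ b : P ⟶ B, ∃ e : P ⟶ E, e ≫ p = b

/-- A perfect dg-module: cofibrant, and compact in the homotopy category, that is, every morphism
to a direct sum is homotopic to one which factors through a finite partial sum. -/
def IsPerfect (P : DGMod A) : Prop :=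
  P.IsCofibrant ∧ ∀ ⦃ι : Type u⦄ (Y : ι → DGMod A) (c : Cofan Y), IsColimit c →
    ∀ f : P ⟶ c.pt, ∃ (s : Finset ι) (g : ∀ i, P ⟶ Y i), Homotopic f (∑ i ∈ s, g i ≫ c.inj i)

/-- `M` is isomorphic in `Ho` to a perfect dg-module. -/
def IsQuasiPerfect (M : DGMod A) : Prop :=
  ∃ P : DGMod A, P.IsPerfect ∧ Nonempty ((toHo A).obj M ≅ (toHo A).obj P)

/-- Restriction along a dg-functor. -/
abbrev pullback {B : DGCat k} (F : DGFunctor A B) (M : DGMod B) : DGMod A where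
  obj x := M.obj (F.obj x)
  act h := (M.act h) ∘ₗ F.map
  dif_act h a m := by simp only [LinearMap.comp_apply, M.dif_act, F.map_dif]
  one_act m := by simp only [LinearMap.comp_apply, F.map_one, M.one_act]
  comp_act h₁ h₂ h₃ h₄ f g m := by
    simp only [LinearMap.comp_apply, F.map_comp, M.comp_act h₁ h₂ h₃ h₄]

/-- Restriction of a morphism along a dg-functor. -/
abbrev pullbackMap {B : DGCat k} (F : DGFunctor A B) {M N : DGMod B} (f : M ⟶ N) :
    M.pullback F ⟶ N.pullback F :=
  Hom.mk (fun x => Hom.app f (F.obj x)) (fun h a m => Hom.comm f h (F.map a) m)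

end DGMod

namespace DGMod


/-- The dg-module `A(x, -)`. For `A = T.op` this is the right `T`-module represented by `x`. -/
abbrev rep (A : DGCat k) (x : A.Obj) : DGMod A where
  obj y := A.Hom x y
  act h := A.comp h
  dif_act h a m := A.dif_comp h a m
  one_act m := A.one_comp m
  comp_act h₁ h₂ h₃ h₄ f g m := A.assoc h₁ h₂ h₃ h₄ f g m

section TensorOver

variable {S B : DGCat k}

/-- The relations `X(a)(x) ⊗ g - (-1)^(|a||x|) x ⊗ a g` in `⨁_s X(s) ⊗ G(s,b)`. -/
def tensorRel (X : DGMod S.op) (G : DGMod (S.tensor B)) (b : B.Obj) (n : ℤ) :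
    Submodule k (DirectSum S.Obj fun s => (tens (X.obj s) (G.obj (s, b))).X n) := by
  classical
  exact Submodule.span k {w | ∃ (s s' : S.Obj) (i p q ip iq : ℤ) (hip : i + p = ip)
    (hiq : i + q = iq) (h : ip + q = n) (a : (S.Hom s' s).X i) (x : (X.obj s).X p)
    (g : (G.obj (s', b)).X q),
    w = DirectSum.lof k S.Obj (fun s => (tens (X.obj s) (G.obj (s, b))).X n) s'
        (tmul h (X.act (x := s) (y := s') hip a x) g) -
      sgn k (i * p) • DirectSum.lof k S.Obj (fun s => (tens (X.obj s) (G.obj (s, b))).X n) s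
        (tmul (show p + iq = n by omega) x
          (G.act (x := (s', b)) (y := (s, b)) hiq (DGFunctor.inlMap S B b i a) g))}

/-- The degree `n` part of `(X ⊗_S G)(b)`. -/
abbrev TensorX (X : DGMod S.op) (G : DGMod (S.tensor B)) (b : B.Obj) (n : ℤ) : Type u :=
  (DirectSum S.Obj fun s => (tens (X.obj s) (G.obj (s, b))).X n) ⧸ tensorRel X G b n

/-- The class of `x ⊗ g` in `X ⊗_S G`. -/
def tm (X : DGMod S.op) (G : DGMod (S.tensor B)) (b : B.Obj) (s : S.Obj) {p q n : ℤ}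
    (h : p + q = n) :
    (X.obj s).X p →ₗ[k] (G.obj (s, b)).X q →ₗ[k] TensorX X G b n := by
  classical
  exact (tmul h).compr₂ ((tensorRel X G b n).mkQ ∘ₗ
    DirectSum.lof k S.Obj (fun s => (tens (X.obj s) (G.obj (s, b))).X n) s)

variable {X : DGMod S.op} {G : DGMod (S.tensor B)} {b : B.Obj}

lemma tm_rel {s s' : S.Obj} {i p q ip iq n : ℤ} (hip : i + p = ip)
    (hiq : i + q = iq) (h : ip + q = n) (h' : p + iq = n) (a : (S.Hom s' s).X i)
    (x : (X.obj s).X p) (g : (G.obj (s', b)).X q) :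
    tm X G b s' h (X.act (x := s) (y := s') hip a x) g = sgn k (i * p) • tm X G b s h' x
      (G.act (x := (s', b)) (y := (s, b)) hiq (DGFunctor.inlMap S B b i a) g) := by
  classical
  have := (Submodule.Quotient.eq (tensorRel X G b n)).mpr
    (Submodule.subset_span ⟨s, s', i, p, q, ip, iq, hip, hiq, h, a, x, g, rfl⟩)
  exact this

/-- Linear maps out of `X ⊗_S G`. -/
def tmLift {n : ℤ} {V : Type u} [AddCommGroup V] [Module k V]
    (φ : ∀ s (p q : ℤ), p + q = n → ((X.obj s).X p →ₗ[k] (G.obj (s, b)).X q →ₗ[k] V))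
    (hφ : ∀ {s s' : S.Obj} {i p q ip iq : ℤ} (hip : i + p = ip)
      (hiq : i + q = iq) (h : ip + q = n) (h' : p + iq = n) (a : (S.Hom s' s).X i)
      (x : (X.obj s).X p) (g : (G.obj (s', b)).X q),
      φ s' ip q h (X.act (x := s) (y := s') hip a x) g = sgn k (i * p) • φ s p iq h' x
        (G.act (x := (s', b)) (y := (s, b)) hiq (DGFunctor.inlMap S B b i a) g)) :
    TensorX X G b n →ₗ[k] V := by
  classical
  exact (tensorRel X G b n).liftQ (DirectSum.toModule k S.Obj V fun s => tlift (φ s)) (by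
    refine Submodule.span_le.mpr ?_
    rintro w ⟨s, s', i, p, q, ip, iq, hip, hiq, h, a, x, g, rfl⟩
    simp only [SetLike.mem_coe, LinearMap.mem_ker, map_sub, map_smul, DirectSum.toModule_lof,
      tlift_tmul]
    rw [sub_eq_zero]
    exact hφ hip hiq h _ a x g)

@[simp] lemma tmLift_tm {n : ℤ} {V : Type u} [AddCommGroup V] [Module k V]
    (φ : ∀ s (p q : ℤ), p + q = n → ((X.obj s).X p →ₗ[k] (G.obj (s, b)).X q →ₗ[k] V))
    (hφ) (s : S.Obj) {p q : ℤ} (h : p + q = n) (x : (X.obj s).X p) (g : (G.obj (s, b)).X q) :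
    tmLift (X := X) φ hφ (tm X G b s h x g) = φ s p q h x g := by
  classical
  change DirectSum.toModule k S.Obj V (fun s => tlift (φ s)) (DirectSum.lof k S.Obj _ s _) = _
  rw [DirectSum.toModule_lof, tlift_tmul]

lemma tm_ext {n : ℤ} {V : Type u} [AddCommGroup V] [Module k V] {f g : TensorX X G b n →ₗ[k] V}
    (H : ∀ s p q (h : p + q = n) (x : (X.obj s).X p) (y : (G.obj (s, b)).X q),
      f (tm X G b s h x y) = g (tm X G b s h x y)) : f = g := by
  classical
  apply Submodule.linearMap_qext
  apply DirectSum.linearMap_ext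
  intro s
  apply tens_ext
  intro p q h x y
  exact H s p q h x y

lemma tm_induction {n : ℤ} {P : TensorX X G b n → Prop}
    (h0 : P 0) (hadd : ∀ x y, P x → P y → P (x + y))
    (H : ∀ s p q (h : p + q = n) (x : (X.obj s).X p) (y : (G.obj (s, b)).X q),
      P (tm X G b s h x y)) (x) : P x := by
  let R : Submodule k (TensorX X G b n) := Submodule.span k
    {w | ∃ s p q, ∃ (h : p + q = n) (x : (X.obj s).X p) (y : (G.obj (s, b)).X q),
      w = tm X G b s h x y}
  have hS : R.mkQ = 0 := tm_ext fun s p q h a b => by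
    have : tm X G _ s h a b ∈ R := Submodule.subset_span ⟨s, p, q, h, a, b, rfl⟩
    simpa using this
  have hx : x ∈ R := by
    have := LinearMap.congr_fun hS x
    simpa using this
  induction hx using Submodule.closure_induction with
  | zero => exact h0
  | add x y _ _ h1 h2 => exact hadd x y h1 h2
  | smul_mem r x hx =>
    obtain ⟨s, p, q, h, a, b, rfl⟩ := hx
    have := H s p q h (r • a) b
    simpa using this

/-- In a tensor product of dg-categories, `a ⊗ 1` and `1 ⊗ c` commute up to sign. -/
lemma inl_inr_act (G : DGMod (S.tensor B)) {s s' : S.Obj} {b b' : B.Obj} {i j q iq jq n : ℤ}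
    (hiq : i + q = iq) (hjq : j + q = jq) (h : j + iq = n) (h' : i + jq = n)
    (a : (S.Hom s' s).X i) (c : (B.Hom b b').X j) (g : (G.obj (s', b)).X q) :
    G.act (x := (s, b)) (y := (s, b')) h (DGFunctor.inrMap S B s j c)
      (G.act (x := (s', b)) (y := (s, b)) hiq (DGFunctor.inlMap S B b i a) g) =
    sgn k (i * j) • G.act (x := (s', b')) (y := (s, b')) h' (DGFunctor.inlMap S B b' i a)
      (G.act (x := (s', b)) (y := (s', b')) hjq (DGFunctor.inrMap S B s' j c) g) := by
  rw [← G.comp_act (x := (s', b)) (y := (s, b)) (z := (s, b')) rfl (show j + i + q = n by omega),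
    ← G.comp_act (x := (s', b)) (y := (s', b')) (z := (s, b')) (show i + j = j + i by omega)
      (show j + i + q = n by omega)]
  simp only [DGFunctor.inlMap_apply, DGFunctor.inrMap_apply]
  have e1 := tensorComp_tmul S B (x := (s', b)) (y := (s, b)) (z := (s, b'))
    (rfl : j + i = j + i) (zero_add j) (add_zero i) (zero_add i) (add_zero j)
    (S.one s) c a (B.one b)
  have e2 := tensorComp_tmul S B (x := (s', b)) (y := (s', b')) (z := (s, b'))
    (show i + j = j + i by omega) (add_zero i) (zero_add j) (add_zero i) (zero_add j)
    a (B.one b') (S.one s') c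
  rw [e1, e2, S.one_comp, S.comp_one, B.one_comp, B.comp_one]
  simp only [zero_mul, sgn_zero, one_smul, map_smul, LinearMap.smul_apply, mul_comm i j]

/-- The differential of `X ⊗_S G`: `d (x ⊗ g) = dx ⊗ g + (-1)^|x| x ⊗ dg`. -/
def tensorDif (X : DGMod S.op) (G : DGMod (S.tensor B)) (b : B.Obj) (n : ℤ) :
    TensorX X G b n →ₗ[k] TensorX X G b (n + 1) :=
  tmLift (fun s p q h => (tm X G b s (show p + 1 + q = n + 1 by omega)) ∘ₗ (dif (X.obj s) p) +
      sgn k p • (tm X G b s (show p + (q + 1) = n + 1 by omega)).compl₂ (dif (G.obj (s, b)) q))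
    (by
      intro s s' i p q ip iq hip hiq h h' a x g
      simp only [LinearMap.add_apply, LinearMap.smul_apply, LinearMap.comp_apply,
        LinearMap.compl₂_apply]
      have hs : sgn k ip = sgn k i * sgn k p := by rw [← hip, sgn_add]
      rw [X.dif_act (x := s) (y := s') hip a x, map_add, LinearMap.add_apply,
        tm_rel _ (show i + 1 + q = iq + 1 by omega) _ (show p + (iq + 1) = n + 1 by omega),
        tm_rel _ (show i + (q + 1) = iq + 1 by omega) _ (show p + (iq + 1) = n + 1 by omega),
        map_smul, LinearMap.smul_apply,
        tm_rel _ hiq _ (show p + 1 + iq = n + 1 by omega),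
        G.dif_act (x := (s', b)) (y := (s, b)) hiq, ← DGFunctor.inlMap_dif]
      simp only [map_add, map_smul, smul_add, smul_smul, hs]
      have e1 : sgn k ((i + 1) * p) = sgn k (i * p) * sgn k p := by
        rw [add_mul, sgn_add, one_mul]
      have e2 : sgn k i * sgn k (i * (p + 1)) = sgn k (i * p) := by
        rw [mul_add, sgn_add, mul_one]
        linear_combination sgn k (i * p) * sgn_mul_self (k := k) i
      rw [e1, e2]
      match_scalars <;> ring)

lemma tensorDif_tm {s : S.Obj} {p q n : ℤ} (h : p + q = n) (x : (X.obj s).X p)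
    (g : (G.obj (s, b)).X q) :
    tensorDif X G b n (tm X G b s h x g) =
      tm X G b s (show p + 1 + q = n + 1 by omega) (dif (X.obj s) p x) g +
      sgn k p • tm X G b s (show p + (q + 1) = n + 1 by omega) x (dif (G.obj (s, b)) q g) := by
  rw [tensorDif, tmLift_tm]
  rfl

lemma tensorDif_comp (n : ℤ) :
    (tensorDif X G b (n + 1)) ∘ₗ (tensorDif X G b n) = 0 := by
  apply tm_ext
  intro s p q h x g
  simp only [LinearMap.comp_apply, tensorDif_tm, map_add, map_smul, dif_dif, map_zero,
    LinearMap.zero_apply, smul_zero, add_zero, zero_add, sgn_add, sgn_one]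
  module

/-- The complex `(X ⊗_S G)(b)`. -/
def tensorCplx (X : DGMod S.op) (G : DGMod (S.tensor B)) (b : B.Obj) : Cplx k :=
  CochainComplex.of (fun n => ModuleCat.of k (TensorX X G b n))
    (fun n => ModuleCat.ofHom (tensorDif X G b n))
    (fun n => by
      rw [← ModuleCat.ofHom_comp, tensorDif_comp]
      rfl)

lemma dif_tensorCplx (n : ℤ) : dif (tensorCplx X G b) n = tensorDif X G b n := by
  simp [dif, tensorCplx, CochainComplex.of_d]
  rfl

/-- The action of `B` on `X ⊗_S G`: `c (x ⊗ g) = (-1)^(|c||x|) x ⊗ c g`. -/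
def tensorAct (X : DGMod S.op) (G : DGMod (S.tensor B)) {b b' : B.Obj} {j m n : ℤ}
    (hn : j + m = n) : (B.Hom b b').X j →ₗ[k] TensorX X G b m →ₗ[k] TensorX X G b' n :=
  LinearMap.mk₂' k k (fun c w => tmLift (X := X) (G := G) (b := b) (n := m)
      (fun s p q h => sgn k (j * p) • (tm X G b' s (show p + (j + q) = n by omega)).compl₂
        (G.act (x := (s, b)) (y := (s, b')) rfl (DGFunctor.inrMap S B s j c)))
      (by
        intro s s' i p q ip iq hip hiq h h' a x g
        simp only [LinearMap.smul_apply, LinearMap.compl₂_apply]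
        rw [tm_rel hip (show i + (j + q) = j + iq by omega) _
            (show p + (j + iq) = n by omega),
          inl_inr_act G hiq rfl rfl (show i + (j + q) = j + iq by omega)]
        simp only [map_smul, smul_smul]
        congr 1
        rw [← hip, mul_add, sgn_add, mul_comm j i]
        ring) w)
    (fun c c' w => by
      rw [← LinearMap.add_apply]
      congr 1
      apply tm_ext
      intro s p q h x g
      simp only [tmLift_tm, LinearMap.add_apply, LinearMap.smul_apply, LinearMap.compl₂_apply,
        map_add, smul_add])
    (fun r c w => by
      rw [← LinearMap.smul_apply]
      congr 1
      apply tm_ext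
      intro s p q h x g
      simp only [tmLift_tm, LinearMap.smul_apply, LinearMap.compl₂_apply, map_smul]
      rw [smul_comm])
    (fun c w w' => map_add _ w w')
    (fun r c w => map_smul _ r w)

lemma tensorAct_tm (X : DGMod S.op) (G : DGMod (S.tensor B)) {b b' : B.Obj} {j m n p q jq : ℤ} (hn : j + m = n) (s : S.Obj)
    (h : p + q = m) (hj : j + q = jq) (c : (B.Hom b b').X j) (x : (X.obj s).X p)
    (g : (G.obj (s, b)).X q) :
    tensorAct X G hn c (tm X G b s h x g) = sgn k (j * p) • tm X G b' s (by omega) x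
      (G.act (x := (s, b)) (y := (s, b')) hj (DGFunctor.inrMap S B s j c) g) := by
  subst hj
  simp only [tensorAct, LinearMap.mk₂'_apply, tmLift_tm, LinearMap.smul_apply,
    LinearMap.compl₂_apply]

lemma tensorDif_act {b b' : B.Obj} {i j n : ℤ} (h : i + j = n) (c : (B.Hom b b').X i)
    (w : TensorX X G b j) :
    tensorDif X G b' n (tensorAct X G h c w) =
      tensorAct X G (show i + 1 + j = n + 1 by omega) (dif (B.Hom b b') i c) w +
        sgn k i • tensorAct X G (show i + (j + 1) = n + 1 by omega) c (tensorDif X G b j w) := by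
  induction w using tm_induction with
  | h0 => simp
  | hadd w w' h₁ h₂ =>
    simp only [map_add, smul_add, h₁, h₂]
    abel
  | H s p q hpq x g =>
    rw [tensorAct_tm X G h s hpq rfl c x g, map_smul, tensorDif_tm, tensorDif_tm, map_add, map_smul,
      tensorAct_tm X G _ s hpq (show i + 1 + q = i + q + 1 by omega) (dif (B.Hom b b') i c) x g,
      tensorAct_tm X G _ s (show p + 1 + q = j + 1 by omega) rfl c (dif (X.obj s) p x) g,
      tensorAct_tm X G _ s (show p + (q + 1) = j + 1 by omega) (show i + (q + 1) = i + q + 1 by omega)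
        c x (dif (G.obj (s, b)) q g),
      G.dif_act (x := (s, b)) (y := (s, b')), ← DGFunctor.inrMap_dif]
    simp only [map_add, map_smul, smul_add, smul_smul]
    have e1 : sgn k ((i + 1) * p) = sgn k (i * p) * sgn k p := by
      rw [add_mul, sgn_add, one_mul]
    have e2 : sgn k i * sgn k (i * (p + 1)) = sgn k (i * p) := by
      rw [mul_add, sgn_add, mul_one]
      linear_combination sgn k (i * p) * sgn_mul_self (k := k) i
    rw [e1, e2]
    match_scalars <;> ring

lemma tensorAct_one {b : B.Obj} {j : ℤ} (w : TensorX X G b j) :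
    tensorAct X G (zero_add j) (B.one b) w = w := by
  induction w using tm_induction with
  | h0 => simp
  | hadd w w' h₁ h₂ => rw [map_add, h₁, h₂]
  | H s p q hpq x g =>
    rw [tensorAct_tm X G _ s hpq (zero_add q) (B.one b) x g]
    have := G.one_act (x := (s, b)) g
    rw [DGFunctor.inrMap_apply, this]
    simp

lemma tensorAct_comp {b b' b'' : B.Obj} {i j l ij jl n : ℤ} (h₁ : i + j = ij) (h₂ : ij + l = n)
    (h₃ : j + l = jl) (h₄ : i + jl = n) (c : (B.Hom b' b'').X i) (c' : (B.Hom b b').X j)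
    (w : TensorX X G b l) :
    tensorAct X G h₂ (B.comp h₁ c c') w = tensorAct X G h₄ c (tensorAct X G h₃ c' w) := by
  induction w using tm_induction with
  | h0 => simp
  | hadd w w' h₁ h₂ => simp only [map_add, h₁, h₂]
  | H s p q hpq x g =>
    rw [tensorAct_tm X G h₂ s hpq rfl (B.comp h₁ c c') x g, tensorAct_tm X G h₃ s hpq rfl c' x g, map_smul,
      tensorAct_tm X G h₄ s (show p + (j + q) = jl by omega) (show i + (j + q) = ij + q by omega) c x
        (G.act (x := (s, b)) (y := (s, b')) rfl (DGFunctor.inrMap S B s j c') g),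
      DGFunctor.inrMap_comp]
    have := G.comp_act (x := (s, b)) (y := (s, b')) (z := (s, b'')) h₁ rfl rfl
        (show i + (j + q) = ij + q by omega) (DGFunctor.inrMap S B s i c)
        (DGFunctor.inrMap S B s j c') g
    rw [this, smul_smul]
    congr 1
    rw [← h₁, add_mul, sgn_add, mul_comm]

/-- The tensor product `X ⊗_S G` of a right `S`-module `X` and an `S ⊗ B`-module `G`; it is a
`B`-module. Its value at `b` is the quotient of `⨁_s X(s) ⊗ G(s,b)` by the relations
`X(a)(x) ⊗ g = (-1)^(|a||x|) x ⊗ a g`, that is, `x a ⊗ g = x ⊗ a g` when `X(a)(x)` is written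
`(-1)^(|a||x|) x a`. -/
def tensorOver (X : DGMod S.op) (G : DGMod (S.tensor B)) : DGMod B where
  obj b := tensorCplx X G b
  act h := tensorAct X G h
  dif_act h c w := by
    rw [dif_tensorCplx, dif_tensorCplx]
    exact tensorDif_act h c w
  one_act w := tensorAct_one w
  comp_act h₁ h₂ h₃ h₄ c c' w := tensorAct_comp h₁ h₂ h₃ h₄ c c' w

end TensorOver

section Functoriality

variable {S B : DGCat k}

/-- `x ⊗ g ↦ ψ(x) ⊗ g`, on elements. -/
def mapLeftFun {X X' : DGMod S.op} (G : DGMod (S.tensor B)) {d : ℤ} (ψ : GHom X X' d) (b : B.Obj)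
    {m n : ℤ} (hn : m + d = n) : TensorX X G b m →ₗ[k] TensorX X' G b n :=
  tmLift (fun s p q h => (tm X' G b s (show p + d + q = n by omega)) ∘ₗ ψ.app s rfl) (by
    intro s s' i p q ip iq hip hiq h h' a x g
    simp only [LinearMap.comp_apply]
    rw [ψ.comm (x := s) (y := s') hip rfl rfl (show i + (p + d) = ip + d by omega) a x, map_smul,
      LinearMap.smul_apply,
      tm_rel _ hiq _ (show p + d + iq = n by omega), smul_smul]
    congr 1
    rw [mul_add, sgn_add, mul_comm d i]
    linear_combination sgn k (i * p) * sgn_mul_self (k := k) (i * d))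

lemma mapLeftFun_tm {X X' : DGMod S.op} (G : DGMod (S.tensor B)) {d : ℤ} (ψ : GHom X X' d)
    (b : B.Obj) {m n p q p' : ℤ} (hn : m + d = n) (s : S.Obj) (h : p + q = m) (hp : p + d = p')
    (x : (X.obj s).X p) (g : (G.obj (s, b)).X q) :
    mapLeftFun G ψ b hn (tm X G b s h x g) =
      tm X' G b s (by omega) (ψ.app s hp x) g := by
  subst hp
  rw [mapLeftFun, tmLift_tm]
  rfl

/-- `x ⊗ g ↦ (-1)^(|ψ||x|) x ⊗ ψ(g)`, on elements. -/
def mapRightFun (X : DGMod S.op) {G G' : DGMod (S.tensor B)} {d : ℤ} (ψ : GHom G G' d) (b : B.Obj)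
    {m n : ℤ} (hn : m + d = n) : TensorX X G b m →ₗ[k] TensorX X G' b n :=
  tmLift (fun s p q h => sgn k (d * p) •
      (tm X G' b s (show p + (q + d) = n by omega)).compl₂ (ψ.app (s, b) rfl)) (by
    intro s s' i p q ip iq hip hiq h h' a x g
    simp only [LinearMap.smul_apply, LinearMap.compl₂_apply]
    rw [tm_rel hip (show i + (q + d) = iq + d by omega) _ (show p + (iq + d) = n by omega),
      ψ.comm (x := (s', b)) (y := (s, b)) hiq rfl rfl (show i + (q + d) = iq + d by omega)
        (DGFunctor.inlMap S B b i a) g, map_smul]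
    simp only [smul_smul]
    congr 1
    rw [← hip, mul_add, sgn_add]
    ring)

lemma mapRightFun_tm (X : DGMod S.op) {G G' : DGMod (S.tensor B)} {d : ℤ} (ψ : GHom G G' d)
    (b : B.Obj) {m n p q q' : ℤ} (hn : m + d = n) (s : S.Obj) (h : p + q = m) (hq : q + d = q')
    (x : (X.obj s).X p) (g : (G.obj (s, b)).X q) :
    mapRightFun X ψ b hn (tm X G b s h x g) =
      sgn k (d * p) • tm X G' b s (by omega) x (ψ.app (s, b) hq g) := by
  subst hq
  rw [mapRightFun, tmLift_tm]
  rfl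

lemma mapLeftFun_act {X X' : DGMod S.op} (G : DGMod (S.tensor B)) {d : ℤ} (ψ : GHom X X' d)
    {b b' : B.Obj} {i j s t u : ℤ} (h : i + j = s) (hs : s + d = t) (hj : j + d = u)
    (ht : i + u = t) (c : (B.Hom b b').X i) (w : TensorX X G b j) :
    mapLeftFun G ψ b' hs (tensorAct X G h c w) =
      sgn k (d * i) • tensorAct X' G ht c (mapLeftFun G ψ b hj w) := by
  induction w using tm_induction with
  | h0 => simp
  | hadd w w' h₁ h₂ => simp only [map_add, smul_add, h₁, h₂]
  | H o p q hpq x g =>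
    rw [tensorAct_tm X G h o hpq rfl c x g, map_smul, mapLeftFun_tm G ψ b' hs o _ rfl,
      mapLeftFun_tm G ψ b hj o hpq rfl,
      tensorAct_tm X' G ht o (show p + d + q = u by omega) rfl c (ψ.app o rfl x) g, smul_smul]
    congr 1
    rw [mul_add, sgn_add, mul_comm d i]
    linear_combination -sgn k (i * p) * sgn_mul_self (k := k) (i * d)

lemma mapRightFun_act (X : DGMod S.op) {G G' : DGMod (S.tensor B)} {d : ℤ} (ψ : GHom G G' d)
    {b b' : B.Obj} {i j s t u : ℤ} (h : i + j = s) (hs : s + d = t) (hj : j + d = u)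
    (ht : i + u = t) (c : (B.Hom b b').X i) (w : TensorX X G b j) :
    mapRightFun X ψ b' hs (tensorAct X G h c w) =
      sgn k (d * i) • tensorAct X G' ht c (mapRightFun X ψ b hj w) := by
  induction w using tm_induction with
  | h0 => simp
  | hadd w w' h₁ h₂ => simp only [map_add, smul_add, h₁, h₂]
  | H o p q hpq x g =>
    rw [tensorAct_tm X G h o hpq rfl c x g, map_smul, mapRightFun_tm X ψ b' hs o _ rfl,
      mapRightFun_tm X ψ b hj o hpq rfl, map_smul,
      tensorAct_tm X G' ht o (show p + (q + d) = u by omega) (show i + (q + d) = i + q + d by omega)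
        c x (ψ.app (o, b) rfl g),
      ψ.comm (x := (o, b)) (y := (o, b')) rfl rfl rfl (show i + (q + d) = i + q + d by omega)
        (DGFunctor.inrMap S B o i c) g, map_smul]
    simp only [smul_smul]
    congr 1
    ring

/-- The morphism `ψ ⊗ 1 : X ⊗_S G → X' ⊗_S G` of degree `d` given by `x ⊗ g ↦ ψ(x) ⊗ g`. -/
def mapLeft {X X' : DGMod S.op} (G : DGMod (S.tensor B)) {d : ℤ} (ψ : GHom X X' d) :
    GHom (tensorOver X G) (tensorOver X' G) d where
  app b _ _ h := mapLeftFun G ψ b h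
  comm h hs hj ht c w := mapLeftFun_act G ψ h hs hj ht c w

/-- The morphism `1 ⊗ ψ : X ⊗_S G → X ⊗_S G'` of degree `d` given by
`x ⊗ g ↦ (-1)^(d|x|) x ⊗ ψ(g)`. -/
def mapRight (X : DGMod S.op) {G G' : DGMod (S.tensor B)} {d : ℤ} (ψ : GHom G G' d) :
    GHom (tensorOver X G) (tensorOver X G') d where
  app b _ _ h := mapRightFun X ψ b h
  comm h hs hj ht c w := mapRightFun_act X ψ h hs hj ht c w

/-- A morphism of degree `0` which commutes with the differentials is a closed morphism. -/
def GHom.toHom {A : DGCat k} {M N : DGMod A} (φ : GHom M N 0)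
    (hd : ∀ x n m, φ.app x (add_zero (n + 1)) (dif (M.obj x) n m) =
      dif (N.obj x) n (φ.app x (add_zero n) m)) : M ⟶ N :=
  mkHom (fun x n => φ.app x (add_zero n)) hd (by
    intro x y i j n h a m
    have := φ.comm h (add_zero n) (add_zero j) h a m
    simpa using this)

lemma mapLeftFun_dif {X X' : DGMod S.op} (f : X ⟶ X') (G : DGMod (S.tensor B)) (b : B.Obj) (n : ℤ)
    (w : TensorX X G b n) :
    mapLeftFun G (Hom.toGHom f) b (add_zero (n + 1)) (tensorDif X G b n w) =
      tensorDif X' G b n (mapLeftFun G (Hom.toGHom f) b (add_zero n) w) := by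
  induction w using tm_induction with
  | h0 => simp
  | hadd w w' h₁ h₂ => simp only [map_add, h₁, h₂]
  | H o p q hpq x g =>
    rw [tensorDif_tm, map_add, map_smul, mapLeftFun_tm G _ b _ o _ (add_zero (p + 1)),
      mapLeftFun_tm G _ b _ o _ (add_zero p), mapLeftFun_tm G _ b _ o _ (add_zero p),
      tensorDif_tm]
    simp only [toGHom_app, ap_dif]

lemma mapRightFun_dif (X : DGMod S.op) {G G' : DGMod (S.tensor B)} (f : G ⟶ G') (b : B.Obj) (n : ℤ)
    (w : TensorX X G b n) :
    mapRightFun X (Hom.toGHom f) b (add_zero (n + 1)) (tensorDif X G b n w) =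
      tensorDif X G' b n (mapRightFun X (Hom.toGHom f) b (add_zero n) w) := by
  induction w using tm_induction with
  | h0 => simp
  | hadd w w' h₁ h₂ => simp only [map_add, h₁, h₂]
  | H o p q hpq x g =>
    rw [tensorDif_tm, map_add, map_smul, mapRightFun_tm X _ b _ o _ (add_zero q),
      mapRightFun_tm X _ b _ o _ (add_zero (q + 1)), mapRightFun_tm X _ b _ o _ (add_zero q),
      map_smul, tensorDif_tm]
    simp only [toGHom_app, ap_dif, zero_mul, sgn_zero, one_smul]

/-- The closed morphism `f ⊗ 1 : X ⊗_S G → X' ⊗_S G`. -/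
def homLeft {X X' : DGMod S.op} (f : X ⟶ X') (G : DGMod (S.tensor B)) :
    tensorOver X G ⟶ tensorOver X' G :=
  (mapLeft G (Hom.toGHom f)).toHom (fun b n w => by
    have h₁ : dif (tensorCplx X G b) n w = tensorDif X G b n w :=
      LinearMap.congr_fun (dif_tensorCplx n) w
    have h₂ := LinearMap.congr_fun (dif_tensorCplx (X := X') (G := G) (b := b) n)
      (mapLeftFun G (Hom.toGHom f) b (add_zero n) w)
    exact (congrArg (mapLeftFun G (Hom.toGHom f) b (add_zero (n + 1))) h₁).trans
      ((mapLeftFun_dif f G b n w).trans h₂.symm))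

/-- The closed morphism `1 ⊗ f : X ⊗_S G → X ⊗_S G'`. -/
def homRight (X : DGMod S.op) {G G' : DGMod (S.tensor B)} (f : G ⟶ G') :
    tensorOver X G ⟶ tensorOver X G' :=
  (mapRight X (Hom.toGHom f)).toHom (fun b n w => by
    have h₁ : dif (tensorCplx X G b) n w = tensorDif X G b n w :=
      LinearMap.congr_fun (dif_tensorCplx n) w
    have h₂ := LinearMap.congr_fun (dif_tensorCplx (X := X) (G := G') (b := b) n)
      (mapRightFun X (Hom.toGHom f) b (add_zero n) w)
    exact (congrArg (mapRightFun X (Hom.toGHom f) b (add_zero (n + 1))) h₁).trans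
      ((mapRightFun_dif X f b n w).trans h₂.symm))

end Functoriality

/-- An operation on dg-modules which is defined on objects and on morphisms of all degrees. -/
structure DGOp (A B : DGCat k) where
  obj : DGMod A → DGMod B
  map : ∀ {M N : DGMod A} {d : ℤ}, GHom M N d → GHom (obj M) (obj N) d

namespace DGOp

/-- The identity operation. -/
abbrev id (A : DGCat k) : DGOp A A := ⟨fun M => M, fun φ => φ⟩

/-- The composite operation `F ∘ G`. -/
abbrev comp {A B C : DGCat k} (F : DGOp B C) (G : DGOp A B) : DGOp A C :=
  ⟨fun M => F.obj (G.obj M), fun φ => F.map (G.map φ)⟩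

/-- A family `η_M : F(M) → G(M)` of morphisms of degree `m` is dg-natural:
`η_N ∘ F(φ) = (-1)^(m|φ|) G(φ) ∘ η_M` for all homogeneous `φ : M → N`. -/
def IsNat {A B : DGCat k} (F G : DGOp A B) {m : ℤ} (η : ∀ M, GHom (F.obj M) (G.obj M) m) : Prop :=
  ∀ (M N : DGMod A) (d : ℤ) (φ : GHom M N d),
    GHom.comp rfl (η N) (F.map φ) =
      sgn k (m * d) • GHom.comp (add_comm m d) (G.map φ) (η M)

/-- Dg-naturality of a family of closed morphisms of degree `0`. -/
def IsNatHom {A B : DGCat k} (F G : DGOp A B) (η : ∀ M, F.obj M ⟶ G.obj M) : Prop :=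
  IsNat F G fun M => Hom.toGHom (η M)

end DGOp

end DGMod

open DGMod

/-- A 2-fold dg-bimodule over `T`: a module over `T ⊗ T ⊗ T.op`, that is, a family of complexes
`Γ(x,y;z)` covariant in `x` and `y` and contravariant in `z`. -/
abbrev Bimod₂ (T : DGCat k) := DGMod (T.tensor (T.tensor T.op))

namespace Bimod₂

variable {T : DGCat k} (Γ : Bimod₂ T)

/-- The right `T`-module `X ⊠ Y = Γ ⊗ X ⊗ Y`, with `X` in the first covariant slot of `Γ` and `Y`
in the second one. -/
def box (X Y : DGMod T.op) : DGMod T.op := tensorOver Y (tensorOver X Γ)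

/-- The dg-functor `X ⊠ -`. -/
abbrev boxRight (X : DGMod T.op) : DGOp T.op T.op where
  obj Y := Γ.box X Y
  map ψ := mapLeft _ ψ

/-- The dg-functor `- ⊠ Y`. -/
abbrev boxLeft (Y : DGMod T.op) : DGOp T.op T.op where
  obj X := Γ.box X Y
  map φ := mapRight Y (mapLeft Γ φ)

/-- The closed morphism `X ⊠ g`. -/
abbrev whiskerLeft (X : DGMod T.op) {Y Y' : DGMod T.op} (g : Y ⟶ Y') :
    Γ.box X Y ⟶ Γ.box X Y' := homLeft g _

/-- The closed morphism `f ⊠ Y`. -/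
abbrev whiskerRight {X X' : DGMod T.op} (f : X ⟶ X') (Y : DGMod T.op) :
    Γ.box X Y ⟶ Γ.box X' Y := homRight Y (homLeft f Γ)

/-- For a left `T`-module `M`, the `T ⊗ T`-module `M ⊗ Γ`, the tensor product being taken over the
contravariant variable of `Γ`. -/
abbrev tensorLeft (M : DGMod T) : DGMod (T.tensor T) :=
  tensorOver (S := T.op) (M.pullback (DGFunctor.fromOpOp T))
    (Γ.pullback (DGFunctor.rotate T T T.op))

/-- The morphism `f ⊗ Γ` for a morphism `f` of left `T`-modules. -/
abbrev tensorLeftMap {M N : DGMod T} (f : M ⟶ N) : Γ.tensorLeft M ⟶ Γ.tensorLeft N :=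
  homLeft (S := T.op) (pullbackMap (DGFunctor.fromOpOp T) f) _

/-- For a right `T`-module `X`, the `T ⊗ T.op`-module `Γ ⊗ X` with `X` in the first covariant
slot of `Γ`. -/
abbrev tensorRight₁ (X : DGMod T.op) : DGMod (T.tensor T.op) := tensorOver X Γ

/-- The morphism `Γ ⊗ g`, first covariant slot. -/
abbrev tensorRightMap₁ {X Y : DGMod T.op} (g : X ⟶ Y) : Γ.tensorRight₁ X ⟶ Γ.tensorRight₁ Y :=
  homLeft g _

/-- For a right `T`-module `X`, the `T ⊗ T.op`-module `Γ ⊗ X` with `X` in the second covariant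
slot of `Γ`. -/
abbrev tensorRight₂ (X : DGMod T.op) : DGMod (T.tensor T.op) :=
  tensorOver X (Γ.pullback (DGFunctor.exchange T T T.op))

/-- The morphism `Γ ⊗ g`, second covariant slot. -/
abbrev tensorRightMap₂ {X Y : DGMod T.op} (g : X ⟶ Y) : Γ.tensorRight₂ X ⟶ Γ.tensorRight₂ Y :=
  homLeft g _

end Bimod₂

open DGOp

namespace Bimod₂

variable {T : DGCat k} (Γ : Bimod₂ T)

/-- The type of associators: morphisms `X ⊠ (Y ⊠ Z) → (X ⊠ Y) ⊠ Z`. -/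
abbrev Assoc : Type (u + 1) := ∀ X Y Z : DGMod T.op, Γ.box X (Γ.box Y Z) ⟶ Γ.box (Γ.box X Y) Z

/-- Dg-naturality of an associator in each of its three variables. -/
structure Assoc.IsNat (α : Γ.Assoc) : Prop where
  nat₁ : ∀ Y Z, IsNatHom (Γ.boxLeft (Γ.box Y Z)) ((Γ.boxLeft Z).comp (Γ.boxLeft Y))
    fun X => α X Y Z
  nat₂ : ∀ X Z, IsNatHom ((Γ.boxRight X).comp (Γ.boxLeft Z)) ((Γ.boxLeft Z).comp (Γ.boxRight X))
    fun Y => α X Y Z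
  nat₃ : ∀ X Y, IsNatHom ((Γ.boxRight X).comp (Γ.boxRight Y)) (Γ.boxRight (Γ.box X Y))
    fun Z => α X Y Z

/-- The type of morphisms `X ⊠ Y → Y ⊠ X`. -/
abbrev Symm : Type (u + 1) := ∀ X Y : DGMod T.op, Γ.box X Y ⟶ Γ.box Y X

/-- Dg-naturality of a symmetry in each of its two variables. -/
structure Symm.IsNat (c : Γ.Symm) : Prop where
  nat₁ : ∀ Y, IsNatHom (Γ.boxLeft Y) (Γ.boxRight Y) fun X => c X Y
  nat₂ : ∀ X, IsNatHom (Γ.boxRight X) (Γ.boxLeft X) fun Y => c X Y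

/-- The pentagon commutes up to a dg-natural homotopy `η`. -/
structure Pentagon (α : Γ.Assoc) where
  η : ∀ X Y Z W, GHom (Γ.box X (Γ.box Y (Γ.box Z W))) (Γ.box (Γ.box (Γ.box X Y) Z) W) (-1)
  nat₁ : ∀ Y Z W, DGOp.IsNat (Γ.boxLeft (Γ.box Y (Γ.box Z W)))
    ((Γ.boxLeft W).comp ((Γ.boxLeft Z).comp (Γ.boxLeft Y))) fun X => η X Y Z W
  nat₂ : ∀ X Z W, DGOp.IsNat ((Γ.boxRight X).comp (Γ.boxLeft (Γ.box Z W)))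
    ((Γ.boxLeft W).comp ((Γ.boxLeft Z).comp (Γ.boxRight X))) fun Y => η X Y Z W
  nat₃ : ∀ X Y W, DGOp.IsNat ((Γ.boxRight X).comp ((Γ.boxRight Y).comp (Γ.boxLeft W)))
    ((Γ.boxLeft W).comp (Γ.boxRight (Γ.box X Y))) fun Z => η X Y Z W
  nat₄ : ∀ X Y Z, DGOp.IsNat ((Γ.boxRight X).comp ((Γ.boxRight Y).comp (Γ.boxRight Z)))
    (Γ.boxRight (Γ.box (Γ.box X Y) Z)) fun W => η X Y Z W
  comm : ∀ X Y Z W, GHom.IsHomotopy (η X Y Z W)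
    (α X Y (Γ.box Z W) ≫ α (Γ.box X Y) Z W)
    (Γ.whiskerLeft X (α Y Z W) ≫ α X (Γ.box Y Z) W ≫ Γ.whiskerRight (α X Y Z) W)

/-- The unit triangle commutes up to a dg-natural homotopy `μ`. -/
structure Triangle (α : Γ.Assoc) (U : DGMod T.op) (l : ∀ X, Γ.box U X ⟶ X)
    (r : ∀ X, Γ.box X U ⟶ X) where
  μ : ∀ X Y, GHom (Γ.box X (Γ.box U Y)) (Γ.box X Y) (-1)
  nat₁ : ∀ Y, DGOp.IsNat (Γ.boxLeft (Γ.box U Y)) (Γ.boxLeft Y) fun X => μ X Y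
  nat₂ : ∀ X, DGOp.IsNat ((Γ.boxRight X).comp (Γ.boxRight U)) (Γ.boxRight X) fun Y => μ X Y
  comm : ∀ X Y, GHom.IsHomotopy (μ X Y)
    (α X U Y ≫ Γ.whiskerRight (r X) Y) (Γ.whiskerLeft X (l Y))

/-- `c ∘ c` is the identity up to a dg-natural homotopy. -/
structure Involution (c : Γ.Symm) where
  σ : ∀ X Y, GHom (Γ.box X Y) (Γ.box X Y) (-1)
  nat₁ : ∀ Y, DGOp.IsNat (Γ.boxLeft Y) (Γ.boxLeft Y) fun X => σ X Y
  nat₂ : ∀ X, DGOp.IsNat (Γ.boxRight X) (Γ.boxRight X) fun Y => σ X Y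
  comm : ∀ X Y, GHom.IsHomotopy (σ X Y) (c X Y ≫ c Y X) (𝟙 (Γ.box X Y))

/-- `ℓ ∘ c` and `r` agree up to a dg-natural homotopy `κ`. -/
structure UnitSymmetry (c : Γ.Symm) (U : DGMod T.op) (l : ∀ X, Γ.box U X ⟶ X)
    (r : ∀ X, Γ.box X U ⟶ X) where
  κ : ∀ X, GHom (Γ.box X U) X (-1)
  nat : DGOp.IsNat (Γ.boxLeft U) (DGOp.id T.op) κ
  comm : ∀ X, GHom.IsHomotopy (κ X) (c X U ≫ l X) (r X)

/-- The hexagon relating `α` and `c` commutes up to a dg-natural homotopy `λ`. -/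
structure Hexagon (α : Γ.Assoc) (c : Γ.Symm) where
  lam : ∀ X Y Z, GHom (Γ.box X (Γ.box Y Z)) (Γ.box (Γ.box Z X) Y) (-1)
  nat₁ : ∀ Y Z, DGOp.IsNat (Γ.boxLeft (Γ.box Y Z)) ((Γ.boxLeft Y).comp (Γ.boxRight Z))
    fun X => lam X Y Z
  nat₂ : ∀ X Z, DGOp.IsNat ((Γ.boxRight X).comp (Γ.boxLeft Z)) (Γ.boxRight (Γ.box Z X))
    fun Y => lam X Y Z
  nat₃ : ∀ X Y, DGOp.IsNat ((Γ.boxRight X).comp (Γ.boxRight Y))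
    ((Γ.boxLeft Y).comp (Γ.boxLeft X)) fun Z => lam X Y Z
  comm : ∀ X Y Z, GHom.IsHomotopy (lam X Y Z)
    (Γ.whiskerLeft X (c Y Z) ≫ α X Z Y ≫ Γ.whiskerRight (c X Z) Y)
    (α X Y Z ≫ c (Γ.box X Y) Z ≫ α Z X Y)

end Bimod₂

/-- A pseudo dg-tensor structure on `T`: a 2-fold bimodule `Γ`, a unit `U`, and morphisms of
bimodules `α`, `ℓ`, `r`, `c` which are quasi-isomorphisms, together with homotopies expressing the
coherence conditions.

By the enriched Yoneda lemma, a morphism of multi-bimodules is the same thing as a family of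
morphisms between the functors obtained by tensoring with right modules in the covariant variables
which is dg-natural in each of them; the structure morphisms and the homotopies are given in this
form. -/
structure PseudoDGTensor (T : DGCat k) where
  Γ : Bimod₂ T
  U : DGMod T.op
  α : Γ.Assoc
  α_nat : α.IsNat
  ℓ : ∀ X, Γ.box U X ⟶ X
  ℓ_nat : IsNatHom (Γ.boxRight U) (DGOp.id T.op) ℓ
  r : ∀ X, Γ.box X U ⟶ X
  r_nat : IsNatHom (Γ.boxLeft U) (DGOp.id T.op) r
  c : Γ.Symm
  c_nat : c.IsNat
  α_quasiIso : ∀ X Y Z, X.IsCofibrant → Y.IsCofibrant → Z.IsCofibrant → quasiIso T.op (α X Y Z)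
  ℓ_quasiIso : ∀ X, X.IsCofibrant → quasiIso T.op (ℓ X)
  r_quasiIso : ∀ X, X.IsCofibrant → quasiIso T.op (r X)
  c_quasiIso : ∀ X Y, X.IsCofibrant → Y.IsCofibrant → quasiIso T.op (c X Y)
  associativity : Γ.Pentagon α
  unit : Γ.Triangle α U ℓ r
  symmetry : Γ.Involution c
  unit_symmetry : Γ.UnitSymmetry c U ℓ r
  compatibility : Γ.Hexagon α c

/-- The pseudo dg-tensor structure is perfect: each right module `Γ(x,y;-)` is quasi-represented by
a perfect module, and so is `X ⊠ Y` for all perfect right modules `X` and `Y`. -/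
structure PseudoDGTensor.IsPerfect {T : DGCat k} (P : PseudoDGTensor T) : Prop where
  right_quasiRepresentable : ∀ x y : T.Obj,
    DGMod.IsQuasiPerfect ((DGMod.pullback (DGFunctor.inr T (T.tensor T.op) x) P.Γ).pullback
      (DGFunctor.inr T T.op y))
  box_perfect : ∀ X Y : DGMod T.op, X.IsPerfect → Y.IsPerfect → IsQuasiPerfect (P.Γ.box X Y)

/-- A cofibrant resolution of a morphism `f : M ⟶ N`: cofibrant modules `P` and `Q`,
quasi-isomorphisms `P ⟶ M` and `Q ⟶ N`, and a lift `P ⟶ Q` of `f` for which the square commutes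
up to homotopy. -/
structure CofRes {A : DGCat k} {M N : DGMod A} (f : M ⟶ N) where
  P : DGMod A
  Q : DGMod A
  cofibrant_P : P.IsCofibrant
  cofibrant_Q : Q.IsCofibrant
  p : P ⟶ M
  q : Q ⟶ N
  quasiIso_p : quasiIso A p
  quasiIso_q : quasiIso A q
  lift : P ⟶ Q
  comm : Homotopic (lift ≫ q) (p ≫ f)

end

end DG

/-! ### Quasi-isomorphisms in terms of elements, and the homotopy relation -/

namespace DG

noncomputable section

variable {k : Type u} [CommRing k]

/-! Tensoring with `Γ` has a left inverse up to quasi-isomorphism, namely tensoring with the unit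
`U` in a covariant variable that is still free. For a right module `X` in the second covariant slot
this is the constraint `ℓ_X : U ⊠ X → X`, in the first slot it is `r_X : X ⊠ U → X`; both are
quasi-isomorphisms for cofibrant `X`. For a left module `M` one interchanges the tensor products, `U
⊗ (M ⊗ Γ) ≅ M ⊗ (U ⊗ Γ)`, and compares `U ⊗ Γ` with the diagonal bimodule `T`, for which `M ⊗ T ≅
M`. The comparison is `ℓ` on the representable modules `T(-, y)`: by co-Yoneda, `U ⊠ T(-, y)` is the
value of `U ⊗ Γ` at `y`, and naturality of `ℓ` for morphisms of all degrees makes the resulting maps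
linear in `y` as well (`unitDiagonal`). The comparison is a quasi-isomorphism because representable
modules are cofibrant, and it remains one after tensoring with a cofibrant `M`
(`quasiIso_homRight`).

In each case there are thus functors `F = - ⊗ Γ` and `G = U ⊗ -` which respect homotopies, and a
natural map `G F X → X` which is a quasi-isomorphism for cofibrant `X` (`QuasiRetraction`). That `F`
preserves the three properties is formal. For reflection, apply `G`, compare `G F f` with `f` in the
derived category, and return to the homotopy category: morphisms out of a cofibrant module are the
same in both (`IsCofibrant.toHo_map_eq_iff`, `IsCofibrant.toHo_map_surjective`). Functors do not
preserve epimorphisms in general, but here every epimorphism splits, because a morphism followed by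
the inclusion into its cone is nullhomotopic (`epi_toH0_iff`, `epi_toHo_iff`).

For (B), a cofibrant `U` makes `G` preserve quasi-isomorphisms, so `G` descends to derived
categories and the same argument runs there on a cofibrant resolution of the morphism.

Two constructions support this. The homotopy pullback `hoPull` turns the strict lifting property of
cofibrant modules into lifting up to homotopy along all quasi-isomorphisms, and gives a right
calculus of fractions in the homotopy category. Flatness of cofibrant modules is proved by duality:
linear forms on `X ⊗ G` with values in the injective cogenerator `CharacterModule k` are morphisms
from `X` to the dual of `G`, so that flatness becomes a lifting statement. -/

lemma mono_homologyMap_iff_elements {K L : Cplx k} (φ : K ⟶ L) (n : ℤ) :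
    Mono (HomologicalComplex.homologyMap φ (n + 1)) ↔
      ∀ (x : K.X (n + 1)) (y : L.X n), dif K (n + 1) x = 0 → (φ.f (n + 1)).hom x = dif L n y →
        ∃ w : K.X n, dif K n w = x := by
  rw [HomologicalComplex.mono_homologyMap_iff_up_to_refinements φ n (n + 1) (n + 1 + 1)
    (by simp) (by simp)]
  constructor
  · intro H x y hx hxy
    -- The test object `k` represents elements; an element over `1` under the epimorphism `π`
    -- recovers an honest element from the refinement.
    obtain ⟨A', π, hπ, x₁, h₁⟩ := H (A := ModuleCat.of k k)
      (ModuleCat.ofHom (LinearMap.toSpanSingleton k _ x))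
      (by ext; simpa [dif] using hx) (ModuleCat.ofHom (LinearMap.toSpanSingleton k _ y))
      (by ext; simpa [dif] using hxy)
    obtain ⟨a, ha⟩ := (ModuleCat.epi_iff_surjective π).mp hπ (1 : k)
    refine ⟨x₁.hom a, ?_⟩
    have := congrArg (fun f => f.hom a) h₁
    simp only [ModuleCat.hom_comp, LinearMap.comp_apply] at this
    rw [dif, ← this]
    change LinearMap.toSpanSingleton k _ x (π.hom a) = x
    rw [show π.hom a = (1 : k) from ha]
    simp
  · intro H A x₂ hx₂ y₁ hy
    -- Primitives cannot be chosen linearly in `a`, so the refinement is the module of all pairs of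
    -- an `a` and a primitive; it surjects onto `A` by `H`.
    let S : Submodule k (A × K.X n) :=
      LinearMap.eqLocus (x₂.hom ∘ₗ LinearMap.fst k _ _) ((dif K n) ∘ₗ LinearMap.snd k _ _)
    refine ⟨ModuleCat.of k S, ModuleCat.ofHom ((LinearMap.fst k _ _) ∘ₗ S.subtype), ?_,
      ModuleCat.ofHom ((LinearMap.snd k _ _) ∘ₗ S.subtype), ?_⟩
    · rw [ModuleCat.epi_iff_surjective]
      intro a
      obtain ⟨w, hw⟩ := H (x₂.hom a) (y₁.hom a) (congrArg (fun f => f.hom a) hx₂)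
        (congrArg (fun f => f.hom a) hy)
      exact ⟨⟨(a, w), hw.symm⟩, rfl⟩
    · ext a
      exact a.2

/-- The same two devices as for monomorphisms: the test object `k`, and the module of all solutions
as refinement. The degree is `n + 1` so that the incoming differential `dif L n` needs no transport.
-/
lemma epi_homologyMap_iff_elements {K L : Cplx k} (φ : K ⟶ L) (n : ℤ) :
    Epi (HomologicalComplex.homologyMap φ (n + 1)) ↔
      ∀ y : L.X (n + 1), dif L (n + 1) y = 0 → ∃ (x : K.X (n + 1)) (v : L.X n),
        dif K (n + 1) x = 0 ∧ y = (φ.f (n + 1)).hom x + dif L n v := by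
  rw [HomologicalComplex.epi_homologyMap_iff_up_to_refinements φ n (n + 1) (n + 1 + 1)
    (by simp) (by simp)]
  constructor
  · intro H y hy
    obtain ⟨A', π, hπ, x₂, hx₂, y₁, h₁⟩ := H (A := ModuleCat.of k k)
      (ModuleCat.ofHom (LinearMap.toSpanSingleton k _ y)) (by ext; simpa [dif] using hy)
    obtain ⟨a, ha⟩ := (ModuleCat.epi_iff_surjective π).mp hπ (1 : k)
    refine ⟨x₂.hom a, y₁.hom a, congrArg (fun f => f.hom a) hx₂, ?_⟩
    have := congrArg (fun f => f.hom a) h₁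
    refine Eq.trans ?_ this
    change y = LinearMap.toSpanSingleton k _ y (π.hom a)
    rw [show π.hom a = (1 : k) from ha]
    simp
  · intro H A y₂ hy₂
    let S : Submodule k (A × K.X (n + 1) × L.X n) :=
      LinearMap.eqLocus (y₂.hom ∘ₗ LinearMap.fst k _ _)
        (((φ.f (n + 1)).hom ∘ₗ LinearMap.fst k _ _ + (dif L n) ∘ₗ LinearMap.snd k _ _) ∘ₗ
          LinearMap.snd k _ _) ⊓
      LinearMap.ker ((dif K (n + 1)) ∘ₗ LinearMap.fst k _ _ ∘ₗ LinearMap.snd k A _)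
    refine ⟨ModuleCat.of k S, ModuleCat.ofHom ((LinearMap.fst k _ _) ∘ₗ S.subtype), ?_,
      ModuleCat.ofHom ((LinearMap.fst k _ _) ∘ₗ (LinearMap.snd k _ _) ∘ₗ S.subtype), ?_,
      ModuleCat.ofHom ((LinearMap.snd k _ _) ∘ₗ (LinearMap.snd k _ _) ∘ₗ S.subtype), ?_⟩
    · rw [ModuleCat.epi_iff_surjective]
      intro a
      obtain ⟨x, v, hx, hv⟩ := H (y₂.hom a) (congrArg (fun f => f.hom a) hy₂)
      exact ⟨⟨(a, x, v), hv, hx⟩, rfl⟩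
    · ext a
      exact a.2.2
    · ext a
      exact a.2.1

/-- A morphism of complexes is a quasi-isomorphism when it is injective and surjective on
cohomology classes. -/
lemma quasiIso_iff_elements {K L : Cplx k} (φ : K ⟶ L) :
    QuasiIso φ ↔ ∀ n : ℤ,
      (∀ (x : K.X (n + 1)) (y : L.X n), dif K (n + 1) x = 0 →
        (φ.f (n + 1)).hom x = dif L n y → ∃ w : K.X n, dif K n w = x) ∧
      (∀ y : L.X (n + 1), dif L (n + 1) y = 0 → ∃ (x : K.X (n + 1)) (v : L.X n),
        dif K (n + 1) x = 0 ∧ y = (φ.f (n + 1)).hom x + dif L n v) := by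
  rw [quasiIso_iff]
  simp only [← mono_homologyMap_iff_elements, ← epi_homologyMap_iff_elements,
    quasiIsoAt_iff_isIso_homologyMap]
  constructor
  · intro H n
    have := H (n + 1)
    exact ⟨inferInstance, inferInstance⟩
  · intro H n
    obtain ⟨n, rfl⟩ : ∃ m, n = m + 1 := ⟨n - 1, by ring⟩
    obtain ⟨h₁, h₂⟩ := H n
    exact isIso_of_mono_of_epi _

namespace DGMod

variable {A : DGCat k}

lemma quasiIso_iff {M N : DGMod A} (f : M ⟶ N) :
    quasiIso A f ↔ ∀ (x : A.Obj) (n : ℤ),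
      (∀ (m : (M.obj x).X (n + 1)) (y : (N.obj x).X n), dif (M.obj x) (n + 1) m = 0 →
        Hom.ap f x (n + 1) m = dif (N.obj x) n y → ∃ w, dif (M.obj x) n w = m) ∧
      (∀ y : (N.obj x).X (n + 1), dif (N.obj x) (n + 1) y = 0 →
        ∃ (m : (M.obj x).X (n + 1)) (v : (N.obj x).X n),
          dif (M.obj x) (n + 1) m = 0 ∧ y = Hom.ap f x (n + 1) m + dif (N.obj x) n v) :=
  forall_congr' fun _ => quasiIso_iff_elements _

instance : (quasiIso A).IsMultiplicative where
  id_mem M x := by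
    change QuasiIso (𝟙 (M.obj x))
    infer_instance
  comp_mem f g hf hg x := by
    have := hf x
    have := hg x
    change QuasiIso (Hom.app f x ≫ Hom.app g x)
    infer_instance

instance : (quasiIso A).HasTwoOutOfThreeProperty where
  of_postcomp f g hg hfg x := by
    have := hg x
    have : QuasiIso (Hom.app f x ≫ Hom.app g x) := hfg x
    exact quasiIso_of_comp_right (Hom.app f x) (Hom.app g x)
  of_precomp f g hf hfg x := by
    have := hf x
    have : QuasiIso (Hom.app f x ≫ Hom.app g x) := hfg x
    exact quasiIso_of_comp_left (Hom.app f x) (Hom.app g x)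

/-- A morphism which is bijective in every degree is a quasi-isomorphism. -/
lemma quasiIso_of_bijective {M N : DGMod A} (f : M ⟶ N)
    (hf : ∀ x n, Function.Bijective (Hom.ap f x n)) : quasiIso A f := by
  rw [quasiIso_iff]
  intro x n
  constructor
  · intro m y _ hy
    obtain ⟨w, rfl⟩ := (hf x n).2 y
    exact ⟨w, (hf x _).1 ((ap_dif f x n w).trans hy.symm)⟩
  · intro y hy
    obtain ⟨m, rfl⟩ := (hf x _).2 y
    refine ⟨m, 0, (hf x _).1 ?_, by simp⟩
    rw [ap_dif, hy, map_zero]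

@[simp] lemma ap_sub {M N : DGMod A} (f g : M ⟶ N) (x : A.Obj) (n : ℤ) (m : (M.obj x).X n) :
    Hom.ap (f - g) x n m = Hom.ap f x n m - Hom.ap g x n m := rfl

namespace GHom

variable {M N P : DGMod A} {d : ℤ}

instance : Zero (GHom M N d) := ⟨⟨fun _ _ _ _ => 0, fun _ _ _ _ _ _ => by simp⟩⟩

instance : Add (GHom M N d) := ⟨fun φ ψ => ⟨fun x _ _ h => φ.app x h + ψ.app x h,
  fun h hs hj ht a m => by
    simp only [LinearMap.add_apply, φ.comm h hs hj ht, ψ.comm h hs hj ht, map_add, smul_add]⟩⟩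

@[simp] lemma zero_app (x : A.Obj) {i j : ℤ} (h : i + d = j) : (0 : GHom M N d).app x h = 0 := rfl

@[simp] lemma add_app (φ ψ : GHom M N d) (x : A.Obj) {i j : ℤ} (h : i + d = j) :
    (φ + ψ).app x h = φ.app x h + ψ.app x h := rfl

@[simp] lemma smul_app (r : k) (φ : GHom M N d) (x : A.Obj) {i j : ℤ} (h : i + d = j) :
    (r • φ).app x h = r • φ.app x h := rfl

/-- Composition with a closed morphism on the left. -/
def postcomp (φ : GHom M N d) (f : N ⟶ P) : GHom M P d where
  app x _ j h := Hom.ap f x j ∘ₗ φ.app x h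
  comm h hs hj ht a m := by
    simp only [LinearMap.comp_apply, φ.comm h hs hj ht, map_smul, ap_act f ht]

/-- Composition with a closed morphism on the right. -/
def precomp (f : M ⟶ N) (φ : GHom N P d) : GHom M P d where
  app x i _ h := φ.app x h ∘ₗ Hom.ap f x i
  comm h hs hj ht a m := by
    simp only [LinearMap.comp_apply, ap_act, φ.comm h hs hj ht]

@[simp] lemma postcomp_app (φ : GHom M N d) (f : N ⟶ P) (x : A.Obj) {i j : ℤ} (h : i + d = j)
    (m : (M.obj x).X i) : (φ.postcomp f).app x h m = Hom.ap f x j (φ.app x h m) := rfl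

@[simp] lemma precomp_app (f : M ⟶ N) (φ : GHom N P d) (x : A.Obj) {i j : ℤ} (h : i + d = j)
    (m : (M.obj x).X i) : (precomp f φ).app x h m = φ.app x h (Hom.ap f x i m) := rfl

end GHom

variable {M N P : DGMod A}

lemma Homotopic.refl (f : M ⟶ N) : Homotopic f f := ⟨0, fun x n m => by simp⟩

lemma Homotopic.symm {f g : M ⟶ N} : Homotopic f g → Homotopic g f := by
  rintro ⟨s, hs⟩
  refine ⟨(-1 : k) • s, fun x n m => ?_⟩
  rw [← neg_sub, hs x n m]
  simp [add_comm]

lemma Homotopic.trans {f g h : M ⟶ N} : Homotopic f g → Homotopic g h → Homotopic f h := by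
  rintro ⟨s, hs⟩ ⟨t, ht⟩
  refine ⟨s + t, fun x n m => ?_⟩
  rw [← sub_add_sub_cancel, hs x n m, ht x n m]
  simp only [GHom.add_app, LinearMap.add_apply, map_add]
  abel

lemma homotopic_iff_sub {f g : M ⟶ N} : Homotopic f g ↔ Homotopic (f - g) 0 := by
  constructor <;> rintro ⟨s, hs⟩ <;> exact ⟨s, fun x n m => by simpa using hs x n m⟩

lemma Homotopic.comp_right {f g : M ⟶ N} (h : N ⟶ P) :
    Homotopic f g → Homotopic (f ≫ h) (g ≫ h) := by
  rintro ⟨s, hs⟩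
  refine ⟨s.postcomp h, fun x n m => ?_⟩
  simp only [ap_comp, GHom.postcomp_app, ← ap_dif, ← map_sub, hs x n m, map_add]

lemma Homotopic.comp_left (h : M ⟶ N) {f g : N ⟶ P} :
    Homotopic f g → Homotopic (h ≫ f) (h ≫ g) := by
  rintro ⟨s, hs⟩
  refine ⟨s.precomp h, fun x n m => ?_⟩
  simp only [ap_comp, GHom.precomp_app, hs x n, ap_dif]

/-- Since homotopy is already a congruence, `toH0` identifies exactly the homotopic morphisms. -/
instance : Congruence (Homotopic (A := A)) where
  equivalence := ⟨Homotopic.refl, Homotopic.symm, Homotopic.trans⟩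
  comp_left f _ _ h := Homotopic.comp_left f h
  comp_right g h := Homotopic.comp_right g h

lemma toH0_map_eq_iff {f g : M ⟶ N} : (toH0 A).map f = (toH0 A).map g ↔ Homotopic f g :=
  Quotient.functor_map_eq_iff _ _ _

end DGMod

end

end DG

/-! ### Signs, differentials and modules with flexible degree indices -/

namespace DG

noncomputable section

variable {k : Type u} [CommRing k]

lemma sgn_neg (n : ℤ) : sgn k (-n) = sgn k n := by simp [sgn]

lemma sgn_neg_one_mul (n : ℤ) : sgn k (-1 * n) = sgn k n := by rw [neg_one_mul, sgn_neg]

/-- The differential of a complex, between any two degrees. -/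
def dd (K : Cplx k) (i j : ℤ) : K.X i →ₗ[k] K.X j := (K.d i j).hom

lemma dif_eq_dd (K : Cplx k) (n : ℤ) : dif K n = dd K n (n + 1) := rfl

@[simp] lemma dd_dd (K : Cplx k) (i j l : ℤ) (x : K.X i) : dd K j l (dd K i j x) = 0 :=
  congrArg (fun f => f.hom x) (K.d_comp_d i j l)

/-- The complex given by a graded module and a differential. -/
def cplxOf (V : ℤ → Type u) [∀ n, AddCommGroup (V n)] [∀ n, Module k (V n)]
    (δ : ∀ n, V n →ₗ[k] V (n + 1)) (hδ : ∀ n v, δ (n + 1) (δ n v) = 0) : Cplx k :=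
  CochainComplex.of (fun n => ModuleCat.of k (V n)) (fun n => ModuleCat.ofHom (δ n))
    (fun n => by ext v; exact hδ n v)

lemma dif_cplxOf (V : ℤ → Type u) [∀ n, AddCommGroup (V n)] [∀ n, Module k (V n)]
    (δ : ∀ n, V n →ₗ[k] V (n + 1)) (hδ : ∀ n v, δ (n + 1) (δ n v) = 0) (n : ℤ) :
    dif (cplxOf V δ hδ) n = δ n := by
  simp [dif, cplxOf, CochainComplex.of_d]
  rfl

namespace DGMod

variable {A : DGCat k}

/-- All degrees are variables tied by equations, so the Leibniz rule applies between degrees such as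
`j + -1 + 1` and `j`, which agree only propositionally. -/
lemma dd_act (M : DGMod A) {x y : A.Obj} {i j n i' j' n' : ℤ} (h : i + j = n) (hi : i + 1 = i')
    (hj : j + 1 = j') (hn : n + 1 = n') (h₁ : i' + j = n') (h₂ : i + j' = n')
    (a : (A.Hom x y).X i) (m : (M.obj x).X j) :
    dd (M.obj y) n n' (M.act h a m) = M.act h₁ (dd (A.Hom x y) i i' a) m +
        sgn k i • M.act h₂ a (dd (M.obj x) j j' m) := by
  subst hi hj hn
  exact M.dif_act h a m

lemma dd_toGHom {M N : DGMod A} (f : M ⟶ N) (x : A.Obj) {i j i' j' : ℤ} (h : i + 0 = j)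
    (h' : i' + 0 = j') (m : (M.obj x).X i) :
    dd (N.obj x) j j' ((Hom.toGHom f).app x h m) =
      (Hom.toGHom f).app x h' (dd (M.obj x) i i' m) := by
  obtain rfl : i = j := by omega
  obtain rfl : i' = j' := by omega
  exact congrArg (fun t => t.hom m) ((Hom.app f x).comm i i')

lemma toGHom_act {M N : DGMod A} (f : M ⟶ N) {x y : A.Obj} {i j n j' n' : ℤ} (h : i + j = n)
    (hj : j + 0 = j') (hn : n + 0 = n') (h' : i + j' = n') (a : (A.Hom x y).X i)
    (m : (M.obj x).X j) :
    (Hom.toGHom f).app y hn (M.act h a m) = N.act h' a ((Hom.toGHom f).app x hj m) := by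
  rw [(Hom.toGHom f).comm h hn hj h' a m, zero_mul, sgn_zero, one_smul]

/-- The dg-module given by graded modules with a differential and an action. -/
def ofGraded (V : A.Obj → ℤ → Type u) [∀ x n, AddCommGroup (V x n)] [∀ x n, Module k (V x n)]
    (δ : ∀ x n, V x n →ₗ[k] V x (n + 1)) (hδ : ∀ x n v, δ x (n + 1) (δ x n v) = 0)
    (act : ∀ {x y : A.Obj} {i j n : ℤ}, i + j = n → ((A.Hom x y).X i →ₗ[k] V x j →ₗ[k] V y n))
    (dif_act : ∀ {x y : A.Obj} {i j : ℤ} (a : (A.Hom x y).X i) (v : V x j),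
      δ y (i + j) (act rfl a v) = act (show i + 1 + j = i + j + 1 by omega) (dif (A.Hom x y) i a) v +
        sgn k i • act (show i + (j + 1) = i + j + 1 by omega) a (δ x j v))
    (one_act : ∀ {x : A.Obj} {j : ℤ} (v : V x j), act (zero_add j) (A.one x) v = v)
    (comp_act : ∀ {x y z : A.Obj} {a b c n : ℤ} (h : a + b + c = n) (h' : a + (b + c) = n)
      (f : (A.Hom y z).X a) (g : (A.Hom x y).X b) (v : V x c),
      act h (A.comp rfl f g) v = act h' f (act rfl g v)) : DGMod A where
  obj x := cplxOf (V x) (δ x) (hδ x)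
  act h := act h
  dif_act h a m := by
    subst h
    rw [dif_cplxOf, dif_cplxOf]
    exact dif_act a m
  one_act m := one_act m
  comp_act h₁ h₂ h₃ h₄ f g m := by
    subst h₁ h₃
    exact comp_act h₂ h₄ f g m

/-- `Hom.toGHom (𝟙 N)` is used throughout as transport between equal degrees; this lemma absorbs
such a transport into the preceding morphism. -/
lemma toGHom_id_app {M N : DGMod A} (f : M ⟶ N) (x : A.Obj) {i j l : ℤ} (h : i + 0 = j)
    (h' : j + 0 = l) (h'' : i + 0 = l) (m : (M.obj x).X i) :
    (Hom.toGHom (𝟙 N)).app x h' ((Hom.toGHom f).app x h m) = (Hom.toGHom f).app x h'' m := by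
  obtain rfl : i = j := by omega
  obtain rfl : i = l := by omega
  rfl

lemma GHom.IsHomotopy.dd_add {M N : DGMod A} {f g : M ⟶ N} {s : GHom M N (-1)}
    (hs : s.IsHomotopy f g) (x : A.Obj) {i j l i' : ℤ} (hi : i + 1 = i') (hj : i + -1 = j)
    (hl : i + 0 = l) (hl' : i' + -1 = l) (m : (M.obj x).X i) :
    (Hom.toGHom f).app x hl m - (Hom.toGHom g).app x hl m =
      dd (N.obj x) j l (s.app x hj m) + s.app x hl' (dd (M.obj x) i i' m) := by
  obtain rfl : i = j + 1 := by omega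
  subst hi
  obtain rfl : j + 1 = l := by omega
  exact hs x j m

lemma toGHom_comp_app {M N P : DGMod A} (f : M ⟶ N) (g : N ⟶ P) (x : A.Obj) {i j : ℤ}
    (h : i + 0 = j) (m : (M.obj x).X i) :
    (Hom.toGHom (f ≫ g)).app x h m = (Hom.toGHom g).app x h (Hom.ap f x i m) := by
  obtain rfl : i = j := by omega
  rfl

/-- This and the next lemma are the injective and surjective halves of `quasiIso_iff`, in a form
usable in degrees like `n + -1`. -/
lemma quasiIso.exists_dd_eq {M N : DGMod A} {f : M ⟶ N} (hf : quasiIso A f) (x : A.Obj) {i j l : ℤ}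
    (h : i + 1 = j) (h' : j + 1 = l) (m : (M.obj x).X j) (hm : dd (M.obj x) j l m = 0)
    (y : (N.obj x).X i) (hy : Hom.ap f x j m = dd (N.obj x) i j y) :
    ∃ w, dd (M.obj x) i j w = m := by
  subst h h'
  exact ((quasiIso_iff f).mp hf x i).1 m y hm hy

lemma quasiIso.exists_eq_add {M N : DGMod A} {f : M ⟶ N} (hf : quasiIso A f) (x : A.Obj)
    {i j l : ℤ} (h : i + 1 = j) (h' : j + 1 = l) (y : (N.obj x).X j)
    (hy : dd (N.obj x) j l y = 0) :
    ∃ (m : (M.obj x).X j) (v : (N.obj x).X i),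
      dd (M.obj x) j l m = 0 ∧ y = Hom.ap f x j m + dd (N.obj x) i j v := by
  subst h h'
  exact ((quasiIso_iff f).mp hf x i).2 y hy

lemma ap_dd {M N : DGMod A} (f : M ⟶ N) (x : A.Obj) (i j : ℤ) (m : (M.obj x).X i) :
    Hom.ap f x j (dd (M.obj x) i j m) = dd (N.obj x) i j (Hom.ap f x i m) :=
  (congrArg (fun t => t.hom m) ((Hom.app f x).comm i j)).symm

/-! ### Homotopy pullbacks, and lifting from cofibrant modules up to homotopy -/

section HoPull

variable {X Y Z : DGMod A} (w : X ⟶ Y) (v : Z ⟶ Y)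

/-- The differential of the homotopy pullback, `d (a, c, y) = (da, dc, w(a) - v(c) - dy)`. -/
def hoPullDif (x : A.Obj) (n : ℤ) :
    ((X.obj x).X n × (Z.obj x).X n × (Y.obj x).X (n + -1)) →ₗ[k]
      ((X.obj x).X (n + 1) × (Z.obj x).X (n + 1) × (Y.obj x).X (n + 1 + -1)) :=
  (dif (X.obj x) n ∘ₗ LinearMap.fst k _ _).prod
    ((dif (Z.obj x) n ∘ₗ LinearMap.fst k _ _ ∘ₗ LinearMap.snd k _ _).prod
      ((Hom.toGHom w).app x (by omega) ∘ₗ LinearMap.fst k _ _ -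
        (Hom.toGHom v).app x (by omega) ∘ₗ LinearMap.fst k _ _ ∘ₗ LinearMap.snd k _ _ -
        dd (Y.obj x) _ _ ∘ₗ LinearMap.snd k _ _ ∘ₗ LinearMap.snd k _ _))

/-- The action of the dg-category on the homotopy pullback. -/
def hoPullAct (X Y Z : DGMod A) {x y : A.Obj} {i j n : ℤ} (h : i + j = n) :
    (A.Hom x y).X i →ₗ[k] ((X.obj x).X j × (Z.obj x).X j × (Y.obj x).X (j + -1)) →ₗ[k]
      ((X.obj y).X n × (Z.obj y).X n × (Y.obj y).X (n + -1)) :=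
  LinearMap.mk₂ k (fun a e => (X.act h a e.1, Z.act h a e.2.1,
      -- The third coordinate lives in a shift of `Y` by an odd degree, hence the sign `(-1)^|a|`.
      sgn k i • Y.act (show i + (j + -1) = n + -1 by omega) a e.2.2))
    (fun _ _ _ => by simp only [map_add, LinearMap.add_apply, smul_add]; rfl)
    (fun r _ _ => by
      simp only [map_smul, LinearMap.smul_apply]
      rw [smul_comm _ r]; rfl)
    (fun _ _ _ => by simp only [map_add, smul_add, Prod.fst_add, Prod.snd_add]; rfl)
    (fun r _ _ => by
      simp only [map_smul, Prod.smul_fst, Prod.smul_snd]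
      rw [smul_comm _ r]; rfl)

lemma hoPullDif_comp (x : A.Obj) (n : ℤ)
    (e : (X.obj x).X n × (Z.obj x).X n × (Y.obj x).X (n + -1)) :
    hoPullDif w v x (n + 1) (hoPullDif w v x n e) = 0 := by
  refine Prod.ext (dif_dif _ _ _) (Prod.ext (dif_dif _ _ _) ?_)
  change (Hom.toGHom w).app x _ (dd (X.obj x) n (n + 1) e.1) -
    (Hom.toGHom v).app x _ (dd (Z.obj x) n (n + 1) e.2.1) -
    dd (Y.obj x) _ _ ((Hom.toGHom w).app x _ e.1 - (Hom.toGHom v).app x _ e.2.1 -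
      dd (Y.obj x) _ _ e.2.2) = 0
  rw [map_sub, map_sub, dd_toGHom w x _ (show n + 1 + 0 = n + 1 + 1 + -1 by omega),
    dd_toGHom v x _ (show n + 1 + 0 = n + 1 + 1 + -1 by omega), dd_dd]
  abel

/-- The homotopy pullback of `w : X ⟶ Y` and `v : Z ⟶ Y`. -/
def hoPull : DGMod A :=
  ofGraded (fun x n => (X.obj x).X n × (Z.obj x).X n × (Y.obj x).X (n + -1))
    (hoPullDif w v) (hoPullDif_comp w v)
    (hoPullAct X Y Z)
    (fun {x y i j} a e => by
      refine Prod.ext (X.dif_act rfl a e.1) (Prod.ext (Z.dif_act rfl a e.2.1) ?_)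
      change (Hom.toGHom w).app y _ (X.act rfl a e.1) - (Hom.toGHom v).app y _ (Z.act rfl a e.2.1) -
        dd (Y.obj y) _ _ (sgn k i • Y.act _ a e.2.2) =
        sgn k (i + 1) • Y.act _ (dif (A.Hom x y) i a) e.2.2 +
        sgn k i • sgn k i • Y.act _ a ((Hom.toGHom w).app x _ e.1 -
          (Hom.toGHom v).app x _ e.2.1 - dd (Y.obj x) _ _ e.2.2)
      rw [toGHom_act w rfl (show j + 0 = j + 1 + -1 by omega) _ (by omega),
        toGHom_act v rfl (show j + 0 = j + 1 + -1 by omega) _ (by omega), map_smul,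
        dd_act Y _ rfl (show j + -1 + 1 = j + 1 + -1 by omega) (by omega) (by omega) (by omega),
        sgn_add, sgn_one, dif_eq_dd]
      simp only [smul_smul, sgn_mul_self, map_sub, smul_add, one_smul, mul_neg_one, neg_smul]
      abel)
    (fun {x j} e => by
      refine Prod.ext (X.one_act e.1) (Prod.ext (Z.one_act e.2.1) ?_)
      change sgn k 0 • Y.act _ (A.one x) e.2.2 = _
      rw [sgn_zero, one_smul]
      exact Y.one_act e.2.2)
    (fun {x y z a b c n} h h' f g e => by
      refine Prod.ext (X.comp_act rfl h rfl h' f g e.1)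
        (Prod.ext (Z.comp_act rfl h rfl h' f g e.2.1) ?_)
      change sgn k (a + b) • Y.act _ (A.comp rfl f g) e.2.2 =
        sgn k a • Y.act _ f (sgn k b • Y.act _ g e.2.2)
      rw [map_smul, smul_smul, ← sgn_add,
        Y.comp_act rfl _ (show b + (c + -1) = b + c + -1 by omega) (by omega)])

lemma hoPull_dif (x : A.Obj) (n : ℤ) :
    dif ((hoPull w v).obj x) n = hoPullDif w v x n :=
  dif_cplxOf _ _ (hoPullDif_comp w v x) n

/-- The projection of the homotopy pullback to `X`. -/
def hoPullFst : hoPull w v ⟶ X :=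
  mkHom (fun x n => LinearMap.fst k ((X.obj x).X n) ((Z.obj x).X n × (Y.obj x).X (n + -1)))
    (fun x n m => by rw [hoPull_dif]; rfl) (fun h a m => rfl)

/-- The projection of the homotopy pullback to `Z`. -/
def hoPullSnd : hoPull w v ⟶ Z :=
  mkHom (fun x n => LinearMap.fst k ((Z.obj x).X n) ((Y.obj x).X (n + -1)) ∘ₗ
      LinearMap.snd k ((X.obj x).X n) ((Z.obj x).X n × (Y.obj x).X (n + -1)))
    (fun x n m => by rw [hoPull_dif]; rfl) (fun h a m => rfl)

/-- The square of a homotopy pullback commutes up to homotopy. -/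
lemma hoPull_homotopic : Homotopic (hoPullFst w v ≫ w) (hoPullSnd w v ≫ v) := by
  -- The homotopy is the third coordinate, transported to degree `j`: the term `w(a) - v(c) - dy` of
  -- the differential is the homotopy identity.
  refine ⟨⟨fun x i j h =>
    (Hom.toGHom (𝟙 Y)).app x (show i + -1 + 0 = j by omega) ∘ₗ LinearMap.snd k ((Z.obj x).X i) ((Y.obj x).X (i + -1)) ∘ₗ
      LinearMap.snd k ((X.obj x).X i) ((Z.obj x).X i × (Y.obj x).X (i + -1)), ?_⟩, ?_⟩
  · intro x y i j s t u h hs hj ht a m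
    subst hs hj
    rw [sgn_neg_one_mul]
    rfl
  · intro x n m
    rw [hoPull_dif]
    change Hom.ap w x (n + 1) m.1 - Hom.ap v x (n + 1) m.2.1 =
      dd (Y.obj x) n (n + 1) ((Hom.toGHom (𝟙 Y)).app x _ m.2.2) +
      (Hom.toGHom (𝟙 Y)).app x _ ((Hom.toGHom w).app x _ m.1 -
        (Hom.toGHom v).app x _ m.2.1 - dd (Y.obj x) _ _ m.2.2)
    rw [map_sub, map_sub, dd_toGHom _ x _ (show n + 1 + 1 + -1 + 0 = n + 1 by omega),
      toGHom_id_app w x _ _ (add_zero _), toGHom_id_app v x _ _ (add_zero _), toGHom_app,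
      toGHom_app]
    abel

/-- A homotopy commutative square induces a morphism to the homotopy pullback. -/
lemma exists_hoPull_lift {M : DGMod A} (e : M ⟶ X) (b : M ⟶ Z) (h : Homotopic (e ≫ w) (b ≫ v)) :
    ∃ f : M ⟶ hoPull w v, f ≫ hoPullFst w v = e ∧ f ≫ hoPullSnd w v = b := by
  obtain ⟨s, hs⟩ := h
  -- The third coordinate is the given homotopy; compatibility with the differential is `hs`, and
  -- `s` has the sign rule required by the shifted action.
  refine ⟨mkHom (fun x n => (Hom.ap e x n).prod ((Hom.ap b x n).prod (s.app x rfl))) ?_ ?_,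
    rfl, rfl⟩
  · intro x n m
    rw [hoPull_dif]
    refine Prod.ext (ap_dif e x n m) (Prod.ext (ap_dif b x n m) ?_)
    change s.app x rfl (dif (M.obj x) n m) = (Hom.toGHom w).app x _ (Hom.ap e x n m) -
      (Hom.toGHom v).app x _ (Hom.ap b x n m) - dd (Y.obj x) _ _ (s.app x rfl m)
    have := hs.dd_add x (i := n) rfl rfl (show n + 0 = n + 1 + -1 by omega) rfl m
    rw [toGHom_comp_app, toGHom_comp_app] at this
    rw [this, dif_eq_dd]
    abel
  · intro x y i j n h a m
    refine Prod.ext (ap_act e h a m) (Prod.ext (ap_act b h a m) ?_)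
    change s.app y rfl (M.act h a m) = sgn k i • Y.act _ a (s.app x rfl m)
    rw [s.comm h rfl rfl (by omega), sgn_neg_one_mul]

/-- With `quasiIso_hoPullSnd` this puts the projection among the maps against which cofibrant
modules lift, although `w` itself need not be surjective. -/
lemma hoPullSnd_surjective (x : A.Obj) (n : ℤ) :
    Function.Surjective (Hom.ap (hoPullSnd w v) x n) := fun c =>
  ⟨((0, c, 0) : (X.obj x).X n × (Z.obj x).X n × (Y.obj x).X (n + -1)), rfl⟩

-- As `w(a)` is the boundary of `v(c) + y`, injectivity on cohomology gives a first primitive `b` of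
-- `a`. Then `w(b) - v(c) - y` is a cocycle, and surjectivity writes it as `w(b') + dz` with `b'` a
-- cocycle; the corrected primitive is `b - b'`.
variable {w} in
lemma quasiIso.exists_hoPull_primitive (hw : quasiIso A w) (x : A.Obj) {n j l : ℤ}
    (hj : n + 0 = j) (hl : n + 1 + 0 = l) (a : (X.obj x).X (n + 1)) (c : (Z.obj x).X n)
    (y : (Y.obj x).X j) (ha : dif (X.obj x) (n + 1) a = 0)
    (h : (Hom.toGHom w).app x hl a - (Hom.toGHom v).app x hl (dif (Z.obj x) n c) -
      dd (Y.obj x) j l y = 0) :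
    ∃ (b : (X.obj x).X n) (z : (Y.obj x).X (n + -1)), dif (X.obj x) n b = a ∧
      (Hom.toGHom w).app x hj b - (Hom.toGHom v).app x hj c - dd (Y.obj x) (n + -1) j z = y := by
  obtain rfl : n = j := by omega
  obtain rfl : n + 1 = l := by omega
  simp only [toGHom_app] at h ⊢
  rw [dif_eq_dd, ap_dd, sub_sub, ← map_add, sub_eq_zero] at h
  obtain ⟨b, hb⟩ := hw.exists_dd_eq x rfl rfl a ha _ h
  obtain ⟨b', z, hb', hz⟩ := hw.exists_eq_add x (show n + -1 + 1 = n by omega) rfl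
    (Hom.ap w x n b - Hom.ap v x n c - y) (by
      rw [map_sub, map_sub, ← ap_dd, hb, h, map_add]
      abel)
  refine ⟨b - b', z, by rw [map_sub, dif_eq_dd, hb, hb', sub_zero], ?_⟩
  rw [map_sub, sub_eq_iff_eq_add, ← sub_eq_zero]
  rw [sub_eq_iff_eq_add, ← sub_eq_zero] at hz
  rw [← hz]
  abel

variable {w} in
/-- The homotopy pullback of a quasi-isomorphism is a quasi-isomorphism. -/
lemma quasiIso_hoPullSnd (hw : quasiIso A w) : quasiIso A (hoPullSnd w v) := by
  rw [quasiIso_iff]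
  intro x n
  constructor
  · rintro ⟨a, c, y⟩ (z : (Z.obj x).X n) hm (hz : c = dif (Z.obj x) n z)
    subst hz
    rw [hoPull_dif] at hm ⊢
    obtain ⟨b, t, hb, ht⟩ := hw.exists_hoPull_primitive v x _ _ a z y (congrArg Prod.fst hm)
      (congrArg (fun e => e.2.2) hm)
    exact ⟨(b, z, t), Prod.ext hb (Prod.ext rfl ht)⟩
  · intro c hc
    -- Write `v(c) = w(a) + dt`; the triple `(a, c, -t)` is then a cocycle over `c`.
    obtain ⟨a, t, ha, ht⟩ := hw.exists_eq_add x rfl rfl (Hom.ap v x (n + 1) c)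
      (by rw [← ap_dd, ← dif_eq_dd, hc, map_zero])
    rw [hoPull_dif]
    refine ⟨(a, c, -(Hom.toGHom (𝟙 Y)).app x (by omega) t), 0, Prod.ext ha (Prod.ext hc ?_), ?_⟩
    · change (Hom.toGHom w).app x _ a - (Hom.toGHom v).app x _ c - dd (Y.obj x) _ _ (-_) = 0
      rw [map_neg, dd_toGHom _ x _ (show n + 1 + 0 = n + 1 + 1 + -1 by omega),
        ← toGHom_id_app v x (add_zero (n + 1)) (show n + 1 + 0 = n + 1 + 1 + -1 by omega),
        toGHom_app, ht, map_add,
        ← toGHom_id_app w x (add_zero (n + 1)) (show n + 1 + 0 = n + 1 + 1 + -1 by omega),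
        toGHom_app]
      abel
    · rw [map_zero, add_zero]
      rfl

end HoPull

/-- A cofibrant module lifts, up to homotopy, along quasi-isomorphisms. -/
lemma IsCofibrant.exists_lift {M X Y : DGMod A} (hM : M.IsCofibrant) {w : X ⟶ Y}
    (hw : quasiIso A w) (b : M ⟶ Y) : ∃ e : M ⟶ X, Homotopic (e ≫ w) b := by
  -- With `v = 𝟙 Y` the homotopy pullback replaces `w` by a surjective quasi-isomorphism onto `Y`;
  -- the other projection brings the strict lift back to `X`.
  obtain ⟨e, he⟩ := hM (hoPullSnd w (𝟙 Y)) (quasiIso_hoPullSnd _ hw) (hoPullSnd_surjective _ _) b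
  refine ⟨e ≫ hoPullFst w (𝟙 Y), ?_⟩
  have := (hoPull_homotopic w (𝟙 Y)).comp_left e
  rwa [Category.comp_id, he, ← Category.assoc] at this

/-- The zero module. -/
def zeroMod (A : DGCat k) : DGMod A :=
  ofGraded (fun _ _ => PUnit) (fun _ _ => 0) (fun _ _ _ => rfl) (fun _ => 0)
    (fun _ _ => rfl) (fun _ => rfl) (fun _ _ _ _ _ => rfl)

lemma zeroMod_hom_ext {M : DGMod A} (f g : M ⟶ zeroMod A) : f = g := hom_ext_ap fun _ _ _ => rfl

/-- The homotopy fibre of `w`: it classifies morphisms with a nullhomotopy of their composite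
with `w`. -/
abbrev hoFib {X Y : DGMod A} (w : X ⟶ Y) : DGMod A := hoPull w (0 : zeroMod A ⟶ Y)

/-- The homotopy fibre of a quasi-isomorphism is acyclic: its projection to the zero module is a
pulled back quasi-isomorphism, and two-out-of-three applies to `0 → hoFib w → 0`. -/
lemma quasiIso_zero_hoFib {X Y : DGMod A} {w : X ⟶ Y} (hw : quasiIso A w) :
    quasiIso A (0 : zeroMod A ⟶ hoFib w) := by
  have h₁ : quasiIso A ((0 : zeroMod A ⟶ hoFib w) ≫ hoPullSnd w 0) := by
    rw [zeroMod_hom_ext (0 ≫ hoPullSnd w 0) (𝟙 _)]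
    exact (quasiIso A).id_mem _
  exact (quasiIso A).of_postcomp _ _ (quasiIso_hoPullSnd _ hw) h₁

lemma exists_hoFib_lift {M X Y : DGMod A} {w : X ⟶ Y} {e : M ⟶ X} (h : Homotopic (e ≫ w) 0) :
    ∃ f : M ⟶ hoFib w, f ≫ hoPullFst w 0 = e := by
  obtain ⟨f, hf, -⟩ := exists_hoPull_lift w (0 : zeroMod A ⟶ Y) e 0 (by simpa using h)
  exact ⟨f, hf⟩

/-- A morphism from a cofibrant module is nullhomotopic as soon as its composite with a
quasi-isomorphism is. -/
lemma IsCofibrant.homotopic_zero {M X Y : DGMod A} (hM : M.IsCofibrant) {w : X ⟶ Y}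
    (hw : quasiIso A w) (e : M ⟶ X) (h : Homotopic (e ≫ w) 0) : Homotopic e 0 := by
  obtain ⟨f, rfl⟩ := exists_hoFib_lift h
  -- The nullhomotopy makes `e` factor through the acyclic fibre, and a map from a cofibrant module
  -- to it factors through zero up to homotopy.
  obtain ⟨g, hg⟩ := hM.exists_lift (quasiIso_zero_hoFib hw) f
  rw [comp_zero] at hg
  simpa using hg.symm.comp_right (hoPullFst w 0)

end DGMod

end

end DG

/-! ### The derived category as a localization of the homotopy category -/

namespace DG

noncomputable section

variable {k : Type u} [CommRing k]

namespace DGMod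

variable {A : DGCat k}

/-- Homotopic morphisms become equal in any localization at the quasi-isomorphisms. -/
lemma Homotopic.map_eq {D : Type*} [Category D] (F : DGMod A ⥤ D)
    (hF : (quasiIso A).IsInvertedBy F) {M N : DGMod A} {f g : M ⟶ N} (h : Homotopic f g) :
    F.map f = F.map g := by
  -- The homotopy pullback of two identities is a path object for `N`: homotopic maps are the two
  -- projections of one map `e`. The diagonal `δ` is a common section of both projections and is a
  -- quasi-isomorphism, so `F` identifies the projections.
  let p₁ := hoPullFst (𝟙 N) (𝟙 N)
  let p₂ := hoPullSnd (𝟙 N) (𝟙 N)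
  have hp₂ : quasiIso A p₂ := quasiIso_hoPullSnd _ ((quasiIso A).id_mem _)
  obtain ⟨δ, h₁, h₂⟩ := exists_hoPull_lift (𝟙 N) (𝟙 N) (𝟙 N) (𝟙 N) (Homotopic.refl _)
  obtain ⟨e, rfl, rfl⟩ := exists_hoPull_lift (𝟙 N) (𝟙 N) f g (by simpa using h)
  have := hF p₂ hp₂
  have hδ : quasiIso A δ := (quasiIso A).of_postcomp δ p₂ hp₂ (by
    rw [h₂]; exact (quasiIso A).id_mem _)
  have := hF δ hδ
  have key : F.map p₁ = F.map p₂ := by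
    rw [← cancel_epi (F.map δ), ← F.map_comp, ← F.map_comp]
    exact congrArg F.map (h₁.trans h₂.symm)
  rw [F.map_comp, F.map_comp]
  exact congrArg _ key

/-- The functor from the homotopy category to the derived category. -/
def H0.toHo (A : DGCat k) : H0 A ⥤ Ho A :=
  CategoryTheory.Quotient.lift _ (DGMod.toHo A) fun _ _ _ _ h => h.map_eq _ (quasiIso A).Q_inverts

/-- The quasi-isomorphisms in the homotopy category. -/
def H0.quasiIso (A : DGCat k) : MorphismProperty (H0 A) :=
  fun X Y f => ∃ g : X.as ⟶ Y.as, DGMod.quasiIso A g ∧ (toH0 A).map g = f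

/-- The derived category is a localization of the homotopy category. -/
def H0.strictUniversalProperty (A : DGCat k) (D : Type*) [Category D] :
    Localization.StrictUniversalPropertyFixedTarget (H0.toHo A) (H0.quasiIso A) D where
  inverts := by
    rintro X Y _ ⟨g, hg, rfl⟩
    exact (DGMod.quasiIso A).Q_inverts g hg
  lift F hF := Localization.Construction.lift (toH0 A ⋙ F) fun X Y f hf => hF _ ⟨f, hf, rfl⟩
  fac F hF := CategoryTheory.Quotient.lift_unique' _ _ _
    (Localization.Construction.fac (toH0 A ⋙ F) fun X Y f hf => hF _ ⟨f, hf, rfl⟩)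
  uniq F₁ F₂ h := Localization.Construction.uniq _ _ (congrArg (fun F => toH0 A ⋙ F) h)

instance : (H0.toHo A).IsLocalization (H0.quasiIso A) :=
  Functor.IsLocalization.mk' _ _ (H0.strictUniversalProperty A _) (H0.strictUniversalProperty A _)

/-- Ore squares are homotopy pullbacks. They commute only up to homotopy, which is why fractions are
formed in `H0 A` and not in `DGMod A`. -/
instance : (H0.quasiIso A).HasRightCalculusOfFractions where
  id_mem X := ⟨𝟙 _, (quasiIso A).id_mem _, rfl⟩
  comp_mem := by
    rintro X Y Z _ _ ⟨f, hf, rfl⟩ ⟨g, hg, rfl⟩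
    exact ⟨f ≫ g, (quasiIso A).comp_mem _ _ hf hg, rfl⟩
  exists_rightFraction := by
    rintro ⟨X⟩ ⟨Y⟩ ⟨f, s, s', hs, rfl⟩
    obtain ⟨f, rfl⟩ := (toH0 A).map_surjective f
    exact ⟨⟨(toH0 A).map (hoPullSnd s' f), ⟨_, quasiIso_hoPullSnd _ hs, rfl⟩,
      (toH0 A).map (hoPullFst s' f)⟩, (toH0_map_eq_iff.mpr (hoPull_homotopic s' f)).symm⟩
  ext := by
    rintro ⟨X⟩ ⟨Y⟩ ⟨Y'⟩ f g _ ⟨s, hs, rfl⟩ h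
    obtain ⟨f, rfl⟩ := (toH0 A).map_surjective f
    obtain ⟨g, rfl⟩ := (toH0 A).map_surjective g
    have h' : Homotopic (f ≫ s) (g ≫ s) := toH0_map_eq_iff.mp h
    rw [homotopic_iff_sub, ← Preadditive.sub_comp] at h'
    -- The difference `f - g` factors through the acyclic fibre of `s`. Pulling `0 → hoFib s` back
    -- along this factorization gives a quasi-isomorphism `t` which makes it null, so `t` equalizes
    -- `f` and `g` up to homotopy.
    obtain ⟨e, he⟩ := exists_hoFib_lift h'
    let t := hoPullSnd (0 : zeroMod A ⟶ hoFib s) e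
    refine ⟨⟨_⟩, (toH0 A).map t, ⟨t, quasiIso_hoPullSnd _ (quasiIso_zero_hoFib hs), rfl⟩, ?_⟩
    refine toH0_map_eq_iff.mpr (homotopic_iff_sub.mpr ?_)
    rw [← Preadditive.comp_sub, ← he, ← Category.assoc]
    have h₀ := (hoPull_homotopic (0 : zeroMod A ⟶ hoFib s) e).symm.comp_right (hoPullFst s 0)
    simpa using h₀

/-- Two morphisms are equal in the derived category when they become homotopic after composition
with a quasi-isomorphism. -/
lemma toHo_map_eq_iff {M N : DGMod A} (f g : M ⟶ N) :
    (toHo A).map f = (toHo A).map g ↔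
      ∃ (M' : DGMod A) (s : M' ⟶ M), quasiIso A s ∧ Homotopic (s ≫ f) (s ≫ g) := by
  constructor
  · intro h
    obtain ⟨⟨M'⟩, _, ⟨s, hs, rfl⟩, h⟩ := (MorphismProperty.map_eq_iff_precomp (H0.toHo A)
      (H0.quasiIso A) ((toH0 A).map f) ((toH0 A).map g)).mp h
    exact ⟨M', s, hs, toH0_map_eq_iff.mp h⟩
  · rintro ⟨M', s, hs, h⟩
    have := (quasiIso A).Q_inverts s hs
    have := h.map_eq _ (quasiIso A).Q_inverts
    rwa [Functor.map_comp, Functor.map_comp, cancel_epi] at this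

/-- For a cofibrant source, morphisms which agree in the derived category are homotopic. -/
lemma IsCofibrant.toHo_map_eq_iff {M N : DGMod A} (hM : M.IsCofibrant) {f g : M ⟶ N} :
    (toHo A).map f = (toHo A).map g ↔ Homotopic f g := by
  refine ⟨fun h => ?_, fun h => h.map_eq _ (quasiIso A).Q_inverts⟩
  obtain ⟨M', s, hs, h⟩ := (DGMod.toHo_map_eq_iff f g).mp h
  -- A quasi-isomorphism onto a cofibrant module has a section up to homotopy, so `s` can be
  -- cancelled.
  obtain ⟨σ, hσ⟩ := hM.exists_lift hs (𝟙 M)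
  have h' := h.comp_left σ
  rw [← Category.assoc, ← Category.assoc] at h'
  have hf := hσ.comp_right f
  have hg := hσ.comp_right g
  rw [Category.id_comp] at hf hg
  exact hf.symm.trans (h'.trans hg)

/-- For a cofibrant source, every morphism of the derived category comes from a morphism. -/
lemma IsCofibrant.toHo_map_surjective {M N : DGMod A} (hM : M.IsCofibrant)
    (φ : (toHo A).obj M ⟶ (toHo A).obj N) : ∃ f : M ⟶ N, (toHo A).map f = φ := by
  obtain ⟨ρ, hφ⟩ := Localization.exists_rightFraction (H0.toHo A)
    (H0.quasiIso A) (X := (toH0 A).obj M) (Y := (toH0 A).obj N) φ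
  have h₂ := ρ.map_s_comp_map (H0.toHo A) (Localization.inverts _ _)
  rw [← hφ] at h₂
  clear hφ
  obtain ⟨_, ⟨s, hs, rfl⟩, f⟩ := ρ
  obtain ⟨f, rfl⟩ := (toH0 A).map_surjective f
  -- In the right fraction `s⁻¹ ≫ f` the inverse of `s` is represented by the homotopy section `σ`.
  obtain ⟨σ, hσ⟩ := hM.exists_lift hs (𝟙 M)
  refine ⟨σ ≫ f, ?_⟩
  have := (quasiIso A).Q_inverts s hs
  have h₁ : (toHo A).map σ ≫ (toHo A).map s = 𝟙 _ := by
    rw [← Functor.map_comp, hσ.map_eq _ (quasiIso A).Q_inverts, CategoryTheory.Functor.map_id]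
  change (toHo A).map s ≫ φ = (toHo A).map f at h₂
  rw [Functor.map_comp, ← h₂, ← Category.assoc, h₁, Category.id_comp]

end DGMod

end

end DG

/-! ### Mapping cones and the splitting of epimorphisms -/

namespace DG

noncomputable section

variable {k : Type u} [CommRing k]

namespace DGMod

variable {A : DGCat k}

section Cone

variable {M N : DGMod A} (f : M ⟶ N)

/-- The differential of the mapping cone, `d (m, y) = (-dm, f(m) + dy)`. -/
def coneDif (x : A.Obj) (n : ℤ) : ((M.obj x).X (n + 1) × (N.obj x).X n) →ₗ[k]
    ((M.obj x).X (n + 1 + 1) × (N.obj x).X (n + 1)) :=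
  (-(dif (M.obj x) (n + 1)) ∘ₗ LinearMap.fst k _ _).prod
    (Hom.ap f x (n + 1) ∘ₗ LinearMap.fst k _ _ + dif (N.obj x) n ∘ₗ LinearMap.snd k _ _)

/-- The action of the dg-category on the mapping cone. -/
def coneAct (M N : DGMod A) {x y : A.Obj} {i j n : ℤ} (h : i + j = n) :
    (A.Hom x y).X i →ₗ[k] ((M.obj x).X (j + 1) × (N.obj x).X j) →ₗ[k]
      ((M.obj y).X (n + 1) × (N.obj y).X n) :=
  LinearMap.mk₂ k (fun a e => (sgn k i • M.act (show i + (j + 1) = n + 1 by omega) a e.1,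
      N.act h a e.2))
    (fun _ _ _ => by simp only [map_add, LinearMap.add_apply, smul_add]; rfl)
    (fun r _ _ => by
      simp only [map_smul, LinearMap.smul_apply]
      rw [smul_comm _ r]; rfl)
    (fun _ _ _ => by simp only [map_add, smul_add, Prod.fst_add, Prod.snd_add]; rfl)
    (fun r _ _ => by
      simp only [map_smul, Prod.smul_fst, Prod.smul_snd]
      rw [smul_comm _ r]; rfl)

lemma coneDif_comp (x : A.Obj) (n : ℤ) (e : (M.obj x).X (n + 1) × (N.obj x).X n) :
    coneDif f x (n + 1) (coneDif f x n e) = 0 := by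
  refine Prod.ext ?_ ?_
  · change -dif (M.obj x) _ (-dif (M.obj x) _ e.1) = 0
    rw [map_neg, dif_dif, neg_zero, neg_zero]
  · change Hom.ap f x _ (-dif (M.obj x) _ e.1) + dif (N.obj x) _ (Hom.ap f x _ e.1 +
      dif (N.obj x) _ e.2) = 0
    rw [map_neg, map_add, dif_dif, ap_dif]
    abel

/-- The mapping cone of a morphism. -/
def cone : DGMod A :=
  ofGraded (fun x n => (M.obj x).X (n + 1) × (N.obj x).X n) (coneDif f) (coneDif_comp f)
    (coneAct M N)
    (fun {x y i j} a e => by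
      refine Prod.ext ?_ ?_
      · change -dif (M.obj y) _ (sgn k i • M.act _ a e.1) =
          sgn k (i + 1) • M.act _ (dif (A.Hom x y) i a) e.1 +
          sgn k i • sgn k i • M.act _ a (-dif (M.obj x) _ e.1)
        rw [map_smul, dif_eq_dd, dd_act M _ rfl rfl rfl (by omega) (by omega), sgn_add, sgn_one]
        simp only [smul_smul, sgn_mul_self, smul_add, one_smul, mul_neg_one, neg_smul, map_neg,
          dif_eq_dd]
        abel
      · change Hom.ap f y _ (sgn k i • M.act _ a e.1) + dif (N.obj y) _ (N.act rfl a e.2) =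
          N.act _ (dif (A.Hom x y) i a) e.2 +
          sgn k i • N.act _ a (Hom.ap f x _ e.1 + dif (N.obj x) _ e.2)
        rw [N.dif_act, map_smul, ap_act f (show i + (j + 1) = i + j + 1 by omega) a e.1,
          map_add, smul_add]
        abel)
    (fun {x j} e => by
      refine Prod.ext ?_ (N.one_act e.2)
      change sgn k 0 • M.act _ (A.one x) e.1 = _
      rw [sgn_zero, one_smul]
      exact M.one_act e.1)
    (fun {x y z a b c n} h h' f g e => by
      refine Prod.ext ?_ (N.comp_act rfl h rfl h' f g e.2)
      change sgn k (a + b) • M.act _ (A.comp rfl f g) e.1 =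
        sgn k a • M.act _ f (sgn k b • M.act _ g e.1)
      rw [map_smul, smul_smul, ← sgn_add,
        M.comp_act rfl _ (show b + (c + 1) = b + c + 1 by omega) (by omega)])

lemma cone_dif (x : A.Obj) (n : ℤ) : dif ((cone f).obj x) n = coneDif f x n :=
  dif_cplxOf _ _ (coneDif_comp f x) n

/-- The inclusion of the target in the mapping cone. -/
def coneInr : N ⟶ cone f :=
  mkHom (fun x n => LinearMap.inr k ((M.obj x).X (n + 1)) ((N.obj x).X n))
    (fun x n m => by
      rw [cone_dif]
      refine Prod.ext ?_ ?_
      · change 0 = -dif (M.obj x) _ 0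
        rw [map_zero, neg_zero]
      · change _ = Hom.ap f x _ 0 + _
        rw [map_zero, zero_add]
        rfl)
    (fun {x y i j n} h a m => by
      refine Prod.ext ?_ rfl
      change 0 = sgn k i • M.act _ a 0
      rw [map_zero, smul_zero])

/-- The nullhomotopy is `m ↦ (m, 0)`, because `d (m, 0) = (-dm, f(m))`. -/
lemma comp_coneInr_homotopic : Homotopic (f ≫ coneInr f) 0 := by
  refine ⟨⟨fun x i j h => LinearMap.inl k ((M.obj x).X (j + 1)) ((N.obj x).X j) ∘ₗ
    (Hom.toGHom (𝟙 M)).app x (show i + 0 = j + 1 by omega), ?_⟩, ?_⟩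
  · intro x y i j s t u h hs hj ht a m
    rw [sgn_neg_one_mul]
    refine Prod.ext ?_ ?_
    · change (Hom.toGHom (𝟙 M)).app y _ (M.act h a m) =
        sgn k i • sgn k i • M.act _ a ((Hom.toGHom (𝟙 M)).app x _ m)
      rw [smul_smul, sgn_mul_self, one_smul, toGHom_act]
    · change 0 = sgn k i • N.act _ a 0
      rw [map_zero, smul_zero]
  · intro x n m
    rw [cone_dif]
    refine Prod.ext ?_ ?_
    · change 0 - 0 = -dif (M.obj x) _ m + dif (M.obj x) _ m
      abel
    · change Hom.ap f x _ m - 0 = Hom.ap f x _ m + dif (N.obj x) _ 0 + 0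
      rw [map_zero]
      abel

variable {f} in
/-- A nullhomotopy of `s ≫ coneInr f` is a factorization of `s` through `f` up to homotopy. -/
lemma exists_factor_of_coneInr {N' : DGMod A} {s : N' ⟶ N} (h : Homotopic (s ≫ coneInr f) 0) :
    ∃ σ : N' ⟶ M, Homotopic (σ ≫ f) s := by
  obtain ⟨t, ht⟩ := h
  -- Split the nullhomotopy into coordinates. The first has total degree `0`, since the cone
  -- contains a shift of `M`, and turns out to be the closed morphism `σ`; the second is a homotopy
  -- between `s` and `σ ≫ f`.
  let t₁ : ∀ (x : A.Obj) {i j : ℤ}, i + -1 = j → ((N'.obj x).X i →ₗ[k] (M.obj x).X (j + 1)) :=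
    fun x i j h => LinearMap.fst k ((M.obj x).X (j + 1)) ((N.obj x).X j) ∘ₗ t.app x h
  let t₂ : ∀ (x : A.Obj) {i j : ℤ}, i + -1 = j → ((N'.obj x).X i →ₗ[k] (N.obj x).X j) :=
    fun x i j h => LinearMap.snd k ((M.obj x).X (j + 1)) ((N.obj x).X j) ∘ₗ t.app x h
  have ht₁ (x : A.Obj) (n : ℤ) (m : (N'.obj x).X (n + 1)) :
      dif (M.obj x) (n + 1) (t₁ x (by omega) m) =
        t₁ x (show n + 1 + 1 + -1 = n + 1 by omega) (dif (N'.obj x) (n + 1) m) := by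
    have := ht x n m
    rw [cone_dif] at this
    have : 0 - 0 = -dif (M.obj x) (n + 1) (t₁ x (by omega) m) +
      t₁ x (show n + 1 + 1 + -1 = n + 1 by omega) (dif (N'.obj x) (n + 1) m) :=
      congrArg Prod.fst this
    rwa [sub_zero, eq_comm, neg_add_eq_zero] at this
  have ht₂ (x : A.Obj) (n : ℤ) (m : (N'.obj x).X (n + 1)) :
      Hom.ap s x _ m - 0 = Hom.ap f x (n + 1) (t₁ x (by omega) m) +
        dif (N.obj x) n (t₂ x (by omega) m) +
        t₂ x (show n + 1 + 1 + -1 = n + 1 by omega) (dif (N'.obj x) (n + 1) m) := by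
    have := ht x n m
    rw [cone_dif] at this
    exact congrArg Prod.snd this
  have hcast (x : A.Obj) {i j l : ℤ} (h : i + -1 = j) (h' : i + -1 = l)
      (e : j + 1 + 0 = l + 1) (m : (N'.obj x).X i) :
      (Hom.toGHom (𝟙 M)).app x e (t₁ x h m) = t₁ x h' m := by
    subst h h'
    rfl
  refine ⟨mkHom (fun x n => (Hom.toGHom (𝟙 M)).app x (show n + -1 + 1 + 0 = n by omega) ∘ₗ
    t₁ x rfl) ?_ ?_, ?_⟩
  · intro x n m
    obtain ⟨n, rfl⟩ : ∃ n', n = n' + 1 := ⟨n - 1, by ring⟩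
    change (Hom.toGHom (𝟙 M)).app x _ (t₁ x rfl _) =
      dif (M.obj x) (n + 1) ((Hom.toGHom (𝟙 M)).app x _ (t₁ x rfl m))
    rw [hcast x _ (show n + 1 + -1 = n by omega), hcast x _ (show n + 1 + 1 + -1 = n + 1 by omega),
      ht₁]
  · intro x y i j n h a m
    -- The sign from the degree `-1` of `t` cancels the sign from the shifted action on the cone, so
    -- `σ` is linear without sign.
    have h₀ := congrArg Prod.fst (t.comm h (rfl : n + -1 = n + -1) rfl (by omega) a m)
    rw [sgn_neg_one_mul] at h₀
    have h₁ : t₁ y (rfl : n + -1 = n + -1) (N'.act h a m) =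
      sgn k i • sgn k i • M.act (show i + (j + -1 + 1) = n + -1 + 1 by omega) a (t₁ x rfl m) := h₀
    change (Hom.toGHom (𝟙 M)).app y _ (t₁ y rfl _) =
      M.act h a ((Hom.toGHom (𝟙 M)).app x _ (t₁ x rfl m))
    rw [h₁, smul_smul, sgn_mul_self, one_smul, toGHom_act]
  · refine Homotopic.symm ⟨⟨fun x _ _ h => t₂ x h, ?_⟩, ?_⟩
    · intro x y i j s t' u h hs hj ht a m
      exact congrArg Prod.snd (t.comm h hs hj ht a m)
    · intro x n m
      have := ht₂ x n m
      change Hom.ap s x _ m - Hom.ap f x _ ((Hom.toGHom (𝟙 M)).app x _ (t₁ x rfl m)) = _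
      rw [hcast x _ (show n + 1 + -1 = n by omega)]
      rw [sub_zero, add_assoc] at this
      rw [sub_eq_iff_eq_add', this]

/-- An epimorphism of the homotopy category is split. -/
lemma epi_toH0_iff : Epi ((toH0 A).map f) ↔ ∃ σ : N ⟶ M, Homotopic (σ ≫ f) (𝟙 N) := by
  constructor
  · intro _
    -- An epimorphism `f` can be cancelled from `f ≫ coneInr f = 0`; a nullhomotopy of `coneInr f`
    -- is a section of `f`.
    refine exists_factor_of_coneInr (f := f) ?_
    rw [Category.id_comp, ← toH0_map_eq_iff, ← cancel_epi ((toH0 A).map f), ← Functor.map_comp,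
      ← Functor.map_comp, toH0_map_eq_iff, comp_zero]
    exact comp_coneInr_homotopic f
  · rintro ⟨σ, hσ⟩
    have h : (toH0 A).map σ ≫ (toH0 A).map f = 𝟙 _ := by
      rw [← Functor.map_comp, toH0_map_eq_iff.mpr hσ, CategoryTheory.Functor.map_id]
    exact ⟨fun a b hab => by
      rw [← Category.id_comp a, ← Category.id_comp b, ← h, Category.assoc, hab, Category.assoc]⟩

/-- An epimorphism of the derived category is split. -/
lemma epi_toHo_iff : Epi ((toHo A).map f) ↔
    ∃ σ : (toHo A).obj N ⟶ (toHo A).obj M, σ ≫ (toHo A).map f = 𝟙 _ := by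
  constructor
  · intro _
    have h : (toHo A).map (coneInr f) = (toHo A).map 0 := by
      rw [← cancel_epi ((toHo A).map f), ← Functor.map_comp, ← Functor.map_comp, comp_zero]
      exact (comp_coneInr_homotopic f).map_eq _ (quasiIso A).Q_inverts
    -- In the derived category `coneInr f` is nullhomotopic only after a quasi-isomorphism `s`. This
    -- factors `s` through `f`, and the section is obtained by dividing by `s`.
    obtain ⟨N', s, hs, h⟩ := (toHo_map_eq_iff _ _).mp h
    rw [comp_zero] at h
    obtain ⟨σ, hσ⟩ := exists_factor_of_coneInr h
    have := (quasiIso A).Q_inverts s hs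
    refine ⟨inv ((toHo A).map s) ≫ (toHo A).map σ, ?_⟩
    rw [Category.assoc, ← Functor.map_comp, hσ.map_eq _ (quasiIso A).Q_inverts, IsIso.inv_hom_id]
  · rintro ⟨σ, h⟩
    exact ⟨fun a b hab => by
      rw [← Category.id_comp a, ← Category.id_comp b, ← h, Category.assoc, hab, Category.assoc]⟩

end Cone

section Cofibrant

variable {M N : DGMod A} (f : M ⟶ N)

lemma isIso_toH0_iff : IsIso ((toH0 A).map f) ↔
    ∃ g : N ⟶ M, Homotopic (f ≫ g) (𝟙 M) ∧ Homotopic (g ≫ f) (𝟙 N) := by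
  constructor
  · intro _
    obtain ⟨g, hg⟩ := (toH0 A).map_surjective (inv ((toH0 A).map f))
    refine ⟨g, ?_, ?_⟩ <;> rw [← toH0_map_eq_iff, Functor.map_comp, hg,
      CategoryTheory.Functor.map_id] <;> simp
  · rintro ⟨g, h₁, h₂⟩
    refine ⟨(toH0 A).map g, ?_, ?_⟩ <;>
      rw [← Functor.map_comp, ← CategoryTheory.Functor.map_id, toH0_map_eq_iff] <;> assumption

variable {f}

/-- Between cofibrant modules `H0.toHo` is bijective on morphisms, so an inverse in the derived
category is represented by a homotopy inverse. -/
lemma IsCofibrant.isIso_toHo_iff (hM : M.IsCofibrant) (hN : N.IsCofibrant) :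
    IsIso ((toHo A).map f) ↔ IsIso ((toH0 A).map f) := by
  constructor
  · intro _
    obtain ⟨g, hg⟩ := hN.toHo_map_surjective (inv ((toHo A).map f))
    refine (isIso_toH0_iff f).mpr ⟨g, ?_, ?_⟩
    · rw [← hM.toHo_map_eq_iff, Functor.map_comp, hg, IsIso.hom_inv_id,
        CategoryTheory.Functor.map_id]
    · rw [← hN.toHo_map_eq_iff, Functor.map_comp, hg, IsIso.inv_hom_id,
        CategoryTheory.Functor.map_id]
  · intro _
    exact inferInstanceAs (IsIso ((H0.toHo A).map ((toH0 A).map f)))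

/-- On both sides epimorphisms are the split ones. The section starts at `N`, so cofibrancy of `N`
suffices to lift it and its identity. -/
lemma IsCofibrant.epi_toHo_iff (hN : N.IsCofibrant) :
    Epi ((toHo A).map f) ↔ Epi ((toH0 A).map f) := by
  rw [DGMod.epi_toHo_iff, epi_toH0_iff]
  constructor
  · rintro ⟨σ, hσ⟩
    obtain ⟨σ, rfl⟩ := hN.toHo_map_surjective σ
    refine ⟨σ, ?_⟩
    rw [← hN.toHo_map_eq_iff, Functor.map_comp, hσ, CategoryTheory.Functor.map_id]
  · rintro ⟨σ, hσ⟩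
    refine ⟨(toHo A).map σ, ?_⟩
    rw [← Functor.map_comp, hσ.map_eq _ (quasiIso A).Q_inverts, CategoryTheory.Functor.map_id]

end Cofibrant

end DGMod

/-! ### Reflecting properties of morphisms through a quasi-retraction -/

/-- A functor `F` between categories of dg-modules which has a left quasi-inverse `G` on cofibrant
modules: there are natural quasi-isomorphisms `G(F(X)) → X` for `X` cofibrant. -/
structure QuasiRetraction {A C : DGCat k} (F : DGMod A ⥤ DGMod C) where
  map_homotopic : ∀ {M N : DGMod A} {f g : M ⟶ N}, DGMod.Homotopic f g →
    DGMod.Homotopic (F.map f) (F.map g)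
  map_zero : ∀ M N : DGMod A, F.map (0 : M ⟶ N) = 0
  G : DGMod C ⥤ DGMod A
  G_map_homotopic : ∀ {M N : DGMod C} {f g : M ⟶ N}, DGMod.Homotopic f g →
    DGMod.Homotopic (G.map f) (G.map g)
  G_map_zero : ∀ M N : DGMod C, G.map (0 : M ⟶ N) = 0
  q : F ⋙ G ⟶ 𝟭 (DGMod A)
  quasiIso_q : ∀ X : DGMod A, X.IsCofibrant → DGMod.quasiIso A (q.app X)

namespace QuasiRetraction

open DGMod

variable {A C : DGCat k} {F : DGMod A ⥤ DGMod C} (R : QuasiRetraction F)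

include R

lemma isIso_q {X : DGMod A} (hX : X.IsCofibrant) : IsIso ((toHo A).map (R.q.app X)) :=
  (quasiIso A).Q_inverts _ (R.quasiIso_q X hX)

lemma q_naturality {M N : DGMod A} (f : M ⟶ N) :
    (toHo A).map (R.G.map (F.map f)) ≫ (toHo A).map (R.q.app N) =
      (toHo A).map (R.q.app M) ≫ (toHo A).map f := by
  rw [← Functor.map_comp, ← Functor.map_comp]
  exact congrArg _ (R.q.naturality f)

variable {M N : DGMod A} {f : M ⟶ N}

/-- By naturality `q_M ≫ f = G(F(f)) ≫ q_N`, and `q_M` can be cancelled on the left. -/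
lemma toHo_map_eq_zero (hM : M.IsCofibrant)
    (h : (toHo A).map (R.G.map (F.map f)) = (toHo A).map 0) :
    (toHo A).map f = (toHo A).map 0 := by
  have := R.isIso_q hM
  rw [← cancel_epi ((toHo A).map (R.q.app M)), ← R.q_naturality, h, ← Functor.map_comp,
    ← Functor.map_comp, zero_comp, comp_zero]

lemma isIso_toHo_map (hM : M.IsCofibrant) (hN : N.IsCofibrant)
    (h : IsIso ((toHo A).map (R.G.map (F.map f)))) : IsIso ((toHo A).map f) := by
  have := R.isIso_q hM
  have := R.isIso_q hN
  have : IsIso ((toHo A).map (R.q.app M) ≫ (toHo A).map f) := by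
    rw [← R.q_naturality]
    infer_instance
  exact IsIso.of_isIso_comp_left ((toHo A).map (R.q.app M)) _

/-- Since `q_N` is invertible, `G(F(f)) ≫ q_N = q_M ≫ f` is an epimorphism, hence so is its last
factor `f`; for this `q_M` need not be invertible. -/
lemma epi_toHo_map (hN : N.IsCofibrant)
    (h : Epi ((toHo A).map (R.G.map (F.map f)))) : Epi ((toHo A).map f) := by
  have := R.isIso_q hN
  have : Epi ((toHo A).map (R.q.app M) ≫ (toHo A).map f) := by
    rw [← R.q_naturality]
    infer_instance
  exact epi_of_epi ((toHo A).map (R.q.app M)) _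

/-- `G` is only required to respect homotopies, not quasi-isomorphisms. The hypothesis is therefore
taken in the homotopy category of `C`, moved by `G`, compared with `f` in `Ho A`, and brought back
to `H0 A` by cofibrancy of `M`. -/
lemma homotopic_zero_iff (hM : M.IsCofibrant) :
    Homotopic (F.map f) 0 ↔ Homotopic f 0 := by
  constructor
  · intro h
    rw [← hM.toHo_map_eq_iff]
    refine R.toHo_map_eq_zero hM ?_
    rw [(R.G_map_homotopic h).map_eq _ (quasiIso A).Q_inverts, R.G_map_zero]
  · intro h
    rw [← R.map_zero]
    exact R.map_homotopic h

lemma isIso_toH0_map_iff (hM : M.IsCofibrant) (hN : N.IsCofibrant) :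
    IsIso ((toH0 C).map (F.map f)) ↔ IsIso ((toH0 A).map f) := by
  constructor
  · intro h
    obtain ⟨g, h₁, h₂⟩ := (isIso_toH0_iff _).mp h
    rw [← hM.isIso_toHo_iff hN]
    refine R.isIso_toHo_map hM hN ?_
    have h₁ := (R.G_map_homotopic h₁).map_eq _ (quasiIso A).Q_inverts
    have h₂ := (R.G_map_homotopic h₂).map_eq _ (quasiIso A).Q_inverts
    simp only [Functor.map_comp, CategoryTheory.Functor.map_id] at h₁ h₂
    exact ⟨_, h₁, h₂⟩
  · intro h
    obtain ⟨g, h₁, h₂⟩ := (isIso_toH0_iff _).mp h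
    refine (isIso_toH0_iff _).mpr ⟨F.map g, ?_, ?_⟩
    · rw [← F.map_comp, ← F.map_id]
      exact R.map_homotopic h₁
    · rw [← F.map_comp, ← F.map_id]
      exact R.map_homotopic h₂

/-- Epimorphisms are carried through `F` and `G` by their sections. -/
lemma epi_toH0_map_iff (hN : N.IsCofibrant) :
    Epi ((toH0 C).map (F.map f)) ↔ Epi ((toH0 A).map f) := by
  constructor
  · intro h
    obtain ⟨σ, hσ⟩ := (epi_toH0_iff _).mp h
    rw [← hN.epi_toHo_iff]
    refine R.epi_toHo_map hN ((DGMod.epi_toHo_iff _).mpr ⟨(toHo A).map (R.G.map σ), ?_⟩)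
    have h₁ := (R.G_map_homotopic hσ).map_eq _ (quasiIso A).Q_inverts
    simpa only [Functor.map_comp, CategoryTheory.Functor.map_id] using h₁
  · intro h
    obtain ⟨σ, hσ⟩ := (epi_toH0_iff _).mp h
    refine (epi_toH0_iff _).mpr ⟨F.map σ, ?_⟩
    rw [← F.map_comp, ← F.map_id]
    exact R.map_homotopic hσ

/-- The functor induced by `G` on derived categories, when `G` preserves quasi-isomorphisms. -/
def derived (hG : ∀ ⦃M N : DGMod C⦄ (f : M ⟶ N), quasiIso C f → quasiIso A (R.G.map f)) :
    Ho C ⥤ Ho A :=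
  Localization.Construction.lift (R.G ⋙ toHo A) fun _ _ f hf => (quasiIso A).Q_inverts _ (hG f hf)

lemma derived_map (hG : ∀ ⦃M N : DGMod C⦄ (f : M ⟶ N), quasiIso C f → quasiIso A (R.G.map f))
    {M N : DGMod C} (f : M ⟶ N) :
    (R.derived hG).map ((toHo C).map f) = (toHo A).map (R.G.map f) := by
  have := Functor.congr_hom (Localization.Construction.fac (R.G ⋙ toHo A)
    fun _ _ f hf => (quasiIso A).Q_inverts _ (hG f hf)) f
  exact this.trans ((Category.id_comp _).trans (Category.comp_id _))

/-! ### Arbitrary morphisms through cofibrant resolutions -/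

section Resolution

variable (hG : ∀ ⦃M N : DGMod C⦄ (f : M ⟶ N), quasiIso C f → quasiIso A (R.G.map f))
  (S : CofRes f)

omit R in
lemma _root_.DG.CofRes.toHo_comm :
    (toHo A).map S.lift ≫ (toHo A).map S.q = (toHo A).map S.p ≫ (toHo A).map f := by
  rw [← Functor.map_comp, ← Functor.map_comp]
  exact S.comm.map_eq _ (quasiIso A).Q_inverts

include hG

/-- Reflection uses the functor induced by `G` on derived categories. For preservation no derived
functor of `F` is needed: cofibrancy of the source of `S.lift` upgrades vanishing in `Ho A` to an
actual homotopy, which `F` respects. -/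
lemma toHo_lift_eq_zero_iff :
    (toHo C).map (F.map S.lift) = (toHo C).map 0 ↔ (toHo A).map f = (toHo A).map 0 := by
  have := (quasiIso A).Q_inverts _ S.quasiIso_p
  have := (quasiIso A).Q_inverts _ S.quasiIso_q
  -- In the derived category `S.p` and `S.q` are invertible, so `f` and its lift are
  -- interchangeable.
  have key : (toHo A).map S.lift = (toHo A).map 0 ↔ (toHo A).map f = (toHo A).map 0 := by
    rw [← cancel_mono ((toHo A).map S.q), ← cancel_epi ((toHo A).map S.p), S.toHo_comm,
      ← Functor.map_comp, ← Functor.map_comp, ← Functor.map_comp, zero_comp, comp_zero]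
  rw [← key]
  constructor
  · intro h
    refine R.toHo_map_eq_zero S.cofibrant_P ?_
    rw [← R.derived_map hG, h, R.derived_map, R.G_map_zero]
  · intro h
    rw [S.cofibrant_P.toHo_map_eq_iff, ← R.homotopic_zero_iff S.cofibrant_P] at h
    exact h.map_eq _ (quasiIso C).Q_inverts

lemma isIso_toHo_lift_iff :
    IsIso ((toHo C).map (F.map S.lift)) ↔ IsIso ((toHo A).map f) := by
  have := (quasiIso A).Q_inverts _ S.quasiIso_p
  have := (quasiIso A).Q_inverts _ S.quasiIso_q
  have key : IsIso ((toHo A).map S.lift) ↔ IsIso ((toHo A).map f) := by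
    rw [← isIso_comp_right_iff _ ((toHo A).map S.q), S.toHo_comm, isIso_comp_left_iff]
  rw [← key]
  constructor
  · intro h
    refine R.isIso_toHo_map S.cofibrant_P S.cofibrant_Q ?_
    rw [← R.derived_map hG]
    exact Functor.map_isIso _ _
  · intro h
    rw [S.cofibrant_P.isIso_toHo_iff S.cofibrant_Q,
      ← R.isIso_toH0_map_iff S.cofibrant_P S.cofibrant_Q] at h
    exact inferInstanceAs (IsIso ((H0.toHo C).map ((toH0 C).map (F.map S.lift))))

lemma epi_toHo_lift_iff :
    Epi ((toHo C).map (F.map S.lift)) ↔ Epi ((toHo A).map f) := by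
  have := (quasiIso A).Q_inverts _ S.quasiIso_p
  have := (quasiIso A).Q_inverts _ S.quasiIso_q
  have key : Epi ((toHo A).map S.lift) ↔ Epi ((toHo A).map f) := by
    rw [← epi_comp_iff_of_epi ((toHo A).map S.p) ((toHo A).map f), ← S.toHo_comm]
    exact ⟨fun _ => inferInstance, fun _ => by
      rw [← Category.comp_id ((toHo A).map S.lift), ← IsIso.hom_inv_id ((toHo A).map S.q),
        ← Category.assoc]
      infer_instance⟩
  rw [← key]
  constructor
  · intro h
    obtain ⟨σ, hσ⟩ := (DGMod.epi_toHo_iff _).mp h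
    -- The section `σ` lives in `Ho C` and need not come from a morphism of modules; this is why `G`
    -- has to be available on derived categories.
    refine R.epi_toHo_map S.cofibrant_Q ((DGMod.epi_toHo_iff _).mpr ⟨(R.derived hG).map σ, ?_⟩)
    rw [← R.derived_map hG]
    refine ((R.derived hG).map_comp _ _).symm.trans ?_
    rw [hσ]
    exact (R.derived hG).map_id _
  · intro h
    rw [S.cofibrant_Q.epi_toHo_iff, ← R.epi_toH0_map_iff S.cofibrant_Q] at h
    obtain ⟨σ, hσ⟩ := (epi_toH0_iff _).mp h
    refine (DGMod.epi_toHo_iff _).mpr ⟨(toHo C).map σ, ?_⟩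
    rw [← Functor.map_comp, hσ.map_eq _ (quasiIso C).Q_inverts, CategoryTheory.Functor.map_id]

end Resolution

end QuasiRetraction

end

end DG

/-! ### The character module of `k` as an injective cogenerator -/

namespace DG

noncomputable section

variable {k : Type u} [CommRing k]

section CharacterDual

variable {V W : Type u} [AddCommGroup V] [Module k V] [AddCommGroup W] [Module k W]

/-- The `k`-linear map to the character module of `k` attached to a character. -/
def charLin (c : CharacterModule V) : V →ₗ[k] CharacterModule k where
  toFun v := c.comp (LinearMap.toSpanSingleton k V v).toAddMonoidHom
  map_add' v w := by
    ext r
    change c (r • (v + w)) = c (r • v) + c (r • w)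
    rw [smul_add, map_add]
  map_smul' r v := by
    ext t
    change c (t • r • v) = c ((r • t) • v)
    rw [smul_smul, smul_eq_mul, mul_comm]

lemma charLin_apply_one (c : CharacterModule V) (v : V) : charLin (k := k) c v (1 : k) = c v := by
  change c ((1 : k) • v) = c v
  rw [one_smul]

/-- The character module of `k` is injective: a linear map to it which vanishes on the kernel of
`L` factors through `L`. -/
lemma exists_factor_of_ker_le (L : V →ₗ[k] W) (θ : V →ₗ[k] CharacterModule k)
    (h : ∀ v, L v = 0 → θ v = 0) : ∃ ψ : W →ₗ[k] CharacterModule k, ∀ v, ψ (L v) = θ v := by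
  let θ' : (V ⧸ LinearMap.ker L) →ₗ[k] CharacterModule k := (LinearMap.ker L).liftQ θ h
  let L' : (V ⧸ LinearMap.ker L) →ₗ[k] W := (LinearMap.ker L).liftQ L le_rfl
  have hL' : Function.Injective L' :=
    LinearMap.ker_eq_bot.mp (Submodule.ker_liftQ_eq_bot _ _ _ le_rfl)
  -- Evaluation at `1` turns a linear map to `CharacterModule k` into a plain character. Characters
  -- extend along the injection `L'`, and `charLin` turns the extension back into a linear map.
  let c : CharacterModule (V ⧸ LinearMap.ker L) :=
    AddMonoidHom.mk' (fun x => θ' x (1 : k)) (fun x y => by rw [map_add]; rfl)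
  obtain ⟨d, hd⟩ := CharacterModule.dual_surjective_of_injective L' hL' c
  refine ⟨charLin d, fun v => ?_⟩
  ext r
  have := DFunLike.congr_fun hd (Submodule.Quotient.mk (r • v))
  change d (r • L v) = θ v r
  have h₁ : d (L (r • v)) = θ (r • v) (1 : k) := this
  rw [← map_smul, h₁, map_smul, CharacterModule.smul_apply, smul_eq_mul, mul_one]

/-- The character module of `k` is a cogenerator. -/
lemma exists_separating (S : Submodule k V) (v : V) (hv : v ∉ S) :
    ∃ χ : V →ₗ[k] CharacterModule k, (∀ w ∈ S, χ w = 0) ∧ χ v ≠ 0 := by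
  obtain ⟨c, hc⟩ := CharacterModule.exists_character_apply_ne_zero_of_ne_zero
    (a := S.mkQ v) (by simpa using hv)
  refine ⟨charLin c ∘ₗ S.mkQ, fun w hw => ?_, fun h => hc ?_⟩
  · have : S.mkQ w = 0 := by simpa using hw
    rw [LinearMap.comp_apply, this, map_zero]
  · rw [← charLin_apply_one (k := k), ← LinearMap.comp_apply, h]
    rfl

end CharacterDual

namespace DGMod

/-! ### Duals of dg-modules -/

section Dual

variable {S : DGCat k}

/-- The action of the opposite category on the dual of a module. -/
def dualAct (N : ℤ) (R : DGMod S) {s s' : S.Obj} {i j n : ℤ} (h : i + j = n) :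
    (S.Hom s' s).X i →ₗ[k] ((R.obj s).X (N - j) →ₗ[k] CharacterModule k) →ₗ[k]
      ((R.obj s').X (N - n) →ₗ[k] CharacterModule k) :=
  sgn k (i * j) • (LinearMap.llcomp k _ _ _).flip ∘ₗ
    R.act (x := s') (y := s) (show i + (N - n) = N - j by omega)

lemma dualAct_apply (N : ℤ) (R : DGMod S) {s s' : S.Obj} {i j n : ℤ} (h : i + j = n)
    (a : (S.Hom s' s).X i) (θ : (R.obj s).X (N - j) →ₗ[k] CharacterModule k)
    (g : (R.obj s').X (N - n)) :
    dualAct N R h a θ g = sgn k (i * j) • θ (R.act (show i + (N - n) = N - j by omega) a g) := rfl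

/-- The differential of the dual of a module. -/
def dualDif (N : ℤ) (R : DGMod S) (s : S.Obj) (p : ℤ) :
    ((R.obj s).X (N - p) →ₗ[k] CharacterModule k) →ₗ[k]
      ((R.obj s).X (N - (p + 1)) →ₗ[k] CharacterModule k) :=
  -sgn k p • (LinearMap.lcomp k _ (dd (R.obj s) (N - (p + 1)) (N - p)))

lemma dualDif_apply (N : ℤ) (R : DGMod S) (s : S.Obj) (p : ℤ)
    (θ : (R.obj s).X (N - p) →ₗ[k] CharacterModule k) (g : (R.obj s).X (N - (p + 1))) :
    dualDif N R s p θ g = -sgn k p • θ (dd (R.obj s) (N - (p + 1)) (N - p) g) := rfl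

lemma dualDif_comp (N : ℤ) (R : DGMod S) (s : S.Obj) (p : ℤ)
    (θ : (R.obj s).X (N - p) →ₗ[k] CharacterModule k) :
    dualDif N R s (p + 1) (dualDif N R s p θ) = 0 := by
  ext1 g
  rw [dualDif_apply, dualDif_apply, dd_dd, map_zero, smul_zero, smul_zero]
  rfl

lemma dualDif_eq_zero {N : ℤ} {R : DGMod S} {s : S.Obj} {p : ℤ}
    {θ : (R.obj s).X (N - p) →ₗ[k] CharacterModule k} (h : dualDif N R s p θ = 0)
    (v : (R.obj s).X (N - (p + 1))) : θ (dd (R.obj s) (N - (p + 1)) (N - p) v) = 0 := by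
  have h₁ : -sgn k p • θ (dd (R.obj s) (N - (p + 1)) (N - p) v) = 0 := LinearMap.congr_fun h v
  have h₂ := congrArg (-sgn k p • ·) h₁
  simpa only [smul_smul, neg_mul_neg, sgn_mul_self, one_smul, smul_zero] using h₂

/-- The dual of a left module with values in the character module of `k`, shifted by `N`:
a right module. -/
def dual (N : ℤ) (R : DGMod S) : DGMod S.op :=
  ofGraded (A := S.op) (fun s p => (R.obj s).X (N - p) →ₗ[k] CharacterModule k) (dualDif N R) (dualDif_comp N R)
    (fun h => dualAct N R h)
    (fun {s s' i j} a θ => by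
      ext1 g
      have e : dif (S.op.Hom s s') i a = dd (S.Hom s' s) i (i + 1) a := rfl
      rw [LinearMap.add_apply, LinearMap.smul_apply, dualDif_apply, dualAct_apply, dualAct_apply,
        dualAct_apply, dualDif_apply, e,
        dd_act R (i' := i + 1) (j' := N - (i + j)) (n' := N - j)
          (show i + (N - (i + j + 1)) = N - (j + 1) by omega) rfl (by omega) (by omega)
          (by omega) (by omega)]
      simp only [map_add, map_smul, smul_add, smul_smul, add_mul, mul_add, sgn_add, one_mul,
        mul_one]
      have e1 : sgn k i * (sgn k (i * j) * sgn k i * (-sgn k j * sgn k i)) =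
        -(sgn k i * sgn k j * sgn k (i * j)) := by
        linear_combination (-(sgn k i * sgn k j * sgn k (i * j))) * sgn_mul_self (k := k) i
      have e2 : sgn k i * (sgn k (i * j) * sgn k i * -sgn k j) = -(sgn k j * sgn k (i * j)) := by
        linear_combination (-(sgn k j * sgn k (i * j))) * sgn_mul_self (k := k) i
      rw [e1, e2]
      match_scalars <;> ring)
    (fun {s j} θ => by
      ext1 g
      rw [dualAct_apply, zero_mul, sgn_zero, one_smul]
      exact congrArg θ (R.one_act g))
    (fun {s s' s'' a b c n} h h' f g θ => by
      ext1 r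
      rw [dualAct_apply, dualAct_apply, dualAct_apply]
      have e : S.op.comp (x := s) (y := s') (z := s'') (rfl : a + b = a + b) f g =
        sgn k (a * b) • S.comp (show b + a = a + b by omega) g f := rfl
      rw [e, map_smul, LinearMap.smul_apply, map_smul, smul_smul, smul_smul,
        R.comp_act (show b + a = a + b by omega) _ (show a + (N - n) = N - (b + c) by omega)
          (by omega)]
      congr 1
      simp only [add_mul, mul_add, sgn_add]
      ring)

lemma dual_dif (N : ℤ) (R : DGMod S) (s : S.Obj) (p : ℤ) :
    dif ((dual N R).obj s) p = dualDif N R s p := dif_cplxOf _ _ (dualDif_comp N R s) p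

/-- The dual of a morphism. -/
def dualMap (N : ℤ) {R R' : DGMod S} (w : R ⟶ R') : dual N R' ⟶ dual N R :=
  mkHom (fun s p => LinearMap.lcomp k (CharacterModule k) (Hom.ap w s (N - p)))
    (fun s p (θ : (R'.obj s).X (N - p) →ₗ[k] CharacterModule k) => by
      rw [dual_dif, dual_dif]
      apply LinearMap.ext
      intro g
      change -sgn k p • θ (dd _ _ _ (Hom.ap w s _ g)) = -sgn k p • θ (Hom.ap w s _ (dd _ _ _ g))
      rw [ap_dd])
    (fun {s s' i j n} h a (θ : (R'.obj s).X (N - j) →ₗ[k] CharacterModule k) => by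
      apply LinearMap.ext
      intro g
      change sgn k (i * j) • θ (R'.act _ a (Hom.ap w s' _ g)) =
        sgn k (i * j) • θ (Hom.ap w s _ (R.act _ a g))
      rw [ap_act])

/-- The dual of a quasi-isomorphism is a quasi-isomorphism. -/
lemma quasiIso_dualMap (N : ℤ) {R R' : DGMod S} {w : R ⟶ R'} (hw : quasiIso S w) :
    quasiIso S.op (dualMap N w) := by
  have hs (p : ℤ) : sgn k p * sgn k p = 1 := sgn_mul_self p
  rw [quasiIso_iff]
  intro s p
  rw [dual_dif, dual_dif, dual_dif, dual_dif]
  constructor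
  · intro (θ' : (R'.obj s).X (N - (p + 1)) →ₗ[k] CharacterModule k)
      (θ : (R.obj s).X (N - p) →ₗ[k] CharacterModule k) hθ' hθ
    have h₁ : ∀ v, θ' (dd (R'.obj s) (N - (p + 1 + 1)) (N - (p + 1)) v) = 0 := dualDif_eq_zero hθ'
    have h₂ : ∀ v, θ' (Hom.ap w s _ v) = -sgn k p • θ (dd (R.obj s) _ _ v) := fun v =>
      LinearMap.congr_fun hθ v
    -- To write `θ'` as a form on boundaries it is enough that `θ'` kills cocycles. A cocycle of
    -- `R'` is `w(m) + dv` with `m` a cocycle; `θ'` kills `dv`, and on `w(m)` it is `±θ(dm) = 0`.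
    obtain ⟨ψ, hψ⟩ := exists_factor_of_ker_le (dd (R'.obj s) (N - (p + 1)) (N - p)) θ' (by
      intro r hr
      obtain ⟨m, v, hm, rfl⟩ := hw.exists_eq_add s (show N - (p + 1 + 1) + 1 = N - (p + 1) by omega)
        (show N - (p + 1) + 1 = N - p by omega) r hr
      rw [map_add, h₁, h₂, hm, map_zero, smul_zero, add_zero])
    refine ⟨(-sgn k p • ψ : (R'.obj s).X (N - p) →ₗ[k] CharacterModule k), ?_⟩
    apply LinearMap.ext
    intro v
    change -sgn k p • -sgn k p • ψ (dd (R'.obj s) _ _ v) = θ' v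
    rw [smul_smul, neg_mul_neg, hs, one_smul, hψ]
  · intro (θ : (R.obj s).X (N - (p + 1)) →ₗ[k] CharacterModule k) hθ
    have h₁ : ∀ v, θ (dd (R.obj s) (N - (p + 1 + 1)) (N - (p + 1)) v) = 0 := dualDif_eq_zero hθ
    let B : Submodule k ((R'.obj s).X (N - (p + 1))) :=
      LinearMap.range (dd (R'.obj s) (N - (p + 1 + 1)) (N - (p + 1)))
    -- Split `θ` as a form on `R'` modulo boundaries pulled back by `w`, plus a form composed with
    -- `d`. It factors through this pair of maps because a cocycle `r` with `w(r)` a boundary is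
    -- itself a boundary, where `θ` vanishes.
    obtain ⟨ψ, hψ⟩ := exists_factor_of_ker_le
      ((B.mkQ ∘ₗ Hom.ap w s (N - (p + 1))).prod (dd (R.obj s) (N - (p + 1)) (N - p))) θ (by
      intro r hr
      have hr₁ : B.mkQ (Hom.ap w s _ r) = 0 := congrArg Prod.fst hr
      have hr₂ : dd (R.obj s) _ _ r = 0 := congrArg Prod.snd hr
      obtain ⟨v, hv⟩ : Hom.ap w s _ r ∈ B := by simpa using hr₁
      obtain ⟨u, rfl⟩ := hw.exists_dd_eq s (show N - (p + 1 + 1) + 1 = N - (p + 1) by omega)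
        (show N - (p + 1) + 1 = N - p by omega) r hr₂ v hv.symm
      exact h₁ u)
    refine ⟨ψ ∘ₗ LinearMap.inl k _ _ ∘ₗ B.mkQ,
      (-sgn k p • (ψ ∘ₗ LinearMap.inr k _ _) : (R.obj s).X (N - p) →ₗ[k] CharacterModule k),
      ?_, ?_⟩
    · apply LinearMap.ext
      intro v
      have hv : B.mkQ (dd (R'.obj s) (N - (p + 1 + 1)) (N - (p + 1)) v) = 0 := by
        rw [Submodule.mkQ_apply, Submodule.Quotient.mk_eq_zero]
        exact ⟨v, rfl⟩
      change -sgn k (p + 1) • ψ (LinearMap.inl k _ _ (B.mkQ (dd (R'.obj s) _ _ v))) = 0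
      rw [hv, map_zero, map_zero, smul_zero]
    · apply LinearMap.ext
      intro v
      change θ v = ψ (LinearMap.inl k _ _ (B.mkQ (Hom.ap w s _ v))) +
        -sgn k p • -sgn k p • ψ (LinearMap.inr k _ _ (dd (R.obj s) _ _ v))
      rw [smul_smul, neg_mul_neg, hs, one_smul, ← map_add, ← hψ]
      congr 1
      simp

end Dual

/-! ### Forms on a tensor product as morphisms to a dual; flatness of cofibrant modules -/

section Pairing

variable {S B : DGCat k} {X : DGMod S.op} {G G' : DGMod (S.tensor B)} {b : B.Obj}

/-- The restriction of an `S ⊗ B`-module to `S` at an object of `B`. -/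
abbrev atRight (G : DGMod (S.tensor B)) (b : B.Obj) : DGMod S := G.pullback (DGFunctor.inl S B b)

lemma tensorDif_tm_dd {s : S.Obj} {p q p' q' n : ℤ} (hp : p + 1 = p')
    (hq : q + 1 = q') (h : p + q = n) (h₁ : p' + q = n + 1) (h₂ : p + q' = n + 1)
    (x : (X.obj s).X p) (g : (G.obj (s, b)).X q) :
    tensorDif X G b n (tm X G b s h x g) = tm X G b s h₁ (dd (X.obj s) p p' x) g +
      sgn k p • tm X G b s h₂ x (dd (G.obj (s, b)) q q' g) := by
  subst hp hq
  exact tensorDif_tm h x g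

/-- The linear form `x ⊗ g ↦ ψ(x)(g)` on `X ⊗_S G`. -/
def dualPair {d M N : ℤ} (h : M + d = N) (ψ : GHom X (dual N (atRight G b)) d) :
    TensorX X G b M →ₗ[k] CharacterModule k :=
  tmLift (fun s p q hpq => (LinearMap.lcomp k (CharacterModule k)
      ((Hom.toGHom (𝟙 (atRight G b))).app s (show q + 0 = N - (p + d) by omega))) ∘ₗ
        (show (X.obj s).X p →ₗ[k] (((atRight G b).obj s).X (N - (p + d)) →ₗ[k] CharacterModule k)
          from ψ.app s rfl)) (by
    intro s s' i p q ip iq hip hiq h h' a x g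
    change (show ((atRight G b).obj s').X (N - (ip + d)) →ₗ[k] CharacterModule k from
      ψ.app s' rfl (X.act hip a x)) ((Hom.toGHom (𝟙 (atRight G b))).app s' _ g) =
      sgn k (i * p) • (show ((atRight G b).obj s).X (N - (p + d)) →ₗ[k] CharacterModule k from
      ψ.app s rfl x) ((Hom.toGHom (𝟙 (atRight G b))).app s _ ((atRight G b).act hiq a g))
    rw [toGHom_act _ hiq (show q + 0 = N - (ip + d) by omega) _ (by omega)]
    have := LinearMap.congr_fun (ψ.comm (x := s) (y := s') hip rfl rfl (by omega) a x)
      ((Hom.toGHom (𝟙 (atRight G b))).app s' (show q + 0 = N - (ip + d) by omega) g)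
    refine this.trans ((smul_smul (sgn k (d * i)) (sgn k (i * (p + d))) _).trans ?_)
    congr 1
    rw [mul_add, sgn_add, mul_comm d i]
    linear_combination sgn k (i * p) * sgn_mul_self (k := k) (i * d))

lemma dualPair_tm {d M N : ℤ} (h : M + d = N) (ψ : GHom X (dual N (atRight G b)) d) (s : S.Obj)
    {p p' : ℤ} (hp : p + d = p') (hpq : p + (N - p') = M) (x : (X.obj s).X p)
    (g : (G.obj (s, b)).X (N - p')) :
    dualPair h ψ (tm X G b s hpq x g) =
      (show (G.obj (s, b)).X (N - p') →ₗ[k] CharacterModule k from ψ.app s hp x) g := by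
  subst hp
  rw [dualPair, tmLift_tm]
  rfl

/-- The morphism to the dual attached to a linear form on the tensor product. -/
def ofPairing {d M N : ℤ} (h : M + d = N) (χ : TensorX X G b M →ₗ[k] CharacterModule k) :
    GHom X (dual N (atRight G b)) d where
  app s p p' hp := (tm X G b s (show p + (N - p') = M by omega)).compr₂ χ
  comm {s s' i j t u l} hs ht hj hu a x := by
    apply LinearMap.ext
    intro (g : (G.obj (s', b)).X (N - u))
    change χ (tm X G b s' _ (X.act hs a x) g) = sgn k (d * i) • sgn k (i * l) •
      χ (tm X G b s _ x ((atRight G b).act _ a g))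
    rw [tm_rel hs (show i + (N - u) = N - l by omega) _ (show j + (N - l) = M by omega), map_smul,
      smul_smul]
    congr 1
    rw [← hj, mul_add, sgn_add, mul_comm d i]
    linear_combination (-sgn k (i * j)) * sgn_mul_self (k := k) (i * d)

/-- In `x ⊗ g` of total degree `M` the degree of `g` is `N - (p + d)`, the index at which the dual
is formed, so both sides can be compared on such tensors by evaluation. -/
lemma tensorX_form_ext {M : ℤ} {χ χ' : TensorX X G b M →ₗ[k] CharacterModule k} (N d : ℤ)
    (h : M + d = N) (H : ∀ (s : S.Obj) (p p' : ℤ) (_ : p + d = p') (hp : p + (N - p') = M)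
      (x : (X.obj s).X p) (g : (G.obj (s, b)).X (N - p')),
      χ (tm X G b s hp x g) = χ' (tm X G b s hp x g)) :
    χ = χ' := by
  apply tm_ext
  intro s p q hpq x g
  obtain rfl : q = N - (p + d) := by omega
  exact H s p _ rfl hpq x g

lemma dualPair_toGHom_tm {N : ℤ} (e : X ⟶ dual N (atRight G b)) (s : S.Obj) {p : ℤ}
    (hpq : p + (N - p) = N) (x : (X.obj s).X p) (g : (G.obj (s, b)).X (N - p)) :
    dualPair (add_zero N) (Hom.toGHom e) (tm X G b s hpq x g) =
      (show (G.obj (s, b)).X (N - p) →ₗ[k] CharacterModule k from Hom.ap e s p x) g :=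
  dualPair_tm (add_zero N) (Hom.toGHom e) s (add_zero p) hpq x g

/-- The closed morphism to the dual attached to a linear form which vanishes on boundaries. -/
def homOfPairing {n : ℤ} (χ : TensorX X G b (n + 1) →ₗ[k] CharacterModule k)
    (hχ : ∀ t, χ (tensorDif X G b n t) = 0) : X ⟶ dual (n + 1) (atRight G b) :=
  (ofPairing (add_zero (n + 1)) χ).toHom (by
    intro s p x
    rw [dual_dif]
    apply LinearMap.ext
    intro (g : (G.obj (s, b)).X (n + 1 - (p + 1)))
    change χ (tm X G b s _ (dif (X.obj s) p x) g) = -sgn k p • χ (tm X G b s _ x (dd _ _ _ g))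
    rw [dif_eq_dd, neg_smul]
    refine (eq_neg_of_add_eq_zero_left ?_)
    rw [← map_smul, ← map_add]
    have := hχ (tm X G b s (show p + (n + 1 - (p + 1)) = n by omega) x g)
    rwa [tensorDif_tm_dd rfl (show n + 1 - (p + 1) + 1 = n + 1 - p by omega) _ (by omega)
      (by omega)] at this)

lemma dualPair_homOfPairing {n : ℤ} (χ : TensorX X G b (n + 1) →ₗ[k] CharacterModule k)
    (hχ : ∀ t, χ (tensorDif X G b n t) = 0) :
    dualPair (add_zero (n + 1)) (Hom.toGHom (homOfPairing χ hχ)) = χ := by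
  refine tensorX_form_ext (n + 1) 0 (add_zero _) fun s p p' h hp x g => ?_
  obtain rfl : p = p' := by omega
  rw [dualPair_toGHom_tm]
  rfl

/-- This is the converse of `homOfPairing`: closed morphisms from `X` to the dual of `G` correspond
to forms on `X ⊗ G` which vanish on boundaries. -/
lemma dualPair_tensorDif {n : ℤ} (e : X ⟶ dual (n + 1) (atRight G b)) (t : TensorX X G b n) :
    dualPair (add_zero (n + 1)) (Hom.toGHom e) (tensorDif X G b n t) = 0 := by
  suffices h : dualPair (add_zero (n + 1)) (Hom.toGHom e) ∘ₗ tensorDif X G b n = 0 from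
    LinearMap.congr_fun h t
  refine tensorX_form_ext (n + 1) 1 rfl fun s p p' h hp x g => ?_
  subst h
  rw [LinearMap.comp_apply, tensorDif_tm_dd rfl (show n + 1 - (p + 1) + 1 = n + 1 - p by omega) _
    (by omega) (by omega), map_add, map_smul, dualPair_toGHom_tm, dualPair_toGHom_tm]
  have := ap_dif e s p x
  rw [dual_dif] at this
  have := LinearMap.congr_fun (show (show (G.obj (s, b)).X (n + 1 - (p + 1)) →ₗ[k]
    CharacterModule k from Hom.ap e s (p + 1) (dd (X.obj s) p (p + 1) x)) = dualDif _ _ s p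
      (Hom.ap e s p x) from this) g
  exact (congrArg (· + _) (this.trans (neg_smul (sgn k p) _))).trans (neg_add_cancel _)

/-- On cocycles the right-hand side is zero, so homotopic morphisms to the dual define the same form
on cohomology classes. -/
lemma dualPair_homotopy {n : ℤ} {e e' : X ⟶ dual (n + 1) (atRight G b)} {s : GHom _ _ (-1)}
    (hs : s.IsHomotopy e e') (t : TensorX X G b (n + 1)) :
    dualPair (add_zero (n + 1)) (Hom.toGHom e) t - dualPair (add_zero (n + 1)) (Hom.toGHom e') t =
      dualPair (show n + 1 + 1 + -1 = n + 1 by omega) s (tensorDif X G b (n + 1) t) := by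
  suffices h : dualPair (add_zero (n + 1)) (Hom.toGHom e) -
      dualPair (add_zero (n + 1)) (Hom.toGHom e') =
      dualPair (show n + 1 + 1 + -1 = n + 1 by omega) s ∘ₗ tensorDif X G b (n + 1) from
    LinearMap.congr_fun h t
  refine tensorX_form_ext (n + 1) 0 (add_zero _) fun o p p' h hp x g => ?_
  obtain rfl : p = p' := by omega
  obtain ⟨p, rfl⟩ : ∃ m, p = m + 1 := ⟨p - 1, by ring⟩
  rw [LinearMap.comp_apply, tensorDif_tm_dd rfl (show n + 1 - (p + 1) + 1 = n + 1 - p by omega) _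
    (by omega) (by omega), map_add, map_smul, LinearMap.sub_apply, dualPair_toGHom_tm,
    dualPair_toGHom_tm, dualPair_tm _ _ _ (show p + 1 + -1 = p by omega),
    dualPair_tm _ _ _ (show p + 1 + 1 + -1 = p + 1 by omega)]
  have := hs o p x
  rw [dual_dif] at this
  refine (LinearMap.congr_fun this g).trans ?_
  change -sgn k p • (show (G.obj (o, b)).X (n + 1 - p) →ₗ[k] CharacterModule k from
    s.app o _ x) (dd _ _ _ g) + _ = _
  rw [sgn_add, sgn_one, mul_neg_one, add_comm]
  rfl

/-- Conversely, a form which factors through the differential corresponds to a nullhomotopic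
morphism; the factor `θ` is the homotopy. -/
lemma isHomotopy_ofPairing {n : ℤ} {e : X ⟶ dual (n + 1) (atRight G b)}
    (θ : TensorX X G b (n + 1 + 1) →ₗ[k] CharacterModule k)
    (hθ : ∀ t, dualPair (add_zero (n + 1)) (Hom.toGHom e) t = θ (tensorDif X G b (n + 1) t)) :
    (ofPairing (show n + 1 + 1 + -1 = n + 1 by omega) θ).IsHomotopy e 0 := by
  intro o p x
  rw [dual_dif]
  apply LinearMap.ext
  intro (g : (G.obj (o, b)).X (n + 1 - (p + 1)))
  have h := hθ (tm X G b o (show p + 1 + (n + 1 - (p + 1)) = n + 1 by omega) x g)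
  rw [dualPair_toGHom_tm, tensorDif_tm_dd rfl (show n + 1 - (p + 1) + 1 = n + 1 - p by omega) _
    (by omega) (by omega), map_add, map_smul, sgn_add, sgn_one, mul_neg_one] at h
  exact (sub_zero _).trans (h.trans (add_comm _ _))

lemma dualPair_comp_dualMap {n : ℤ} (w : G ⟶ G') (e : X ⟶ dual (n + 1) (atRight G' b))
    (t : TensorX X G b (n + 1)) :
    dualPair (add_zero (n + 1)) (Hom.toGHom
      (e ≫ dualMap (n + 1) (pullbackMap (DGFunctor.inl S B b) w))) t =
    dualPair (add_zero (n + 1)) (Hom.toGHom e)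
      (mapRightFun X (Hom.toGHom w) b (add_zero (n + 1)) t) := by
  suffices h : dualPair (add_zero (n + 1)) (Hom.toGHom
      (e ≫ dualMap (n + 1) (pullbackMap (DGFunctor.inl S B b) w))) =
      dualPair (add_zero (n + 1)) (Hom.toGHom e) ∘ₗ
        mapRightFun X (Hom.toGHom w) b (add_zero (n + 1)) from LinearMap.congr_fun h t
  refine tensorX_form_ext (n + 1) 0 (add_zero _) fun s p p' h hp x g => ?_
  obtain rfl : p = p' := by omega
  rw [LinearMap.comp_apply, mapRightFun_tm X _ b _ s _ (add_zero _), zero_mul, sgn_zero, one_smul,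
    dualPair_toGHom_tm, dualPair_toGHom_tm]
  rfl

/-- Cofibrant modules are homotopically flat: tensoring with them preserves quasi-isomorphisms. -/
theorem quasiIso_homRight (hX : X.IsCofibrant) {w : G ⟶ G'} (hw : quasiIso _ w) :
    quasiIso B (homRight X w) := by
  rw [quasiIso_iff]
  intro b n
  have hw' : quasiIso S (pullbackMap (DGFunctor.inl S B b) w) := fun s => hw (s, b)
  have hD := quasiIso_dualMap (n + 1) hw'
  have hd (Γ : DGMod (S.tensor B)) (m : ℤ) :
    dif ((tensorOver X Γ).obj b) m = tensorDif X Γ b m := dif_tensorCplx m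
  rw [hd, hd, hd, hd]
  let φ : TensorX X G b (n + 1) →ₗ[k] TensorX X G' b (n + 1) :=
    mapRightFun X (Hom.toGHom w) b (add_zero (n + 1))
  constructor
  · intro (x : TensorX X G b (n + 1)) (y : TensorX X G' b n) (hx : tensorDif X G b (n + 1) x = 0)
      (hxy : φ x = tensorDif X G' b n y)
    by_contra hne
    obtain ⟨χ, hχ, hχx⟩ := exists_separating (LinearMap.range (tensorDif X G b n)) x hne
    have hχ' : ∀ t, χ (tensorDif X G b n t) = 0 := fun t => hχ _ ⟨t, rfl⟩
    -- The morphism attached to `χ` lifts up to homotopy through the dual of `G'`. On the cocycle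
    -- `x`, the form `χ` is then the value at `φ x` of a form which kills boundaries, contradicting
    -- `χ x ≠ 0`.
    obtain ⟨e, s, hs⟩ := hX.exists_lift hD (homOfPairing χ hχ')
    have h₁ := dualPair_homotopy hs x
    rw [dualPair_homOfPairing, hx, map_zero, dualPair_comp_dualMap, hxy, dualPair_tensorDif,
      zero_sub, neg_eq_zero] at h₁
    exact hχx h₁
  · intro (y : TensorX X G' b (n + 1)) (hy : tensorDif X G' b (n + 1) y = 0)
    let K : Submodule k (TensorX X G' b (n + 1)) := LinearMap.range (tensorDif X G' b n) ⊔
      (LinearMap.ker (tensorDif X G b (n + 1))).map φ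
    suffices h : y ∈ K by
      obtain ⟨_, ⟨v, rfl⟩, _, ⟨x, hx, rfl⟩, h⟩ := Submodule.mem_sup.mp h
      exact ⟨x, v, hx, h.symm.trans (add_comm _ _)⟩
    by_contra hne
    obtain ⟨χ, hχ, hχy⟩ := exists_separating K y hne
    have hχ' : ∀ t, χ (tensorDif X G' b n t) = 0 := fun t =>
      hχ _ (Submodule.mem_sup_left ⟨t, rfl⟩)
    -- As `χ ∘ φ` kills cocycles, it factors through the differential, so the morphism attached to
    -- `χ` becomes null after composition with the dual of `w`. Cofibrancy of `X` makes it null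
    -- already, hence `χ y = 0`.
    obtain ⟨θ, hθ⟩ := exists_factor_of_ker_le (tensorDif X G b (n + 1)) (χ ∘ₗ φ)
      (fun v hv => hχ _ (Submodule.mem_sup_right ⟨v, hv, rfl⟩))
    have h₀ := hX.homotopic_zero hD (homOfPairing χ hχ') ⟨_, isHomotopy_ofPairing θ fun t => by
      rw [dualPair_comp_dualMap, dualPair_homOfPairing, hθ]
      rfl⟩
    obtain ⟨s, hs⟩ := h₀
    have h₁ := dualPair_homotopy hs y
    have h₂ : dualPair (add_zero (n + 1))
        (Hom.toGHom (0 : X ⟶ dual (n + 1) (atRight G' b))) = 0 := by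
      refine tensorX_form_ext (n + 1) 0 (add_zero _) fun s p p' h hp x g => ?_
      obtain rfl : p = p' := by omega
      rw [dualPair_toGHom_tm]
      rfl
    rw [dualPair_homOfPairing, hy, map_zero, sub_eq_zero, h₂] at h₁
    exact hχy h₁

end Pairing

end DGMod

end

end DG

/-! ### The tensor product as a functor in each variable -/

namespace DG

noncomputable section

variable {k : Type u} [CommRing k]

namespace DGMod

section TensorFunctors

variable {S B : DGCat k}

lemma tensorOver_dif (X : DGMod S.op) (G : DGMod (S.tensor B)) (b : B.Obj) (n : ℤ) :
    dif ((tensorOver X G).obj b) n = tensorDif X G b n := dif_tensorCplx n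

/-- Construct a morphism out of a tensor product from linear maps on its underlying modules. -/
def tensorDesc {X : DGMod S.op} {G : DGMod (S.tensor B)} {N : DGMod B}
    (φ : ∀ b n, TensorX X G b n →ₗ[k] (N.obj b).X n)
    (hd : ∀ b s (p q n : ℤ) (h : p + q = n) (x : (X.obj s).X p) (g : (G.obj (s, b)).X q),
      φ b (n + 1) (tensorDif X G b n (tm X G b s h x g)) =
        dif (N.obj b) n (φ b n (tm X G b s h x g)))
    (ha : ∀ {b b' : B.Obj} {i j n : ℤ} (h : i + j = n) (c : (B.Hom b b').X i) s (p q : ℤ)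
      (h' : p + q = j) (x : (X.obj s).X p) (g : (G.obj (s, b)).X q),
      φ b' n (tensorAct X G h c (tm X G b s h' x g)) = N.act h c (φ b j (tm X G b s h' x g))) :
    tensorOver X G ⟶ N :=
  mkHom (M := tensorOver X G) φ
    (fun b n (t : TensorX X G b n) => by
      have H : φ b (n + 1) ∘ₗ tensorDif X G b n = dif (N.obj b) n ∘ₗ φ b n :=
        tm_ext fun s p q h x g => hd b s p q n h x g
      exact (congrArg (φ b (n + 1)) (LinearMap.congr_fun (tensorOver_dif X G b n) t)).trans
        (LinearMap.congr_fun H t))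
    (fun {b b' i j n} h c t => by
      have H : φ b' n ∘ₗ tensorAct X G h c = N.act h c ∘ₗ φ b j :=
        tm_ext fun s p q h' x g => ha h c s p q h' x g
      exact LinearMap.congr_fun H t)

lemma tensorOver_hom_ext {X : DGMod S.op} {G : DGMod (S.tensor B)} {N : DGMod B}
    {f g : tensorOver X G ⟶ N}
    (H : ∀ b s (p q n : ℤ) (h : p + q = n) (x : (X.obj s).X p) (y : (G.obj (s, b)).X q),
      Hom.ap f b n (tm X G b s h x y) = Hom.ap g b n (tm X G b s h x y)) : f = g :=
  hom_ext_ap fun b n t => LinearMap.congr_fun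
    (tm_ext (f := Hom.ap f b n) (g := Hom.ap g b n) fun s p q h x y => H b s p q n h x y) t

lemma homLeft_ap_tm {X X' : DGMod S.op} (f : X ⟶ X') (G : DGMod (S.tensor B)) (b : B.Obj)
    (s : S.Obj) {p q n : ℤ} (h : p + q = n) (x : (X.obj s).X p) (g : (G.obj (s, b)).X q) :
    Hom.ap (homLeft f G) b n (tm X G b s h x g) = tm X' G b s h (Hom.ap f s p x) g :=
  mapLeftFun_tm G (Hom.toGHom f) b (add_zero n) s h (add_zero p) x g

lemma homRight_ap_tm (X : DGMod S.op) {G G' : DGMod (S.tensor B)} (f : G ⟶ G') (b : B.Obj)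
    (s : S.Obj) {p q n : ℤ} (h : p + q = n) (x : (X.obj s).X p) (g : (G.obj (s, b)).X q) :
    Hom.ap (homRight X f) b n (tm X G b s h x g) = tm X G' b s h x (Hom.ap f (s, b) q g) := by
  refine (mapRightFun_tm X (Hom.toGHom f) b (add_zero n) s h (add_zero q) x g).trans ?_
  rw [zero_mul, sgn_zero, one_smul]
  rfl

/-- The functor `- ⊗_S G`. -/
def tensorLeftFunctor (G : DGMod (S.tensor B)) : DGMod S.op ⥤ DGMod B where
  obj X := tensorOver X G
  map f := homLeft f G
  map_id X := tensorOver_hom_ext fun _ _ _ _ _ _ _ _ => by rw [homLeft_ap_tm]; rfl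
  map_comp f g := tensorOver_hom_ext fun _ _ _ _ _ _ _ _ => by
    rw [homLeft_ap_tm]
    exact ((congrArg (Hom.ap (homLeft g G) _ _) (homLeft_ap_tm f G _ _ _ _ _)).trans
      (homLeft_ap_tm g G _ _ _ _ _)).symm

/-- The functor `X ⊗_S -`. -/
def tensorRightFunctor (X : DGMod S.op) : DGMod (S.tensor B) ⥤ DGMod B where
  obj G := tensorOver X G
  map f := homRight X f
  map_id X := tensorOver_hom_ext fun _ _ _ _ _ _ _ _ => by rw [homRight_ap_tm]; rfl
  map_comp f g := tensorOver_hom_ext fun _ _ _ _ _ _ _ _ => by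
    rw [homRight_ap_tm]
    exact ((congrArg (Hom.ap (homRight X g) _ _) (homRight_ap_tm X f _ _ _ _ _)).trans
      (homRight_ap_tm X g _ _ _ _ _)).symm

lemma homLeft_zero (X X' : DGMod S.op) (G : DGMod (S.tensor B)) :
    homLeft (0 : X ⟶ X') G = 0 := tensorOver_hom_ext fun _ _ _ _ _ _ _ _ => by
  rw [homLeft_ap_tm, ap_zero, map_zero]
  rfl

lemma homRight_zero (X : DGMod S.op) (G G' : DGMod (S.tensor B)) :
    homRight X (0 : G ⟶ G') = 0 := tensorOver_hom_ext fun _ _ _ _ _ _ _ _ => by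
  rw [homRight_ap_tm, ap_zero, map_zero]
  rfl

lemma homLeft_homRight_comm {X X' : DGMod S.op} (f : X ⟶ X') {G G' : DGMod (S.tensor B)}
    (w : G ⟶ G') : homLeft f G ≫ homRight X' w = homRight X w ≫ homLeft f G' :=
  tensorOver_hom_ext fun b s p q n h x y => by
    have h₁ := congrArg (Hom.ap (homRight X' w) b n) (homLeft_ap_tm f G b s h x y)
    have h₂ := congrArg (Hom.ap (homLeft f G') b n) (homRight_ap_tm X w b s h x y)
    exact (h₁.trans (homRight_ap_tm X' w b s h _ y)).trans
      (h₂.trans (homLeft_ap_tm f G' b s h x _)).symm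

/-- The homotopy is `σ ⊗ 1`: its two terms in `σ(x) ⊗ dg` cancel because `σ` changes the parity of
`x`. -/
lemma Homotopic.homLeft {X X' : DGMod S.op} {f g : X ⟶ X'} (h : Homotopic f g)
    (G : DGMod (S.tensor B)) : Homotopic (homLeft f G) (homLeft g G) := by
  obtain ⟨σ, hσ⟩ := h
  refine ⟨mapLeft G σ, fun b n (t : TensorX X G b (n + 1)) => ?_⟩
  rw [tensorOver_dif, tensorOver_dif]
  change mapLeftFun G (Hom.toGHom f) b (add_zero (n + 1)) t -
    mapLeftFun G (Hom.toGHom g) b (add_zero (n + 1)) t =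
    tensorDif X' G b n (mapLeftFun G σ b (show n + 1 + -1 = n by omega) t) +
      mapLeftFun G σ b (show n + 1 + 1 + -1 = n + 1 by omega) (tensorDif X G b (n + 1) t)
  induction t using tm_induction with
  | h0 => simp
  | hadd t t' h₁ h₂ =>
    simp only [map_add, add_sub_add_comm, h₁, h₂]
    abel
  | H s p q h x y =>
    obtain ⟨p, rfl⟩ : ∃ m, p = m + 1 := ⟨p - 1, by ring⟩
    rw [tensorDif_tm, map_add, map_smul, mapLeftFun_tm G _ b _ s _ (add_zero _),
      mapLeftFun_tm G _ b _ s _ (add_zero _), mapLeftFun_tm G σ b _ s _ (show p + 1 + -1 = p by omega),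
      mapLeftFun_tm G σ b _ s _ (show p + 1 + 1 + -1 = p + 1 by omega),
      mapLeftFun_tm G σ b _ s _ (show p + 1 + -1 = p by omega), tensorDif_tm, toGHom_app,
      toGHom_app, ← LinearMap.sub_apply, ← map_sub, hσ, map_add, LinearMap.add_apply, sgn_add,
      sgn_one]
    module

/-- The homotopy is `1 ⊗ σ`; the Koszul sign in `mapRight` makes the terms in `dx ⊗ σ(g)` cancel. -/
lemma Homotopic.homRight (X : DGMod S.op) {G G' : DGMod (S.tensor B)} {f g : G ⟶ G'}
    (h : Homotopic f g) : Homotopic (homRight X f) (homRight X g) := by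
  obtain ⟨σ, hσ⟩ := h
  refine ⟨mapRight X σ, fun b n (t : TensorX X G b (n + 1)) => ?_⟩
  rw [tensorOver_dif, tensorOver_dif]
  change mapRightFun X (Hom.toGHom f) b (add_zero (n + 1)) t -
    mapRightFun X (Hom.toGHom g) b (add_zero (n + 1)) t =
    tensorDif X G' b n (mapRightFun X σ b (show n + 1 + -1 = n by omega) t) +
      mapRightFun X σ b (show n + 1 + 1 + -1 = n + 1 by omega) (tensorDif X G b (n + 1) t)
  induction t using tm_induction with
  | h0 => simp
  | hadd t t' h₁ h₂ =>
    simp only [map_add, add_sub_add_comm, h₁, h₂]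
    abel
  | H s p q h x y =>
    obtain ⟨q, rfl⟩ : ∃ m, q = m + 1 := ⟨q - 1, by ring⟩
    rw [tensorDif_tm, map_add, map_smul, mapRightFun_tm X _ b _ s _ (add_zero _),
      mapRightFun_tm X _ b _ s _ (add_zero _),
      mapRightFun_tm X σ b _ s _ (show q + 1 + -1 = q by omega),
      mapRightFun_tm X σ b _ s _ (show q + 1 + 1 + -1 = q + 1 by omega),
      mapRightFun_tm X σ b _ s _ (show q + 1 + -1 = q by omega), map_smul, tensorDif_tm, toGHom_app,
      toGHom_app, zero_mul, sgn_zero, one_smul, one_smul, ← map_sub, hσ, map_add]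
    simp only [sgn_neg_one_mul, sgn_add, sgn_one, smul_add, smul_smul, sgn_mul_self, one_smul]
    module

lemma Homotopic.pullbackMap {A B : DGCat k} (F : DGFunctor A B) {M N : DGMod B} {f g : M ⟶ N}
    (h : Homotopic f g) : Homotopic (pullbackMap F f) (pullbackMap F g) := by
  obtain ⟨σ, hσ⟩ := h
  exact ⟨⟨fun x _ _ h => σ.app (F.obj x) h, fun h hs hj ht a m => σ.comm h hs hj ht (F.map a) m⟩,
    fun x n m => hσ (F.obj x) n m⟩

end TensorFunctors

/-! ### Compatibility with changes in the variable not tensored over -/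

section Spectator

variable {S B B' : DGCat k} (X : DGMod S.op) {G : DGMod (S.tensor B)} {G' : DGMod (S.tensor B')}
  {b : B.Obj} {b' : B'.Obj}

/-- The map `x ⊗ g ↦ x ⊗ ε(g)` for an `S`-linear map `ε`. -/
def spectatorMap (ε : ∀ s q, (G.obj (s, b)).X q →ₗ[k] (G'.obj (s, b')).X q)
    (hε : ∀ {s s' : S.Obj} {i q iq : ℤ} (h : i + q = iq) (a : (S.Hom s' s).X i)
      (g : (G.obj (s', b)).X q),
      ε s iq (G.act (x := (s', b)) (y := (s, b)) h (DGFunctor.inlMap S B b i a) g) =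
        G'.act (x := (s', b')) (y := (s, b')) h (DGFunctor.inlMap S B' b' i a) (ε s' q g))
    (n : ℤ) : TensorX X G b n →ₗ[k] TensorX X G' b' n :=
  tmLift (fun s p q h => (tm X G' b' s h).compl₂ (ε s q)) (by
    intro s s' i p q ip iq hip hiq h h' a x g
    simp only [LinearMap.compl₂_apply]
    rw [tm_rel hip hiq h h', hε])

lemma spectatorMap_tm (ε : ∀ s q, (G.obj (s, b)).X q →ₗ[k] (G'.obj (s, b')).X q) (hε)
    (s : S.Obj) {p q n : ℤ} (h : p + q = n) (x : (X.obj s).X p) (g : (G.obj (s, b)).X q) :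
    spectatorMap X ε hε n (tm X G b s h x g) = tm X G' b' s h x (ε s q g) :=
  tmLift_tm _ _ s h x g

lemma spectatorMap_bijective (ε : ∀ s q, (G.obj (s, b)).X q →ₗ[k] (G'.obj (s, b')).X q) (hε)
    (δ : ∀ s q, (G'.obj (s, b')).X q →ₗ[k] (G.obj (s, b)).X q)
    (h₁ : ∀ s q g, δ s q (ε s q g) = g) (h₂ : ∀ s q g, ε s q (δ s q g) = g) (n : ℤ) :
    Function.Bijective (spectatorMap X ε hε n) := by
  -- The pointwise inverse of an `S`-linear bijection is again `S`-linear, so it induces the inverse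
  -- map.
  have hδ {s s' : S.Obj} {i q iq : ℤ} (h : i + q = iq) (a : (S.Hom s' s).X i)
      (g : (G'.obj (s', b')).X q) :
      δ s iq (G'.act (x := (s', b')) (y := (s, b')) h (DGFunctor.inlMap S B' b' i a) g) =
        G.act (x := (s', b)) (y := (s, b)) h (DGFunctor.inlMap S B b i a) (δ s' q g) := by
    conv_lhs => rw [← h₂ s' q g, ← hε, h₁]
  have e₁ : spectatorMap X δ (fun h a g => hδ h a g) n ∘ₗ spectatorMap X ε hε n = LinearMap.id :=
    tm_ext fun s p q h x g => by
      rw [LinearMap.comp_apply, spectatorMap_tm, spectatorMap_tm, h₁]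
      rfl
  have e₂ : spectatorMap X ε hε n ∘ₗ spectatorMap X δ (fun h a g => hδ h a g) n = LinearMap.id :=
    tm_ext fun s p q h x g => by
      rw [LinearMap.comp_apply, spectatorMap_tm, spectatorMap_tm, h₂]
      rfl
  exact Function.bijective_iff_has_inverse.mpr
    ⟨spectatorMap X δ (fun h a g => hδ h a g) n, fun t => LinearMap.congr_fun e₁ t, fun t => LinearMap.congr_fun e₂ t⟩

lemma spectatorMap_dif (ε : ∀ s q, (G.obj (s, b)).X q →ₗ[k] (G'.obj (s, b')).X q) (hε)
    (hd : ∀ s q g, ε s (q + 1) (dif (G.obj (s, b)) q g) = dif (G'.obj (s, b')) q (ε s q g))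
    (n : ℤ) (t : TensorX X G b n) :
    spectatorMap X ε hε (n + 1) (tensorDif X G b n t) =
      tensorDif X G' b' n (spectatorMap X ε hε n t) := by
  induction t using tm_induction with
  | h0 => simp
  | hadd t t' h₁ h₂ => simp only [map_add, h₁, h₂]
  | H s p q h x g =>
    rw [tensorDif_tm, map_add, map_smul, spectatorMap_tm, spectatorMap_tm, spectatorMap_tm,
      tensorDif_tm, hd]

end Spectator

section PullbackTensor

variable {S B B' : DGCat k} (X : DGMod S.op) (G : DGMod (S.tensor B)) (F : DGFunctor B' B)

lemma whiskerLeft_map_tmul (S : DGCat k) {B B' : DGCat k} (F : DGFunctor B' B)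
    {x y : (S.tensor B').Obj} {p q n : ℤ} (h : p + q = n) (a : (S.Hom x.1 y.1).X p)
    (c : (B'.Hom x.2 y.2).X q) :
    (DGFunctor.whiskerLeft S F).map (x := x) (y := y) (tmul h a c) = tmul h a (F.map c) := by
  simp only [tlift_tmul, LinearMap.compl₂_apply]

lemma whiskerLeft_map_inlMap (S : DGCat k) {B B' : DGCat k} (F : DGFunctor B' B) (b : B'.Obj)
    {s s' : S.Obj} {i : ℤ} (a : (S.Hom s s').X i) :
    (DGFunctor.whiskerLeft S F).map (x := (s, b)) (y := (s', b)) (DGFunctor.inlMap S B' b i a) =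
      DGFunctor.inlMap S B (F.obj b) i a := by
  refine (whiskerLeft_map_tmul S F (x := (s, b)) (y := (s', b)) _ a (B'.one b)).trans ?_
  rw [F.map_one]
  rfl

/-- Tensor products are compatible with restriction in the spectator variable. -/
def tensorPullback : tensorOver X (G.pullback (DGFunctor.whiskerLeft S F)) ⟶
    (tensorOver X G).pullback F :=
  mkHom (M := tensorOver X (G.pullback (DGFunctor.whiskerLeft S F)))
    (N := (tensorOver X G).pullback F)
    -- The underlying complexes coincide, so the map is induced by identities; only the two
    -- `S`-actions have to be matched, and `F` preserves identities.
    (fun b n => spectatorMap X (G := G.pullback (DGFunctor.whiskerLeft S F)) (G' := G) (b := b)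
      (b' := F.obj b) (fun _ _ => LinearMap.id) (fun {s s' _ _ _} h a g =>
        congrArg (fun t => G.act (x := (s', F.obj b)) (y := (s, F.obj b)) h t g)
          (whiskerLeft_map_inlMap S F b a)) n)
    (fun b n (t : TensorX X (G.pullback (DGFunctor.whiskerLeft S F)) b n) =>
      ((congrArg (spectatorMap X _ _ (n + 1)) (LinearMap.congr_fun (tensorOver_dif X _ b n) t)).trans
        (spectatorMap_dif X (G := G.pullback (DGFunctor.whiskerLeft S F)) (G' := G) (b := b)
          (b' := F.obj b) (fun _ _ => LinearMap.id) _ (fun _ _ _ => rfl) n t)).trans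
        (LinearMap.congr_fun (tensorOver_dif X G (F.obj b) n) _).symm)
    (fun {b b' i j n} h c (t : TensorX X (G.pullback (DGFunctor.whiskerLeft S F)) b j) => by
      change spectatorMap X _ _ n (tensorAct X _ h c t) =
        tensorAct X G h (F.map c) (spectatorMap X _ _ j t)
      induction t using tm_induction with
      | h0 => simp only [map_zero]
      | hadd t t' h₁ h₂ => simp only [map_add, h₁, h₂]
      | H s p q h' x g =>
      rw [tensorAct_tm X _ h s h' rfl, map_smul, spectatorMap_tm, spectatorMap_tm,
        tensorAct_tm X G h s h' rfl]
      exact congrArg (fun t => sgn k (i * p) • tm X G (F.obj b') s _ x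
        (G.act (x := (s, F.obj b)) (y := (s, F.obj b')) rfl t g))
        (whiskerLeft_map_tmul S F (x := (s, b)) (y := (s, b')) (zero_add i) (S.one s) c))

lemma tensorPullback_bijective (b : B'.Obj) (n : ℤ) :
    Function.Bijective (Hom.ap (tensorPullback X G F) b n) :=
  spectatorMap_bijective X (G := G.pullback (DGFunctor.whiskerLeft S F)) (G' := G) (b := b)
      (b' := F.obj b) (fun _ _ => LinearMap.id) (fun {s s' _ _ _} h a g =>
        congrArg (fun t => G.act (x := (s', F.obj b)) (y := (s, F.obj b)) h t g)
          (whiskerLeft_map_inlMap S F b a)) (fun _ _ => LinearMap.id) (fun _ _ _ => rfl) (fun _ _ _ => rfl) n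

end PullbackTensor

end DGMod

end

end DG

/-! ### Iterated tensor products -/

namespace DG

noncomputable section

variable {k : Type u} [CommRing k]

namespace DGMod

section IteratedTensor

variable {S₁ S₂ B : DGCat k} (X : DGMod S₁.op) (Y : DGMod S₂.op)
  (G : DGMod (S₂.tensor (S₁.tensor B)))

/-- The class of `x ⊗ w` in `X ⊗ (Y ⊗ G)`. -/
def tmOuter (b : B.Obj) (s : S₁.Obj) {p m n : ℤ} (h : p + m = n) :
    (X.obj s).X p →ₗ[k] TensorX Y G (s, b) m →ₗ[k] TensorX X (tensorOver Y G) b n :=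
  tm X (tensorOver Y G) b s h

/-- Here and below the inner argument is typed as an element of `TensorX Y G` rather than of the
complex `tensorOver Y G`, so that the rules for the inner tensor product can be applied to it. -/
lemma tmOuter_rel {b : B.Obj} {s s' : S₁.Obj} {i p m ip im n : ℤ} (hip : i + p = ip)
    (him : i + m = im) (h : ip + m = n) (h' : p + im = n) (a : (S₁.Hom s' s).X i)
    (x : (X.obj s).X p) (w : TensorX Y G (s', b) m) :
    tmOuter X Y G b s' h (X.act (x := s) (y := s') hip a x) w = sgn k (i * p) •
      tmOuter X Y G b s h' x (tensorAct Y G (b := (s', b)) (b' := (s, b)) him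
        (DGFunctor.inlMap S₁ B b i a) w) :=
  tm_rel (G := tensorOver Y G) hip him h h' a x w

lemma tensorDif_tmOuter {b : B.Obj} {s : S₁.Obj} {p m n : ℤ} (h : p + m = n) (x : (X.obj s).X p)
    (w : TensorX Y G (s, b) m) :
    tensorDif X (tensorOver Y G) b n (tmOuter X Y G b s h x w) =
      tmOuter X Y G b s (show p + 1 + m = n + 1 by omega) (dif (X.obj s) p x) w +
      sgn k p • tmOuter X Y G b s (show p + (m + 1) = n + 1 by omega) x
        (tensorDif Y G (s, b) m w) := by
  refine (tensorDif_tm (G := tensorOver Y G) h x w).trans ?_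
  exact congrArg (fun t : TensorX Y G (s, b) (m + 1) =>
    tmOuter X Y G b s (show p + 1 + m = n + 1 by omega) (dif (X.obj s) p x) w +
      sgn k p • tmOuter X Y G b s (show p + (m + 1) = n + 1 by omega) x t)
    (LinearMap.congr_fun (tensorOver_dif Y G (s, b) m) w)

lemma tensorAct_tmOuter {b b' : B.Obj} {j l n p m jm : ℤ} (hn : j + l = n) (s : S₁.Obj)
    (h : p + m = l) (hj : j + m = jm) (c : (B.Hom b b').X j) (x : (X.obj s).X p)
    (w : TensorX Y G (s, b) m) :
    tensorAct X (tensorOver Y G) hn c (tmOuter X Y G b s h x w) = sgn k (j * p) •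
      tmOuter X Y G b' s (by omega) x (tensorAct Y G (b := (s, b)) (b' := (s, b')) hj
        (DGFunctor.inrMap S₁ B s j c) w) :=
  tensorAct_tm X (tensorOver Y G) hn s h hj c x w

/-- The class of `x ⊗ (y ⊗ g)` in `X ⊗ (Y ⊗ G)`. -/
def tm₂ (b : B.Obj) (s₁ : S₁.Obj) (s₂ : S₂.Obj) {p p' q n : ℤ} (h : p + p' + q = n) :
    (X.obj s₁).X p →ₗ[k] (Y.obj s₂).X p' →ₗ[k] (G.obj (s₂, (s₁, b))).X q →ₗ[k]
      TensorX X (tensorOver Y G) b n :=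
  LinearMap.mk₂ k (fun x y => tmOuter X Y G b s₁ (show p + (p' + q) = n by omega) x ∘ₗ
      tm Y G (s₁, b) s₂ rfl y)
    (fun _ _ _ => by ext; simp only [map_add, LinearMap.add_apply, LinearMap.comp_apply])
    (fun _ _ _ => by ext; simp only [map_smul, LinearMap.smul_apply, LinearMap.comp_apply])
    (fun _ _ _ => by ext; simp only [map_add, LinearMap.add_apply, LinearMap.comp_apply])
    (fun _ _ _ => by ext; simp only [map_smul, LinearMap.smul_apply, LinearMap.comp_apply])

lemma tmOuter_tm {b : B.Obj} {s₁ : S₁.Obj} {s₂ : S₂.Obj} {p p' q m n : ℤ} (h : p + m = n)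
    (h' : p' + q = m) (x : (X.obj s₁).X p) (y : (Y.obj s₂).X p')
    (g : (G.obj (s₂, (s₁, b))).X q) :
    tmOuter X Y G b s₁ h x (tm Y G (s₁, b) s₂ h' y g) =
      tm₂ X Y G b s₁ s₂ (show p + p' + q = n by omega) x y g := by
  subst h'
  rfl

variable {X Y G}

/-- The element `a` has to pass both `x` and `y` to reach `g`, hence the product of two signs. -/
lemma tm₂_rel_left {b : B.Obj} {s s' : S₁.Obj} {s₂ : S₂.Obj} {i p p' q ip iq n : ℤ}
    (hip : i + p = ip) (hiq : i + q = iq) (h : ip + p' + q = n) (h' : p + p' + iq = n)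
    (a : (S₁.Hom s' s).X i) (x : (X.obj s).X p) (y : (Y.obj s₂).X p')
    (g : (G.obj (s₂, (s', b))).X q) :
    tm₂ X Y G b s' s₂ h (X.act (x := s) (y := s') hip a x) y g =
      (sgn k (i * p) * sgn k (i * p')) • tm₂ X Y G b s s₂ h' x y
        (G.act (x := (s₂, (s', b))) (y := (s₂, (s, b))) hiq
          (DGFunctor.inrMap S₂ (S₁.tensor B) s₂ (x := (s', b)) (y := (s, b)) i
            (DGFunctor.inlMap S₁ B b i a)) g) := by
  rw [← tmOuter_tm X Y G (show ip + (p' + q) = n by omega) rfl,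
    tmOuter_rel X Y G hip (show i + (p' + q) = p' + iq by omega) _
      (show p + (p' + iq) = n by omega),
    tensorAct_tm Y G (b := (s', b)) (b' := (s, b)) _ s₂ rfl hiq, map_smul, smul_smul, tmOuter_tm]

lemma tm₂_rel_right {b : B.Obj} {s₁ : S₁.Obj} {s s' : S₂.Obj} {i p p' q ip iq n : ℤ}
    (hip : i + p' = ip) (hiq : i + q = iq) (h : p + ip + q = n) (h' : p + p' + iq = n)
    (a : (S₂.Hom s' s).X i) (x : (X.obj s₁).X p) (y : (Y.obj s).X p')
    (g : (G.obj (s', (s₁, b))).X q) :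
    tm₂ X Y G b s₁ s' h x (Y.act (x := s) (y := s') hip a y) g =
      sgn k (i * p') • tm₂ X Y G b s₁ s h' x y
        (G.act (x := (s', (s₁, b))) (y := (s, (s₁, b))) hiq
          (DGFunctor.inlMap S₂ (S₁.tensor B) (s₁, b) i a) g) := by
  rw [← tmOuter_tm X Y G (show p + (ip + q) = n by omega) rfl]
  have := congrArg (tmOuter X Y G b s₁ (show p + (ip + q) = n by omega) x)
    (tm_rel (X := Y) (G := G) (b := (s₁, b)) hip hiq rfl (show p' + iq = ip + q by omega) a y g)
  rwa [map_smul, tmOuter_tm X Y G _ (show p' + iq = ip + q by omega)] at this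

lemma tensorDif_tm₂ {b : B.Obj} {s₁ : S₁.Obj} {s₂ : S₂.Obj} {p p' q n : ℤ} (h : p + p' + q = n)
    (x : (X.obj s₁).X p) (y : (Y.obj s₂).X p') (g : (G.obj (s₂, (s₁, b))).X q) :
    tensorDif X (tensorOver Y G) b n (tm₂ X Y G b s₁ s₂ h x y g) =
      tm₂ X Y G b s₁ s₂ (show p + 1 + p' + q = n + 1 by omega) (dif (X.obj s₁) p x) y g +
      sgn k p • tm₂ X Y G b s₁ s₂ (show p + (p' + 1) + q = n + 1 by omega) x
        (dif (Y.obj s₂) p' y) g +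
      (sgn k p * sgn k p') • tm₂ X Y G b s₁ s₂ (show p + p' + (q + 1) = n + 1 by omega) x y
        (dif (G.obj (s₂, (s₁, b))) q g) := by
  rw [← tmOuter_tm X Y G (show p + (p' + q) = n by omega) rfl, tensorDif_tmOuter, tmOuter_tm,
    tensorDif_tm, map_add, map_smul, tmOuter_tm, tmOuter_tm, smul_add, smul_smul]
  exact (add_assoc _ _ _).symm

lemma tensorAct_tm₂ {b b' : B.Obj} {j l n p p' q jq : ℤ} (hn : j + l = n) (s₁ : S₁.Obj)
    (s₂ : S₂.Obj) (h : p + p' + q = l) (hj : j + q = jq) (c : (B.Hom b b').X j)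
    (x : (X.obj s₁).X p) (y : (Y.obj s₂).X p') (g : (G.obj (s₂, (s₁, b))).X q) :
    tensorAct X (tensorOver Y G) hn c (tm₂ X Y G b s₁ s₂ h x y g) =
      (sgn k (j * p) * sgn k (j * p')) • tm₂ X Y G b' s₁ s₂ (by omega) x y
        (G.act (x := (s₂, (s₁, b))) (y := (s₂, (s₁, b'))) hj
          (DGFunctor.inrMap S₂ (S₁.tensor B) s₂ (x := (s₁, b)) (y := (s₁, b')) j
            (DGFunctor.inrMap S₁ B s₁ j c)) g) := by
  rw [← tmOuter_tm X Y G (show p + (p' + q) = l by omega) rfl,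
    tensorAct_tmOuter X Y G hn s₁ _ (show j + (p' + q) = p' + jq by omega),
    tensorAct_tm Y G (b := (s₁, b)) (b' := (s₁, b')) _ s₂ rfl hj, map_smul, smul_smul, tmOuter_tm]

lemma tm₂_ext {b : B.Obj} {n : ℤ} {V : Type u} [AddCommGroup V] [Module k V]
    {f g : TensorX X (tensorOver Y G) b n →ₗ[k] V}
    (H : ∀ s₁ s₂ p p' q (h : p + p' + q = n) (x : (X.obj s₁).X p) (y : (Y.obj s₂).X p')
      (z : (G.obj (s₂, (s₁, b))).X q),
      f (tm₂ X Y G b s₁ s₂ h x y z) = g (tm₂ X Y G b s₁ s₂ h x y z)) : f = g := by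
  refine tm_ext fun s₁ p m h x (w : TensorX Y G (s₁, b) m) => ?_
  have : f ∘ₗ tmOuter X Y G b s₁ h x = g ∘ₗ tmOuter X Y G b s₁ h x :=
    tm_ext fun s₂ p' q h' y z => by
      rw [LinearMap.comp_apply, LinearMap.comp_apply, tmOuter_tm]
      exact H s₁ s₂ p p' q _ x y z
  exact LinearMap.congr_fun this w

/-- A map out of `X ⊗ (Y ⊗ G)` is lifted first over `Y ⊗ G` with `x` as a parameter; this lift must
be linear in `x` before the outer one can be formed. -/
lemma tmLift_add {S B : DGCat k} {X : DGMod S.op} {G : DGMod (S.tensor B)} {b : B.Obj} {n : ℤ}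
    {V : Type u} [AddCommGroup V] [Module k V]
    (φ ψ χ : ∀ s (p q : ℤ), p + q = n → ((X.obj s).X p →ₗ[k] (G.obj (s, b)).X q →ₗ[k] V))
    (hφ) (hψ) (hχ) (H : ∀ s p q h, χ s p q h = φ s p q h + ψ s p q h) :
    tmLift (X := X) (G := G) (b := b) χ hχ = tmLift φ hφ + tmLift ψ hψ :=
  tm_ext fun s p q h x g => by
    rw [LinearMap.add_apply, tmLift_tm, tmLift_tm, tmLift_tm, H]
    rfl

lemma tmLift_smul {S B : DGCat k} {X : DGMod S.op} {G : DGMod (S.tensor B)} {b : B.Obj} {n : ℤ}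
    {V : Type u} [AddCommGroup V] [Module k V] (r : k)
    (φ χ : ∀ s (p q : ℤ), p + q = n → ((X.obj s).X p →ₗ[k] (G.obj (s, b)).X q →ₗ[k] V))
    (hφ) (hχ) (H : ∀ s p q h, χ s p q h = r • φ s p q h) :
    tmLift (X := X) (G := G) (b := b) χ hχ = r • tmLift φ hφ :=
  tm_ext fun s p q h x g => by
    rw [LinearMap.smul_apply, tmLift_tm, tmLift_tm, H]
    rfl

/-- Linear maps out of `V ⊗ (X ⊗ G)`, for a module `V`. -/
def tmLiftParam {S B : DGCat k} {X : DGMod S.op} {G : DGMod (S.tensor B)} {b : B.Obj} {n : ℤ}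
    {V W : Type u} [AddCommGroup V] [Module k V] [AddCommGroup W] [Module k W]
    (φ : W →  ∀ s (p q : ℤ), p + q = n → ((X.obj s).X p →ₗ[k] (G.obj (s, b)).X q →ₗ[k] V))
    (hφ : ∀ w, ∀ {s s' : S.Obj} {i p q ip iq : ℤ} (hip : i + p = ip)
      (hiq : i + q = iq) (h : ip + q = n) (h' : p + iq = n) (a : (S.Hom s' s).X i)
      (x : (X.obj s).X p) (g : (G.obj (s', b)).X q),
      φ w s' ip q h (X.act (x := s) (y := s') hip a x) g = sgn k (i * p) • φ w s p iq h' x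
        (G.act (x := (s', b)) (y := (s, b)) hiq (DGFunctor.inlMap S B b i a) g))
    (hadd : ∀ w w' s p q h, φ (w + w') s p q h = φ w s p q h + φ w' s p q h)
    (hsmul : ∀ (r : k) w s p q h, φ (r • w) s p q h = r • φ w s p q h) :
    W →ₗ[k] TensorX X G b n →ₗ[k] V where
  toFun w := tmLift (φ w) (hφ w)
  map_add' w w' := tmLift_add _ _ _ _ _ _ (hadd w w')
  map_smul' r w := tmLift_smul r _ _ _ _ (hsmul r w)

lemma tmLiftParam_tm {S B : DGCat k} {X : DGMod S.op} {G : DGMod (S.tensor B)} {b : B.Obj} {n : ℤ}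
    {V W : Type u} [AddCommGroup V] [Module k V] [AddCommGroup W] [Module k W]
    (φ : W →  ∀ s (p q : ℤ), p + q = n → ((X.obj s).X p →ₗ[k] (G.obj (s, b)).X q →ₗ[k] V))
    (hφ) (hadd) (hsmul) (w : W) (s : S.Obj) {p q : ℤ} (h : p + q = n) (x : (X.obj s).X p)
    (g : (G.obj (s, b)).X q) :
    tmLiftParam (X := X) φ hφ hadd hsmul w (tm X G b s h x g) = φ w s p q h x g :=
  tmLift_tm (φ w) (hφ w) s h x g

/-- The linear map `w ↦ φ(x, w)` on `Y ⊗ G` which enters into `tmLift₂`. -/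
def tmLiftInner {b : B.Obj} {n : ℤ} {V : Type u} [AddCommGroup V] [Module k V]
    (φ : ∀ s₁ s₂ (p p' q : ℤ), p + p' + q = n →
      ((X.obj s₁).X p →ₗ[k] (Y.obj s₂).X p' →ₗ[k] (G.obj (s₂, (s₁, b))).X q →ₗ[k] V))
    (h₂ : ∀ {s₁ : S₁.Obj} {s s' : S₂.Obj} {i p p' q ip iq : ℤ}
      (hip : i + p' = ip) (hiq : i + q = iq) (h : p + ip + q = n) (h' : p + p' + iq = n)
      (a : (S₂.Hom s' s).X i) (x : (X.obj s₁).X p) (y : (Y.obj s).X p')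
      (g : (G.obj (s', (s₁, b))).X q),
      φ s₁ s' p ip q h x (Y.act (x := s) (y := s') hip a y) g = sgn k (i * p') •
        φ s₁ s p p' iq h' x y (G.act (x := (s', (s₁, b))) (y := (s, (s₁, b))) hiq
          (DGFunctor.inlMap S₂ (S₁.tensor B) (s₁, b) i a) g))
    (s₁ : S₁.Obj) {p m : ℤ} (h : p + m = n) :
    (X.obj s₁).X p →ₗ[k] TensorX Y G (s₁, b) m →ₗ[k] V :=
  tmLiftParam (X := Y) (G := G) (b := (s₁, b)) (n := m)
      (W := (X.obj s₁).X p) (fun x s₂ p' q h' => φ s₁ s₂ p p' q (by omega) x)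
      (fun x _ _ _ _ _ _ _ hip hiq _ _ a y g => h₂ hip hiq (by omega) (by omega) a x y g)
      (fun _ _ _ _ _ _ => map_add _ _ _) (fun _ _ _ _ _ _ => map_smul _ _ _)

lemma tmLiftInner_tm {b : B.Obj} {n : ℤ} {V : Type u} [AddCommGroup V] [Module k V]
    (φ : ∀ s₁ s₂ (p p' q : ℤ), p + p' + q = n →
      ((X.obj s₁).X p →ₗ[k] (Y.obj s₂).X p' →ₗ[k] (G.obj (s₂, (s₁, b))).X q →ₗ[k] V))
    (h₂) (s₁ : S₁.Obj) {p m : ℤ} (h : p + m = n) (x : (X.obj s₁).X p) (s₂ : S₂.Obj) {p' q : ℤ}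
    (h' : p' + q = m) (y : (Y.obj s₂).X p') (g : (G.obj (s₂, (s₁, b))).X q) :
    tmLiftInner (X := X) (Y := Y) (G := G) φ h₂ s₁ h x (tm Y G (s₁, b) s₂ h' y g) =
      φ s₁ s₂ p p' q (by omega) x y g :=
  tmLiftParam_tm (X := Y) (G := G) (b := (s₁, b)) _ _ _ _ x s₂ h' y g

/-- The balancing condition over `S₁`, given on tensors `y ⊗ g`, extends to all of `Y ⊗ G`; it is
what the outer lift requires. -/
lemma tmLiftInner_rel {b : B.Obj} {n : ℤ} {V : Type u} [AddCommGroup V] [Module k V]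
    (φ : ∀ s₁ s₂ (p p' q : ℤ), p + p' + q = n →
      ((X.obj s₁).X p →ₗ[k] (Y.obj s₂).X p' →ₗ[k] (G.obj (s₂, (s₁, b))).X q →ₗ[k] V))
    (h₁ : ∀ {s s' : S₁.Obj} {s₂ : S₂.Obj} {i p p' q ip iq : ℤ}
      (hip : i + p = ip) (hiq : i + q = iq) (h : ip + p' + q = n) (h' : p + p' + iq = n)
      (a : (S₁.Hom s' s).X i) (x : (X.obj s).X p) (y : (Y.obj s₂).X p')
      (g : (G.obj (s₂, (s', b))).X q),
      φ s' s₂ ip p' q h (X.act (x := s) (y := s') hip a x) y g =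
        (sgn k (i * p) * sgn k (i * p')) • φ s s₂ p p' iq h' x y
          (G.act (x := (s₂, (s', b))) (y := (s₂, (s, b))) hiq
            (DGFunctor.inrMap S₂ (S₁.tensor B) s₂ (x := (s', b)) (y := (s, b)) i
              (DGFunctor.inlMap S₁ B b i a)) g))
    (h₂) {s s' : S₁.Obj} {i p m ip im : ℤ} (hip : i + p = ip) (him : i + m = im)
    (h : ip + m = n) (h' : p + im = n) (a : (S₁.Hom s' s).X i) (x : (X.obj s).X p)
    (w : TensorX Y G (s', b) m) :
    tmLiftInner φ h₂ s' h (X.act (x := s) (y := s') hip a x) w =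
      sgn k (i * p) • tmLiftInner φ h₂ s h' x (tensorAct Y G (b := (s', b)) (b' := (s, b)) him
        (DGFunctor.inlMap S₁ B b i a) w) := by
  induction w using tm_induction with
  | h0 => simp only [map_zero, smul_zero]
  | hadd w w' e₁ e₂ => simp only [map_add, smul_add, e₁, e₂]
  | H s₂ p' q hw y g =>
  rw [tensorAct_tm Y G (b := (s', b)) (b' := (s, b)) _ s₂ hw rfl, map_smul, tmLiftInner_tm,
    tmLiftInner_tm, h₁ hip rfl _ (show p + p' + (i + q) = n by omega), smul_smul]

/-- Linear maps out of `X ⊗ (Y ⊗ G)`. -/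
def tmLift₂ {b : B.Obj} {n : ℤ} {V : Type u} [AddCommGroup V] [Module k V]
    (φ : ∀ s₁ s₂ (p p' q : ℤ), p + p' + q = n →
      ((X.obj s₁).X p →ₗ[k] (Y.obj s₂).X p' →ₗ[k] (G.obj (s₂, (s₁, b))).X q →ₗ[k] V))
    (h₁ : ∀ {s s' : S₁.Obj} {s₂ : S₂.Obj} {i p p' q ip iq : ℤ}
      (hip : i + p = ip) (hiq : i + q = iq) (h : ip + p' + q = n) (h' : p + p' + iq = n)
      (a : (S₁.Hom s' s).X i) (x : (X.obj s).X p) (y : (Y.obj s₂).X p')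
      (g : (G.obj (s₂, (s', b))).X q),
      φ s' s₂ ip p' q h (X.act (x := s) (y := s') hip a x) y g =
        (sgn k (i * p) * sgn k (i * p')) • φ s s₂ p p' iq h' x y
          (G.act (x := (s₂, (s', b))) (y := (s₂, (s, b))) hiq
            (DGFunctor.inrMap S₂ (S₁.tensor B) s₂ (x := (s', b)) (y := (s, b)) i
              (DGFunctor.inlMap S₁ B b i a)) g))
    (h₂ : ∀ {s₁ : S₁.Obj} {s s' : S₂.Obj} {i p p' q ip iq : ℤ}
      (hip : i + p' = ip) (hiq : i + q = iq) (h : p + ip + q = n) (h' : p + p' + iq = n)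
      (a : (S₂.Hom s' s).X i) (x : (X.obj s₁).X p) (y : (Y.obj s).X p')
      (g : (G.obj (s', (s₁, b))).X q),
      φ s₁ s' p ip q h x (Y.act (x := s) (y := s') hip a y) g = sgn k (i * p') •
        φ s₁ s p p' iq h' x y (G.act (x := (s', (s₁, b))) (y := (s, (s₁, b))) hiq
          (DGFunctor.inlMap S₂ (S₁.tensor B) (s₁, b) i a) g)) :
    TensorX X (tensorOver Y G) b n →ₗ[k] V :=
  tmLift (G := tensorOver Y G) (fun s₁ _ _ h => tmLiftInner φ h₂ s₁ h)
    (fun hip him h h' a x w => tmLiftInner_rel φ h₁ h₂ hip him h h' a x w)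

lemma tmLift₂_tm₂ {b : B.Obj} {n : ℤ} {V : Type u} [AddCommGroup V] [Module k V]
    (φ : ∀ s₁ s₂ (p p' q : ℤ), p + p' + q = n →
      ((X.obj s₁).X p →ₗ[k] (Y.obj s₂).X p' →ₗ[k] (G.obj (s₂, (s₁, b))).X q →ₗ[k] V))
    (h₁) (h₂) {s₁ : S₁.Obj} {s₂ : S₂.Obj} {p p' q : ℤ} (h : p + p' + q = n)
    (x : (X.obj s₁).X p) (y : (Y.obj s₂).X p') (g : (G.obj (s₂, (s₁, b))).X q) :
    tmLift₂ (X := X) (Y := Y) (G := G) φ h₁ h₂ (tm₂ X Y G b s₁ s₂ h x y g) =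
      φ s₁ s₂ p p' q h x y g := by
  rw [← tmOuter_tm X Y G (show p + (p' + q) = n by omega) rfl]
  exact (tmLift_tm (G := tensorOver Y G) _ _ s₁ _ x
    (tm Y G (s₁, b) s₂ rfl y g : TensorX Y G (s₁, b) (p' + q))).trans
    (tmLiftInner_tm φ h₂ s₁ _ x s₂ rfl y g)

end IteratedTensor

end DGMod

end

end DG

/-! ### Interchanging two tensor products -/

namespace DG

noncomputable section

variable {k : Type u} [CommRing k]

namespace DGMod

section Interchange

variable {S₁ S₂ B : DGCat k}

/-- An identification of an `S₁ ⊗ (S₂ ⊗ B)`-module with an `S₂ ⊗ (S₁ ⊗ B)`-module. -/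
structure Interchange (G : DGMod (S₁.tensor (S₂.tensor B)))
    (G' : DGMod (S₂.tensor (S₁.tensor B))) where
  equiv : ∀ (s₁ : S₁.Obj) (s₂ : S₂.Obj) (b : B.Obj) (q : ℤ),
    (G.obj (s₁, (s₂, b))).X q ≃ₗ[k] (G'.obj (s₂, (s₁, b))).X q
  equiv_dif : ∀ s₁ s₂ b q g, equiv s₁ s₂ b (q + 1) (dif (G.obj (s₁, (s₂, b))) q g) =
    dif (G'.obj (s₂, (s₁, b))) q (equiv s₁ s₂ b q g)
  equiv_left : ∀ {s s' : S₁.Obj} (s₂ : S₂.Obj) (b : B.Obj) {i q n : ℤ} (h : i + q = n)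
    (a : (S₁.Hom s s').X i) (g : (G.obj (s, (s₂, b))).X q),
    equiv s' s₂ b n (G.act (x := (s, (s₂, b))) (y := (s', (s₂, b))) h
        (DGFunctor.inlMap S₁ (S₂.tensor B) (s₂, b) i a) g) =
      G'.act (x := (s₂, (s, b))) (y := (s₂, (s', b))) h
        (DGFunctor.inrMap S₂ (S₁.tensor B) s₂ (x := (s, b)) (y := (s', b)) i
          (DGFunctor.inlMap S₁ B b i a)) (equiv s s₂ b q g)
  equiv_right : ∀ (s₁ : S₁.Obj) {s s' : S₂.Obj} (b : B.Obj) {i q n : ℤ} (h : i + q = n)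
    (a : (S₂.Hom s s').X i) (g : (G.obj (s₁, (s, b))).X q),
    equiv s₁ s' b n (G.act (x := (s₁, (s, b))) (y := (s₁, (s', b))) h
        (DGFunctor.inrMap S₁ (S₂.tensor B) s₁ (x := (s, b)) (y := (s', b)) i
          (DGFunctor.inlMap S₂ B b i a)) g) =
      G'.act (x := (s, (s₁, b))) (y := (s', (s₁, b))) h
        (DGFunctor.inlMap S₂ (S₁.tensor B) (s₁, b) i a) (equiv s₁ s b q g)
  equiv_spectator : ∀ (s₁ : S₁.Obj) (s₂ : S₂.Obj) {b b' : B.Obj} {i q n : ℤ} (h : i + q = n)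
    (c : (B.Hom b b').X i) (g : (G.obj (s₁, (s₂, b))).X q),
    equiv s₁ s₂ b' n (G.act (x := (s₁, (s₂, b))) (y := (s₁, (s₂, b'))) h
        (DGFunctor.inrMap S₁ (S₂.tensor B) s₁ (x := (s₂, b)) (y := (s₂, b')) i
          (DGFunctor.inrMap S₂ B s₂ i c)) g) =
      G'.act (x := (s₂, (s₁, b))) (y := (s₂, (s₁, b'))) h
        (DGFunctor.inrMap S₂ (S₁.tensor B) s₂ (x := (s₁, b)) (y := (s₁, b')) i
          (DGFunctor.inrMap S₁ B s₁ i c)) (equiv s₁ s₂ b q g)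

namespace Interchange

variable {G : DGMod (S₁.tensor (S₂.tensor B))} {G' : DGMod (S₂.tensor (S₁.tensor B))}
  (I : Interchange G G')

/-- The inverse identification. -/
def symm : Interchange G' G where
  equiv s₂ s₁ b q := (I.equiv s₁ s₂ b q).symm
  equiv_dif s₂ s₁ b q g := by
    rw [LinearEquiv.symm_apply_eq, I.equiv_dif, LinearEquiv.apply_symm_apply]
  equiv_left s₁ b _ _ _ h a g := by
    rw [LinearEquiv.symm_apply_eq, I.equiv_right, LinearEquiv.apply_symm_apply]
  equiv_right s₂ _ _ b _ _ _ h a g := by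
    rw [LinearEquiv.symm_apply_eq, I.equiv_left, LinearEquiv.apply_symm_apply]
  equiv_spectator s₂ s₁ _ _ _ _ _ h c g := by
    rw [LinearEquiv.symm_apply_eq, I.equiv_spectator, LinearEquiv.apply_symm_apply]

variable (X : DGMod S₁.op) (Y : DGMod S₂.op)

/-- The trilinear map `(y, x, g) ↦ (-1)^(|y||x|) x ⊗ (y ⊗ g)`. -/
def trilinear (b : B.Obj) (s₂ : S₂.Obj) (s₁ : S₁.Obj) {p p' q n : ℤ} (h : p + p' + q = n) :
    (Y.obj s₂).X p →ₗ[k] (X.obj s₁).X p' →ₗ[k] (G.obj (s₁, (s₂, b))).X q →ₗ[k]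
      TensorX X (tensorOver Y G') b n :=
  LinearMap.mk₂ k (fun y x => sgn k (p * p') •
      (tm₂ X Y G' b s₁ s₂ (show p' + p + q = n by omega) x y ∘ₗ
        (I.equiv s₁ s₂ b q).toLinearMap))
    (fun _ _ _ => by rw [map_add, LinearMap.add_comp, smul_add])
    (fun _ _ _ => by rw [map_smul, LinearMap.smul_comp, smul_comm])
    (fun _ _ _ => by rw [map_add, LinearMap.add_apply, LinearMap.add_comp, smul_add])
    (fun _ _ _ => by rw [map_smul, LinearMap.smul_apply, LinearMap.smul_comp, smul_comm])

lemma trilinear_apply (b : B.Obj) (s₂ : S₂.Obj) (s₁ : S₁.Obj) {p p' q n : ℤ}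
    (h : p + p' + q = n) (y : (Y.obj s₂).X p) (x : (X.obj s₁).X p')
    (g : (G.obj (s₁, (s₂, b))).X q) :
    I.trilinear X Y b s₂ s₁ h y x g = sgn k (p * p') •
      tm₂ X Y G' b s₁ s₂ (show p' + p + q = n by omega) x y (I.equiv s₁ s₂ b q g) := rfl

/-- The underlying linear maps of `Interchange.hom`. -/
def map (b : B.Obj) (n : ℤ) :
    TensorX Y (tensorOver X G) b n →ₗ[k] TensorX X (tensorOver Y G') b n :=
  tmLift₂ (X := Y) (Y := X) (fun s₂ s₁ _ _ _ h => I.trilinear X Y b s₂ s₁ h)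
    (by
      intro s s' s₂ i p p' q ip iq hip hiq h h' a y x g
      rw [trilinear_apply, trilinear_apply, I.equiv_right,
        tm₂_rel_right hip hiq _ (show p' + p + iq = n by omega), smul_smul, smul_smul]
      congr 1
      rw [← hip, add_mul, sgn_add]
      ring)
    (by
      intro s s' s₂ i p p' q ip iq hip hiq h h' a y x g
      rw [trilinear_apply, trilinear_apply, I.equiv_left,
        tm₂_rel_left hip hiq _ (show p' + p + iq = n by omega), smul_smul, smul_smul]
      congr 1
      rw [← hip, mul_add, sgn_add, mul_comm p i]
      linear_combination sgn k (p * p') * sgn k (i * p') * sgn_mul_self (k := k) (i * p))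

lemma map_tm₂ (b : B.Obj) (s₂ : S₂.Obj) (s₁ : S₁.Obj) {p p' q n : ℤ} (h : p + p' + q = n)
    (y : (Y.obj s₂).X p) (x : (X.obj s₁).X p') (g : (G.obj (s₁, (s₂, b))).X q) :
    I.map X Y b n (tm₂ Y X G b s₂ s₁ h y x g) = sgn k (p * p') •
      tm₂ X Y G' b s₁ s₂ (show p' + p + q = n by omega) x y (I.equiv s₁ s₂ b q g) :=
  (tmLift₂_tm₂ _ _ _ h y x g).trans (I.trilinear_apply X Y b s₂ s₁ h y x g)

/-- The two interchanges contribute the same Koszul sign `(-1)^(|x||y|)`, whose square is one. -/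
lemma map_symm_map (b : B.Obj) (n : ℤ) (t : TensorX Y (tensorOver X G) b n) :
    I.symm.map Y X b n (I.map X Y b n t) = t := by
  have : I.symm.map Y X b n ∘ₗ I.map X Y b n = LinearMap.id :=
    tm₂_ext fun s₂ s₁ p p' q h y x g => by
      rw [LinearMap.comp_apply, map_tm₂, map_smul, map_tm₂, smul_smul, mul_comm p' p,
        sgn_mul_self, one_smul]
      exact congrArg _ ((I.equiv s₁ s₂ b q).symm_apply_apply g)
  exact LinearMap.congr_fun this t

lemma map_bijective (b : B.Obj) (n : ℤ) : Function.Bijective (I.map X Y b n) :=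
  Function.bijective_iff_has_inverse.mpr ⟨I.symm.map Y X b n, I.map_symm_map X Y b n,
    I.symm.map_symm_map Y X b n⟩

lemma map_dif (b : B.Obj) (n : ℤ) (t : TensorX Y (tensorOver X G) b n) :
    I.map X Y b (n + 1) (tensorDif Y (tensorOver X G) b n t) =
      tensorDif X (tensorOver Y G') b n (I.map X Y b n t) := by
  have : I.map X Y b (n + 1) ∘ₗ tensorDif Y (tensorOver X G) b n =
      tensorDif X (tensorOver Y G') b n ∘ₗ I.map X Y b n :=
    tm₂_ext fun s₂ s₁ p p' q h y x g => by
      rw [LinearMap.comp_apply, LinearMap.comp_apply, tensorDif_tm₂, map_add, map_add, map_smul,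
        map_smul, map_tm₂, map_tm₂, map_tm₂, map_tm₂, map_smul, tensorDif_tm₂, I.equiv_dif]
      have e₁ : sgn k ((p + 1) * p') = sgn k (p * p') * sgn k p' := by
        rw [add_mul, sgn_add, one_mul]
      have e₂ : sgn k p * sgn k (p * (p' + 1)) = sgn k (p * p') := by
        rw [mul_add, sgn_add, mul_one]
        linear_combination sgn k (p * p') * sgn_mul_self (k := k) p
      rw [smul_smul, smul_smul, e₁, e₂]
      simp only [smul_add, smul_smul]
      match_scalars <;> ring
  exact LinearMap.congr_fun this t

lemma map_act {b b' : B.Obj} {i j n : ℤ} (h : i + j = n) (c : (B.Hom b b').X i)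
    (t : TensorX Y (tensorOver X G) b j) :
    I.map X Y b' n (tensorAct Y (tensorOver X G) h c t) =
      tensorAct X (tensorOver Y G') h c (I.map X Y b j t) := by
  have : I.map X Y b' n ∘ₗ tensorAct Y (tensorOver X G) h c =
      tensorAct X (tensorOver Y G') h c ∘ₗ I.map X Y b j :=
    tm₂_ext fun s₂ s₁ p p' q h' y x g => by
      rw [LinearMap.comp_apply, LinearMap.comp_apply, tensorAct_tm₂ (X := Y) (Y := X) (G := G) h s₂ s₁ h' rfl, map_smul,
        map_tm₂, map_tm₂, map_smul,
        tensorAct_tm₂ (X := X) (Y := Y) (G := G') h s₁ s₂ _ rfl, I.equiv_spectator, smul_smul,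
        smul_smul]
      congr 1
      ring
  exact LinearMap.congr_fun this t

/-- The isomorphism `Y ⊗ (X ⊗ G) → X ⊗ (Y ⊗ G')`. -/
def hom : tensorOver Y (tensorOver X G) ⟶ tensorOver X (tensorOver Y G') :=
  mkHom (M := tensorOver Y (tensorOver X G)) (N := tensorOver X (tensorOver Y G'))
    (fun b n => I.map X Y b n)
    (fun b n (t : TensorX Y (tensorOver X G) b n) =>
      ((congrArg (I.map X Y b (n + 1)) (LinearMap.congr_fun (tensorOver_dif Y _ b n) t)).trans
        (I.map_dif X Y b n t)).trans
        (LinearMap.congr_fun (tensorOver_dif X (tensorOver Y G') b n) _).symm)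
    (fun h c t => I.map_act X Y h c t)

lemma quasiIso_hom : quasiIso B (I.hom X Y) :=
  quasiIso_of_bijective _ fun b n => I.map_bijective X Y b n

-- The morphism `f` acts on the inner factor before the interchange and on the outer one after it;
-- its degree is zero, so the Koszul sign is unchanged.
variable {X} in
lemma hom_naturality {X' : DGMod S₁.op} (f : X ⟶ X') :
    homRight Y (homLeft f G) ≫ I.hom X' Y = I.hom X Y ≫ homLeft f (tensorOver Y G') := by
  refine hom_ext_ap fun b n (t : TensorX Y (tensorOver X G) b n) => ?_
  have : I.map X' Y b n ∘ₗ mapRightFun Y (Hom.toGHom (homLeft f G)) b (add_zero n) =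
      mapLeftFun (tensorOver Y G') (Hom.toGHom f) b (add_zero n) ∘ₗ I.map X Y b n :=
    tm₂_ext fun s₂ s₁ p p' q h y x g => by
      have e₁ : mapRightFun Y (Hom.toGHom (homLeft f G)) b (add_zero n)
          (tm₂ Y X G b s₂ s₁ h y x g) = tm₂ Y X' G b s₂ s₁ h y (Hom.ap f s₁ p' x) g := by
        rw [← tmOuter_tm Y X G (show p + (p' + q) = n by omega) rfl,
          ← tmOuter_tm Y X' G (show p + (p' + q) = n by omega) rfl]
        refine (homRight_ap_tm Y (homLeft f G) b s₂ _ y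
          (tm X G (s₂, b) s₁ rfl x g : TensorX X G (s₂, b) (p' + q))).trans ?_
        exact congrArg (tmOuter Y X' G b s₂ _ y) (homLeft_ap_tm f G (s₂, b) s₁ rfl x g)
      have e₂ : mapLeftFun (tensorOver Y G') (Hom.toGHom f) b (add_zero n)
          (tm₂ X Y G' b s₁ s₂ (show p' + p + q = n by omega) x y (I.equiv s₁ s₂ b q g)) =
          tm₂ X' Y G' b s₁ s₂ (by omega) (Hom.ap f s₁ p' x) y (I.equiv s₁ s₂ b q g) := by
        rw [← tmOuter_tm X Y G' (show p' + (p + q) = n by omega) rfl,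
          ← tmOuter_tm X' Y G' (show p' + (p + q) = n by omega) rfl]
        exact homLeft_ap_tm f (tensorOver Y G') b s₁ _ x
          (tm Y G' (s₁, b) s₂ rfl y (I.equiv s₁ s₂ b q g) : TensorX Y G' (s₁, b) (p + q))
      rw [LinearMap.comp_apply, LinearMap.comp_apply, e₁, map_tm₂, map_tm₂, map_smul, e₂]
  exact LinearMap.congr_fun this t

end Interchange

end Interchange

end DGMod

end

end DG

/-! ### Representable modules and morphisms out of tensor products -/

namespace DG

noncomputable section

variable {k : Type u} [CommRing k]

namespace DGMod

section Representable

variable {A : DGCat k}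

/-- The morphism `A(x, -) → M` given by a cocycle of `M(x)`. -/
def ofCocycle (M : DGMod A) {x : A.Obj} (m : (M.obj x).X 0) (hm : dif (M.obj x) 0 m = 0) :
    rep A x ⟶ M :=
  mkHom (M := rep A x) (fun y n => (M.act (add_zero n)).flip m)
    (fun y n a => by
      change M.act _ _ m = dif (M.obj y) n (M.act _ a m)
      rw [M.dif_act, hm, map_zero, smul_zero, add_zero])
    (fun h a b => M.comp_act h (add_zero _) (add_zero _) h a b m)

/-- Representable dg-modules are cofibrant. -/
lemma isCofibrant_rep (x : A.Obj) : (rep A x).IsCofibrant := by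
  intro E B p hp hs b
  let β : (B.obj x).X 0 := Hom.ap b x 0 (A.one x)
  have hβ : dif (B.obj x) 0 β = 0 := by
    refine (ap_dif b x 0 (A.one x)).symm.trans ?_
    refine (congrArg (Hom.ap b x (0 + 1)) (A.dif_one x)).trans (map_zero _)
  -- By Yoneda a cocycle over `β` is wanted. The quasi-isomorphism gives one up to a boundary `dv`,
  -- and surjectivity lifts `v` in degree `-1`, which removes the error.
  obtain ⟨m, v, hm, hv⟩ := hp.exists_eq_add x (show (-1 : ℤ) + 1 = 0 by norm_num)
    (show (0 : ℤ) + 1 = 0 + 1 from rfl) β hβ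
  obtain ⟨v, rfl⟩ := hs x _ v
  let ε : (E.obj x).X 0 := m + dd (E.obj x) (-1) 0 v
  have hε : dif (E.obj x) 0 ε = 0 := by
    rw [dif_eq_dd, map_add, dd_dd, add_zero, hm]
  have hpε : Hom.ap p x 0 ε = β := by rw [map_add, ap_dd, hv]
  refine ⟨ofCocycle E ε hε, hom_ext_ap fun y n a => ?_⟩
  change Hom.ap p y n (E.act (add_zero n) a ε) = Hom.ap b y n a
  rw [ap_act, hpε]
  refine (ap_act b (add_zero n) a (A.one x)).symm.trans ?_
  exact congrArg (Hom.ap b y n) (A.comp_one a)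

/-- The identification of a dg-category with its double opposite. -/
def _root_.DG.DGFunctor.toOpOp (A : DGCat k) : DGFunctor A A.op.op where
  obj x := x
  map := LinearMap.id
  map_dif _ := rfl
  map_one _ := rfl
  map_comp h g f := ((DGFunctor.fromOpOp A).map_comp h g f).symm

/-- The double opposite has the same complexes and, after two equal signs, the same composition, so
lifting problems transfer. Restriction is needed because `tensorOver` with `S = T.op` expects a
module over `T.op.op`. -/
lemma IsCofibrant.pullback_fromOpOp {M : DGMod A} (hM : M.IsCofibrant) :
    (M.pullback (DGFunctor.fromOpOp A)).IsCofibrant := by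
  intro E B p hp hs b
  obtain ⟨e, he⟩ := hM (pullbackMap (DGFunctor.toOpOp A) p) (fun x => hp x) (fun x n => hs x n)
    (mkHom (N := B.pullback (DGFunctor.toOpOp A)) (fun x n => Hom.ap b x n)
      (fun x n m => ap_dif b x n m) (fun h a m => ap_act b h a m))
  refine ⟨mkHom (M := M.pullback (DGFunctor.fromOpOp A)) (N := E) (fun x n => Hom.ap e x n)
    (fun x n m => ap_dif e x n m) (fun h a m => ap_act e h a m), hom_ext_ap fun x n m => ?_⟩
  exact congrArg (fun f : M ⟶ B.pullback (DGFunctor.toOpOp A) => Hom.ap f x n m) he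

end Representable

section Pairing

variable {S B : DGCat k} {X : DGMod S.op} {G : DGMod (S.tensor B)} {N : DGMod B}

/-- The morphism `X ⊗ G → N` given by a balanced family of bilinear maps. -/
def homOfBilinear
    (β : ∀ (s : S.Obj) (b : B.Obj) (p q n : ℤ), p + q = n →
      ((X.obj s).X p →ₗ[k] (G.obj (s, b)).X q →ₗ[k] (N.obj b).X n))
    (hβ : ∀ (s s' : S.Obj) (b : B.Obj) {i p q ip iq n : ℤ} (hip : i + p = ip)
      (hiq : i + q = iq) (h : ip + q = n) (h' : p + iq = n) (a : (S.Hom s' s).X i)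
      (x : (X.obj s).X p) (g : (G.obj (s', b)).X q),
      β s' b ip q n h (X.act (x := s) (y := s') hip a x) g = sgn k (i * p) • β s b p iq n h' x
        (G.act (x := (s', b)) (y := (s, b)) hiq (DGFunctor.inlMap S B b i a) g))
    (hd : ∀ s b (p q n : ℤ) (h : p + q = n) (x : (X.obj s).X p) (g : (G.obj (s, b)).X q),
      β s b (p + 1) q (n + 1) (by omega) (dif (X.obj s) p x) g +
        sgn k p • β s b p (q + 1) (n + 1) (by omega) x (dif (G.obj (s, b)) q g) =
      dif (N.obj b) n (β s b p q n h x g))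
    (ha : ∀ (s : S.Obj) (b b' : B.Obj) (i j p q iq n : ℤ) (h : i + j = n) (h' : p + q = j)
      (hq : i + q = iq) (c : (B.Hom b b').X i) (x : (X.obj s).X p) (g : (G.obj (s, b)).X q),
      sgn k (i * p) • β s b' p iq n (by omega) x
        (G.act (x := (s, b)) (y := (s, b')) hq (DGFunctor.inrMap S B s i c) g) =
      N.act h c (β s b p q j h' x g)) :
    tensorOver X G ⟶ N :=
  tensorDesc (fun b n => tmLift (fun s p q h => β s b p q n h)
      (fun {s s' _ _ _ _ _} hip hiq h h' a x g => hβ s s' b hip hiq h h' a x g))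
    (fun b s p q n h x g => by
      rw [tensorDif_tm, map_add, map_smul, tmLift_tm, tmLift_tm, tmLift_tm, hd])
    (fun {b b' i j n} h c s p q h' x g => by
      rw [tensorAct_tm X G h s h' rfl, map_smul, tmLift_tm, tmLift_tm,
        ha s b b' i j p q (i + q) n h h' rfl])

lemma homOfBilinear_ap_tm
    (β : ∀ (s : S.Obj) (b : B.Obj) (p q n : ℤ), p + q = n →
      ((X.obj s).X p →ₗ[k] (G.obj (s, b)).X q →ₗ[k] (N.obj b).X n)) (hβ) (hd) (ha)
    (s : S.Obj) (b : B.Obj) {p q n : ℤ} (h : p + q = n) (x : (X.obj s).X p)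
    (g : (G.obj (s, b)).X q) :
    Hom.ap (homOfBilinear (X := X) (G := G) (N := N) β hβ hd ha) b n (tm X G b s h x g) =
      β s b p q n h x g :=
  tmLift_tm _ (fun {s s' _ _ _ _ _} hip hiq h h' a x g => hβ s s' b hip hiq h h' a x g) s h x g

end Pairing

/-! ### The diagonal bimodule is neutral for the tensor product -/

section Diagonal

variable (T : DGCat k)

/-- The trilinear map `(a, c, t) ↦ (-1)^(|a|(|c| + |t|)) c ∘ t ∘ a`. -/
def diagonalTri {z z' y y' : T.Obj} {p q j n : ℤ} (h : p + q + j = n) :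
    (T.Hom z' z).X p →ₗ[k] (T.Hom y y').X q →ₗ[k] (T.Hom z y).X j →ₗ[k] (T.Hom z' y').X n :=
  LinearMap.mk₂ k (fun a c => sgn k (p * (q + j)) •
      (T.comp (show q + (j + p) = n by omega) c ∘ₗ (T.comp rfl).flip a))
    (fun _ _ _ => by rw [map_add, LinearMap.comp_add, smul_add])
    (fun _ _ _ => by rw [map_smul, LinearMap.comp_smul, smul_comm])
    (fun _ _ _ => by rw [map_add, LinearMap.add_comp, smul_add])
    (fun _ _ _ => by rw [map_smul, LinearMap.smul_comp, smul_comm])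

lemma diagonalTri_apply {z z' y y' : T.Obj} {p q j n jp : ℤ} (h : p + q + j = n) (h' : j + p = jp)
    (a : (T.Hom z' z).X p) (c : (T.Hom y y').X q) (t : (T.Hom z y).X j) :
    diagonalTri T h a c t = sgn k (p * (q + j)) •
      T.comp (show q + jp = n by omega) c (T.comp h' t a) := by
  subst h'
  rfl

/-- The action of `T.op ⊗ T` on the diagonal bimodule. -/
def diagonalAct {x x' : T.Obj × T.Obj} {i j n : ℤ} (h : i + j = n) :
    (tens (T.Hom x'.1 x.1) (T.Hom x.2 x'.2)).X i →ₗ[k] (T.Hom x.1 x.2).X j →ₗ[k]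
      (T.Hom x'.1 x'.2).X n :=
  tlift fun p q hpq => diagonalTri T (show p + q + j = n by omega)

lemma diagonalAct_tmul {x x' : T.Obj × T.Obj} {p q i j n : ℤ} (h : i + j = n) (hpq : p + q = i)
    (a : (T.Hom x'.1 x.1).X p) (c : (T.Hom x.2 x'.2).X q) (t : (T.Hom x.1 x.2).X j) :
    diagonalAct T (x := x) (x' := x') h (tmul hpq a c) t =
      diagonalTri T (show p + q + j = n by omega) a c t := by
  rw [diagonalAct, tlift_tmul]

/-- The diagonal bimodule `(z, y) ↦ T(z, y)`. -/
abbrev diagonal : DGMod (T.op.tensor T) where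
  obj x := T.Hom x.1 x.2
  act {x y i j n} h := diagonalAct T (x := x) (x' := y) h
  dif_act {x y i j n} h e t := by
    induction e using tens_induction with
    | h0 => simp only [map_zero, LinearMap.zero_apply, smul_zero, add_zero]
    | hadd e e' h₁ h₂ =>
      simp only [map_add, LinearMap.add_apply, smul_add, h₁, h₂]
      abel
    | H p q hpq a c =>
    rw [dif_tmul, map_add, map_smul, LinearMap.add_apply, LinearMap.smul_apply,
      diagonalAct_tmul, diagonalAct_tmul, diagonalAct_tmul, diagonalAct_tmul,
      diagonalTri_apply T _ rfl, diagonalTri_apply T _ (show j + (p + 1) = j + p + 1 by omega),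
      diagonalTri_apply T _ rfl, diagonalTri_apply T _ (show j + 1 + p = j + p + 1 by omega),
      map_smul, T.dif_comp, T.dif_comp, map_add, map_smul]
    have e₁ : sgn k i = sgn k p * sgn k q := by rw [← hpq, sgn_add]
    have e₂ : sgn k ((p + 1) * (q + j)) = sgn k (p * (q + j)) * (sgn k q * sgn k j) := by
      rw [add_mul, sgn_add, one_mul, sgn_add]
    have e₃ : sgn k (p * (q + 1 + j)) = sgn k (p * (q + j)) * sgn k p := by
      rw [← sgn_add]; congr 1; ring
    have e₄ : sgn k (p * (q + (j + 1))) = sgn k (p * (q + j)) * sgn k p := by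
      rw [← sgn_add]; congr 1; ring
    rw [e₁, e₂, e₃, e₄]
    simp only [smul_add, smul_smul]
    have e₅ : sgn k p * (sgn k (p * (q + j)) * sgn k p) = sgn k (p * (q + j)) := by
      linear_combination sgn k (p * (q + j)) * sgn_mul_self (k := k) p
    have e₆ : sgn k p * sgn k q * (sgn k (p * (q + j)) * sgn k p) =
        sgn k (p * (q + j)) * sgn k q := by
      linear_combination sgn k (p * (q + j)) * sgn k q * sgn_mul_self (k := k) p
    rw [e₅, e₆]
    match_scalars <;> ring
  one_act {x j} t := by
    rw [diagonalAct_tmul, diagonalTri_apply T _ (add_zero j), T.one_comp, T.comp_one, zero_mul,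
      sgn_zero, one_smul]
  comp_act {x y z u v w uv vw n} h₁ h₂ h₃ h₄ e e' t := by
    induction e using tens_induction with
    | h0 => simp only [map_zero, LinearMap.zero_apply]
    | hadd e e₁ h₁ h₂ => simp only [map_add, LinearMap.add_apply, h₁, h₂]
    | H p q hpq a c =>
    induction e' using tens_induction with
    | h0 => simp only [map_zero, LinearMap.zero_apply]
    | hadd e e₁ h₁ h₂ => simp only [map_add, LinearMap.add_apply, h₁, h₂]
    | H p' q' hpq' a' c' =>
    rw [tensorComp_tmul T.op T h₁ hpq hpq' rfl rfl, map_smul, LinearMap.smul_apply,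
      diagonalAct_tmul, diagonalAct_tmul, diagonalAct_tmul, diagonalTri_apply T _ rfl,
      diagonalTri_apply T _ rfl, diagonalTri_apply T _ rfl]
    have e₁ : T.op.comp (rfl : p + p' = p + p') a a' =
      sgn k (p * p') • T.comp (show p' + p = p + p' by omega) a' a := rfl
    rw [e₁]
    simp only [LinearMap.smul_apply, map_smul, smul_smul]
    rw [T.assoc (show q + q' = q + q' from rfl) (show q + q' + (w + (p + p')) = n by omega)
        (show q' + (w + (p + p')) = vw + p by omega) (show q + (vw + p) = n by omega),
      T.assoc (show q' + (w + p') = vw by omega) (show vw + p = vw + p from rfl)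
        (show w + p' + p = w + (p + p') by omega),
      T.assoc rfl (show w + p' + p = w + (p + p') by omega) (show p' + p = p + p' by omega) rfl]
    · congr 1
      rw [← h₃, ← hpq']
      simp only [add_mul, mul_add, sgn_add, mul_comm q p']
      -- The sign `sgn k (p' * q)` occurs twice on the left, from the interchange in the tensor
      -- category and from the action of `a'` past `c`, and cancels.
      linear_combination sgn k (p * q) * sgn k (p * q') * sgn k (p * w) * sgn k (p' * q') *
        sgn k (p' * w) * sgn k (p * p') * sgn_mul_self (k := k) (p' * q)
    · omega

lemma diagonal_act_tmul {x x' : T.Obj × T.Obj} {p q i j n jp : ℤ} (h : i + j = n)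
    (hpq : p + q = i) (hj : j + p = jp) (a : (T.Hom x'.1 x.1).X p) (c : (T.Hom x.2 x'.2).X q)
    (t : (T.Hom x.1 x.2).X j) :
    (diagonal T).act (x := x) (y := x') h (tmul hpq a c) t = sgn k (p * (q + j)) •
      T.comp (show q + jp = n by omega) c (T.comp hj t a) :=
  (diagonalAct_tmul T h hpq a c t).trans (diagonalTri_apply T _ hj a c t)

lemma diagonal_act_inlMap {z z' : T.Obj} (y : T.Obj) {i j n : ℤ} (h : i + j = n)
    (a : (T.Hom z' z).X i) (t : (T.Hom z y).X j) :
    (diagonal T).act (x := (z, y)) (y := (z', y)) h (DGFunctor.inlMap T.op T y i a) t =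
      sgn k (i * j) • T.comp (show j + i = n by omega) t a := by
  rw [DGFunctor.inlMap_apply, diagonal_act_tmul T h _ (show j + i = n by omega), T.one_comp,
    zero_add]

lemma diagonal_act_inrMap (z : T.Obj) {y y' : T.Obj} {i j n : ℤ} (h : i + j = n)
    (c : (T.Hom y y').X i) (t : (T.Hom z y).X j) :
    (diagonal T).act (x := (z, y)) (y := (z, y')) h (DGFunctor.inrMap T.op T z i c) t =
      T.comp h c t := by
  rw [DGFunctor.inrMap_apply, diagonal_act_tmul T h _ (add_zero j), T.comp_one, zero_mul,
    sgn_zero, one_smul]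

variable {T}

/-- The pairing `(m, t) ↦ (-1)^(|m||t|) t m`. -/
def evalPairing (M : DGMod T) (s y : T.Obj) {p q n : ℤ} (h : p + q = n) :
    (M.obj s).X p →ₗ[k] (T.Hom s y).X q →ₗ[k] (M.obj y).X n :=
  sgn k (p * q) • (M.act (x := s) (y := y) (show q + p = n by omega)).flip

lemma evalPairing_apply (M : DGMod T) (s y : T.Obj) {p q n : ℤ} (h : p + q = n)
    (m : (M.obj s).X p) (t : (T.Hom s y).X q) :
    evalPairing M s y h m t = sgn k (p * q) • M.act (show q + p = n by omega) t m := rfl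

lemma evalPairing_rel (M : DGMod T) {s s' y : T.Obj} {i p q ip iq n : ℤ} (hip : i + p = ip)
    (hiq : i + q = iq) (h : ip + q = n) (h' : p + iq = n) (a : (T.Hom s s').X i)
    (x : (M.obj s).X p) (g : (T.Hom s' y).X q) :
    evalPairing M s' y h (M.act hip a x) g = sgn k (i * p) • evalPairing M s y h' x
      ((diagonal T).act (x := (s', y)) (y := (s, y)) hiq (DGFunctor.inlMap T.op T y i a) g) := by
  rw [diagonal_act_inlMap, evalPairing_apply, map_smul, evalPairing_apply,
    ← M.comp_act (show q + i = iq by omega) (show iq + p = n by omega) hip _ g a x, smul_smul,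
    smul_smul]
  congr 1
  rw [← hip, ← hiq, add_mul, mul_add, sgn_add, sgn_add, mul_comm p i]
  linear_combination -sgn k (i * q) * sgn k (p * q) * sgn_mul_self (k := k) (i * p)

lemma evalPairing_dif (M : DGMod T) (s y : T.Obj) {p q n : ℤ} (h : p + q = n)
    (m : (M.obj s).X p) (t : (T.Hom s y).X q) :
    evalPairing M s y (show p + 1 + q = n + 1 by omega) (dif (M.obj s) p m) t +
      sgn k p • evalPairing M s y (show p + (q + 1) = n + 1 by omega) m (dif (T.Hom s y) q t) =
      dif (M.obj y) n (evalPairing M s y h m t) := by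
  rw [evalPairing_apply, evalPairing_apply, evalPairing_apply, map_smul, M.dif_act]
  have e₁ : sgn k ((p + 1) * q) = sgn k (p * q) * sgn k q := by rw [add_mul, sgn_add, one_mul]
  have e₂ : sgn k p * sgn k (p * (q + 1)) = sgn k (p * q) := by
    rw [mul_add, sgn_add, mul_one]
    linear_combination sgn k (p * q) * sgn_mul_self (k := k) p
  rw [smul_smul, e₁, e₂, smul_add, smul_smul]
  exact add_comm _ _

lemma evalPairing_act (M : DGMod T) (s : T.Obj) {y y' : T.Obj} {i j p q iq n : ℤ} (h : i + j = n)
    (h' : p + q = j) (hq : i + q = iq) (c : (T.Hom y y').X i) (m : (M.obj s).X p)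
    (t : (T.Hom s y).X q) :
    sgn k (i * p) • evalPairing M s y' (show p + iq = n by omega) m
      ((diagonal T).act (x := (s, y)) (y := (s, y')) hq (DGFunctor.inrMap T.op T s i c) t) =
      M.act h c (evalPairing M s y h' m t) := by
  rw [diagonal_act_inrMap, evalPairing_apply, evalPairing_apply, map_smul,
    M.comp_act hq (show iq + p = n by omega) (show q + p = j by omega) h, smul_smul]
  congr 1
  rw [← hq, mul_add, sgn_add, mul_comm p i]
  linear_combination sgn k (p * q) * sgn_mul_self (k := k) (i * p)

/-- The isomorphism `M ⊗_T T → M`. -/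
def evalDiagonal (M : DGMod T) :
    tensorOver (M.pullback (DGFunctor.fromOpOp T)) (diagonal T) ⟶ M :=
  homOfBilinear (X := M.pullback (DGFunctor.fromOpOp T)) (G := diagonal T)
    (fun s y _ _ _ h => evalPairing M s y h)
    (fun _ _ _ {_ _ _ _ _ _} hip hiq h h' a x g => evalPairing_rel M hip hiq h h' a x g)
    (fun s y _ _ _ h m t => evalPairing_dif M s y h m t)
    (fun s _ _ _ _ _ _ _ _ h h' hq c m t => evalPairing_act M s h h' hq c m t)

lemma evalDiagonal_ap_tm (M : DGMod T) (s y : T.Obj) {p q n : ℤ} (h : p + q = n)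
    (m : (M.obj s).X p) (t : (T.Hom s y).X q) :
    Hom.ap (evalDiagonal M) y n
      (tm (M.pullback (DGFunctor.fromOpOp T)) (diagonal T) y s h m t) =
      evalPairing M s y h m t :=
  homOfBilinear_ap_tm (X := M.pullback (DGFunctor.fromOpOp T)) (G := diagonal T) _ _ _ _ s y h m t

/-- The inverse is `m ↦ m ⊗ 1`: balancing moves `t` across the tensor sign, so `m ⊗ t = ± t m ⊗ 1`.
-/
lemma evalDiagonal_bijective (M : DGMod T) (y : T.Obj) (n : ℤ) :
    Function.Bijective (Hom.ap (evalDiagonal M) y n) := by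
  let X := M.pullback (DGFunctor.fromOpOp T)
  let φ : TensorX X (diagonal T) y n →ₗ[k] (M.obj y).X n := Hom.ap (evalDiagonal M) y n
  let ψ : (M.obj y).X n →ₗ[k] TensorX X (diagonal T) y n :=
    (tm X (diagonal T) y y (add_zero n)).flip (T.one y)
  have h₁ : ψ ∘ₗ φ = LinearMap.id := tm_ext fun s p q h m t => by
    have e : ψ (evalPairing M s y h m t) = tm X (diagonal T) y s h m t := by
      rw [evalPairing_apply, map_smul]
      have := tm_rel (X := X) (G := diagonal T) (b := y) (s := s)
        (s' := y) (show q + p = n by omega) (add_zero q) (add_zero n) h t m (T.one y)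
      have e₁ := diagonal_act_inlMap T (z := y) (z' := s) y (add_zero q) t (T.one y)
      rw [T.one_comp, mul_zero, sgn_zero, one_smul] at e₁
      refine (congrArg (sgn k (p * q) • ·) this).trans ?_
      rw [smul_smul, mul_comm q p, sgn_mul_self, one_smul]
      exact congrArg (tm X (diagonal T) y s h m) e₁
    exact (congrArg ψ (evalDiagonal_ap_tm M s y h m t)).trans e
  have h₂ (m : (M.obj y).X n) : φ (ψ m) = m := by
    refine (evalDiagonal_ap_tm M y y (add_zero n) m (T.one y)).trans ?_
    rw [evalPairing_apply, M.one_act, mul_zero, sgn_zero, one_smul]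
  exact Function.bijective_iff_has_inverse.mpr ⟨ψ, fun t => LinearMap.congr_fun h₁ t, h₂⟩

lemma evalDiagonal_naturality {M N : DGMod T} (f : M ⟶ N) :
    homLeft (pullbackMap (DGFunctor.fromOpOp T) f) (diagonal T) ≫ evalDiagonal N =
      evalDiagonal M ≫ f :=
  tensorOver_hom_ext fun y s p q n h m t => by
    have h₁ := homLeft_ap_tm (pullbackMap (DGFunctor.fromOpOp T) f) (diagonal T) y s h m t
    have h₂ : evalPairing N s y h (Hom.ap f s p m) t =
        Hom.ap f y n (evalPairing M s y h m t) := by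
      rw [evalPairing_apply, evalPairing_apply, map_smul, ap_act]
    exact ((congrArg (Hom.ap (evalDiagonal N) y n) h₁).trans
      (evalDiagonal_ap_tm N s y h (Hom.ap f s p m) t)).trans
      (h₂.trans (congrArg (Hom.ap f y n) (evalDiagonal_ap_tm M s y h m t)).symm)

end Diagonal

end DGMod

end

end DG

/-! ### The co-Yoneda isomorphism -/

namespace DG

noncomputable section

variable {k : Type u} [CommRing k]

namespace DGMod

section CoYoneda

variable {S B : DGCat k} (H : DGMod (S.tensor B))

/-- The morphism `w ↦ 1 ⊗ w` from `H(y, -)` to `S(-, y) ⊗ H`. -/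
def coYoneda (y : S.Obj) : H.pullback (DGFunctor.inr S B y) ⟶ tensorOver (rep S.op y) H :=
  mkHom (M := H.pullback (DGFunctor.inr S B y)) (N := tensorOver (rep S.op y) H)
    (fun b n => tm (rep S.op y) H b y (zero_add n) (S.one y))
    (fun b n w => by
      have h₁ := tensorDif_tm (X := rep S.op y) (G := H) (b := b) (s := y) (zero_add n) (S.one y) w
      have h₂ : dif ((rep S.op y).obj y) 0 (S.one y) = 0 := S.dif_one y
      rw [h₂, map_zero, LinearMap.zero_apply, zero_add, sgn_zero, one_smul] at h₁
      exact h₁.symm.trans (LinearMap.congr_fun (tensorOver_dif (rep S.op y) H b n) _).symm)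
    (fun {b b' i j n} h c w => by
      have h₁ := tensorAct_tm (rep S.op y) H h y (zero_add j) h c (S.one y) w
      rw [mul_zero, sgn_zero, one_smul] at h₁
      exact h₁.symm)

/-- The pairing `(t, w) ↦ t w`. -/
def repPairing (y : S.Obj) (b : B.Obj) (s : S.Obj) {p q n : ℤ} (h : p + q = n) :
    (S.Hom s y).X p →ₗ[k] (H.obj (s, b)).X q →ₗ[k] (H.obj (y, b)).X n :=
  (H.act (x := (s, b)) (y := (y, b)) h) ∘ₗ DGFunctor.inlMap S B b p

lemma repPairing_rel (y : S.Obj) (b : B.Obj) {s s' : S.Obj} {i p q ip iq n : ℤ} (hip : i + p = ip)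
    (hiq : i + q = iq) (h : ip + q = n) (h' : p + iq = n) (a : (S.Hom s' s).X i)
    (x : (S.Hom s y).X p) (g : (H.obj (s', b)).X q) :
    repPairing H y b s' h ((rep S.op y).act (x := s) (y := s') hip a x) g = sgn k (i * p) •
      repPairing H y b s h' x
        (H.act (x := (s', b)) (y := (s, b)) hiq (DGFunctor.inlMap S B b i a) g) := by
  have e : DGFunctor.inlMap S B b ip (S.comp (show p + i = ip by omega) x a) =
    tensorComp S B (x := (s', b)) (y := (s, b)) (z := (y, b)) (show p + i = ip by omega)
      (DGFunctor.inlMap S B b p x) (DGFunctor.inlMap S B b i a) :=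
    (DGFunctor.inl S B b).map_comp _ x a
  have e₁ : (rep S.op y).act (x := s) (y := s') hip a x =
    sgn k (i * p) • S.comp (show p + i = ip by omega) x a := rfl
  rw [e₁, map_smul, LinearMap.smul_apply, repPairing, LinearMap.comp_apply, repPairing,
    LinearMap.comp_apply, e]
  exact congrArg (sgn k (i * p) • ·) (H.comp_act (x := (s', b)) (y := (s, b)) (z := (y, b))
    (show p + i = ip by omega) h hiq
    h' (DGFunctor.inlMap S B b p x) (DGFunctor.inlMap S B b i a) g)

/-- The linear map `t ⊗ w ↦ t w`. -/
def coYonedaInv (y : S.Obj) (b : B.Obj) (n : ℤ) :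
    TensorX (rep S.op y) H b n →ₗ[k] (H.obj (y, b)).X n :=
  tmLift (X := rep S.op y) (G := H) (b := b) (fun s _ _ h => repPairing H y b s h)
    (fun hip hiq h h' a x g => repPairing_rel H y b hip hiq h h' a x g)

lemma coYonedaInv_tm (y s : S.Obj) (b : B.Obj) {p q n : ℤ} (h : p + q = n) (x : (S.Hom s y).X p)
    (g : (H.obj (s, b)).X q) :
    coYonedaInv H y b n (tm (rep S.op y) H b s h x g) = repPairing H y b s h x g :=
  tmLift_tm (X := rep S.op y) (G := H) (b := b) _
    (fun hip hiq h h' a x g => repPairing_rel H y b hip hiq h h' a x g) s h x g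

/-- The inverse is `t ⊗ w ↦ t w`, since `t ⊗ w = 1 ⊗ t w` by balancing. -/
lemma coYoneda_bijective (y : S.Obj) (b : B.Obj) (n : ℤ) :
    Function.Bijective (Hom.ap (coYoneda H y) b n) := by
  let φ : (H.obj (y, b)).X n →ₗ[k] TensorX (rep S.op y) H b n :=
    tm (rep S.op y) H b y (zero_add n) (S.one y)
  have h₁ (w : (H.obj (y, b)).X n) : coYonedaInv H y b n (φ w) = w :=
    (coYonedaInv_tm H y y b (zero_add n) (S.one y) w).trans (H.one_act (x := (y, b)) w)
  have h₂ : φ ∘ₗ coYonedaInv H y b n = LinearMap.id := tm_ext fun s p q h x g => by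
    refine (congrArg φ (coYonedaInv_tm H y s b h x g)).trans ?_
    have e := tm_rel (X := rep S.op y) (G := H) (b := b) (s := y) (s' := s) (add_zero p) h h
      (zero_add n) x (S.one y) g
    have e' : (rep S.op y).act (x := y) (y := s) (add_zero p) x (S.one y) = x :=
      S.op.comp_one x
    rw [e', mul_zero, sgn_zero, one_smul] at e
    exact e.symm
  exact Function.bijective_iff_has_inverse.mpr
    ⟨coYonedaInv H y b n, h₁, fun t => LinearMap.congr_fun h₂ t⟩

/-- The morphism `t ↦ c ∘ t` between representable modules. -/
def repMap {y y' : S.Obj} {d : ℤ} (c : (S.Hom y y').X d) : GHom (rep S.op y) (rep S.op y') d where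
  app s i j h := S.comp (show d + i = j by omega) c
  comm {s s' i j m n l} h hm hl hn a t := by
    change S.comp _ c (sgn k (i * j) • S.comp _ t a) =
      sgn k (d * i) • sgn k (i * l) • S.comp _ (S.comp _ c t) a
    rw [map_smul, S.assoc (show d + j = l by omega) (show l + i = n by omega)
      (show j + i = m by omega) (show d + m = n by omega), smul_smul]
    congr 1
    rw [← hl, mul_add, sgn_add, mul_comm d i]
    linear_combination -sgn k (i * j) * sgn_mul_self (k := k) (i * d)

/-- Naturality in the representing object: `1 ⊗ w` goes to `c ⊗ w = 1 ⊗ c w`. It is needed for `c`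
of every degree and not necessarily closed, hence the use of `GHom`. -/
lemma mapLeftFun_coYoneda {y y' : S.Obj} (b : B.Obj) {d m n : ℤ} (h : d + m = n)
    (c : (S.Hom y y').X d) (w : (H.obj (y, b)).X m) :
    mapLeftFun H (repMap c) b (show m + d = n by omega)
        (tm (rep S.op y) H b y (zero_add m) (S.one y) w) =
      tm (rep S.op y') H b y' (zero_add n) (S.one y')
        (H.act (x := (y, b)) (y := (y', b)) h (DGFunctor.inlMap S B b d c) w) := by
  rw [mapLeftFun_tm H (repMap c) b _ y (zero_add m) (zero_add d)]
  have e := tm_rel (X := rep S.op y') (G := H) (b := b) (s := y') (s' := y) (add_zero d) h h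
      (zero_add n) c (S.one y') w
  have e' : (rep S.op y').act (x := y') (y := y) (add_zero d) c (S.one y') = c := S.op.comp_one c
  rw [e', mul_zero, sgn_zero, one_smul] at e
  have e'' : (repMap c).app y (zero_add d) (S.one y) = c := S.comp_one c
  rw [e'']
  exact e

end CoYoneda

/-! ### From a unit constraint to a quasi-isomorphism with the diagonal -/

section Unit

variable {T : DGCat k} (H : DGMod (T.tensor T.op)) (l : ∀ X : DGMod T.op, tensorOver X H ⟶ X)

lemma swap_map_tmul (A B : DGCat k) {x y : (A.tensor B).Obj} {p q n : ℤ} (h : p + q = n)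
    (a : (A.Hom x.1 y.1).X p) (b : (B.Hom x.2 y.2).X q) :
    (DGFunctor.swap A B).map (x := x) (y := y) (tmul h a b) =
      sgn k (p * q) • tmul (show q + p = n by omega) b a := by
  simp only [tlift_tmul, LinearMap.smul_apply, LinearMap.flip_apply]

/-- The action of a pure tensor in terms of the actions of the two factors. -/
lemma act_tmul {A B : DGCat k} (G : DGMod (A.tensor B)) {x y : (A.tensor B).Obj}
    {p q i j n qj : ℤ} (h : i + j = n) (hpq : p + q = i) (hqj : q + j = qj)
    (a : (A.Hom x.1 y.1).X p) (b : (B.Hom x.2 y.2).X q) (g : (G.obj x).X j) :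
    G.act h (tmul hpq a b) g =
      G.act (x := (x.1, y.2)) (y := y) (show p + qj = n by omega) (DGFunctor.inlMap A B y.2 p a)
        (G.act (x := x) (y := (x.1, y.2)) hqj (DGFunctor.inrMap A B x.1 q b) g) := by
  rw [← G.comp_act (x := x) (y := (x.1, y.2)) (z := y) hpq h]
  have := tensorComp_tmul A B (x := x) (y := (x.1, y.2)) (z := y) hpq (add_zero p) (zero_add q)
    (add_zero p) (zero_add q) a (B.one y.2) (A.one x.1) b
  rw [A.comp_one, B.one_comp, mul_zero, sgn_zero, one_smul] at this
  exact congrArg (fun t => G.act h t g) this.symm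

/-- The morphism `H(y, -) → T(-, y)` induced by a morphism `l : X ⊗ H → X` for the representable
module `X = T(-, y)`. -/
def unitRep (y : T.Obj) : H.pullback (DGFunctor.inr T T.op y) ⟶ rep T.op y :=
  coYoneda H y ≫ l (rep T.op y)

/-- Co-Yoneda is bijective, and representable modules are cofibrant, so the hypothesis on `l`
applies to them. -/
lemma quasiIso_unitRep (hl : ∀ X : DGMod T.op, X.IsCofibrant → quasiIso T.op (l X)) (y : T.Obj) :
    quasiIso T.op (unitRep H l y) :=
  (quasiIso T.op).comp_mem _ _ (quasiIso_of_bijective _ (coYoneda_bijective H y))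
    (hl _ (isCofibrant_rep (A := T.op) y))

lemma GHom.app_toGHom_app {A : DGCat k} {L M N : DGMod A} {d : ℤ} (φ : GHom M N d) (f : L ⟶ M)
    (x : A.Obj) {i j n : ℤ} (h : i + 0 = j) (h' : j + d = n) (w : (L.obj x).X i) :
    φ.app x h' ((Hom.toGHom f).app x h w) = φ.app x (show i + d = n by omega) (Hom.ap f x i w) := by
  obtain rfl : i = j := by omega
  rfl

-- Dg-naturality evaluated on elements; as `l` has degree zero, the sign is trivial even when `φ`
-- has nonzero degree.
variable {l} in
lemma ap_mapLeftFun (hl : DGOp.IsNatHom ⟨fun X => tensorOver X H, mapLeft H⟩ (DGOp.id T.op) l)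
    {X Y : DGMod T.op} {d : ℤ} (φ : GHom X Y d) (z : T.Obj) {m n : ℤ} (h : m + d = n)
    (t : TensorX X H z m) :
    Hom.ap (l Y) z n (mapLeftFun H φ z h t) = φ.app z h (Hom.ap (l X) z m t) := by
  subst h
  have h₁ := congrArg (fun ψ : GHom (tensorOver X H) Y (d + 0) =>
    ψ.app z (show m + (d + 0) = m + d by omega) t) (hl X Y d φ)
  have h₂ (ψ : GHom (tensorOver X H) Y (d + 0)) : (sgn k (0 * d) • ψ) = ψ := by
    rw [zero_mul, sgn_zero]
    exact GHom.ext (by funext x i j h; exact one_smul k _)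
  refine h₁.trans ((congrArg (fun ψ : GHom (tensorOver X H) Y (d + 0) =>
    ψ.app z (show m + (d + 0) = m + d by omega) t) (h₂ _)).trans ?_)
  exact GHom.app_toGHom_app φ (l X) z rfl _ t

-- Linearity in the covariant variable is dg-naturality of `l` for the morphism `t ↦ c ∘ t` of
-- representable modules. Linearity in the other variable is part of `l` being a morphism of right
-- modules.
variable {l} in
lemma unitRep_inl (hl : DGOp.IsNatHom ⟨fun X => tensorOver X H, mapLeft H⟩ (DGOp.id T.op) l)
    {y y' z : T.Obj} {d m n : ℤ} (h : d + m = n) (c : (T.Hom y y').X d) (w : (H.obj (y, z)).X m) :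
    Hom.ap (unitRep H l y') z n
        (H.act (x := (y, z)) (y := (y', z)) h (DGFunctor.inlMap T T.op z d c) w) =
      T.comp h c (Hom.ap (unitRep H l y) z m w) :=
  (congrArg (Hom.ap (l (rep T.op y')) z n) (mapLeftFun_coYoneda H z h c w)).symm.trans
    (ap_mapLeftFun H hl (repMap c) z _ _)

lemma unitRep_inr {y z z' : T.Obj} {i j n : ℤ} (h : i + j = n) (a : (T.Hom z' z).X i)
    (w : (H.obj (y, z)).X j) :
    Hom.ap (unitRep H l y) z' n
        (H.act (x := (y, z)) (y := (y, z')) h (DGFunctor.inrMap T T.op y i a) w) =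
      sgn k (i * j) • T.comp (show j + i = n by omega) (Hom.ap (unitRep H l y) z j w) a :=
  ap_act (unitRep H l y) h a w

/-- The morphism from `H` to the diagonal bimodule induced by a natural morphism `X ⊗ H → X`. -/
def unitDiagonal (hl : DGOp.IsNatHom ⟨fun X => tensorOver X H, mapLeft H⟩ (DGOp.id T.op) l) :
    H.pullback (DGFunctor.swap T.op T) ⟶ diagonal T :=
  mkHom (M := H.pullback (DGFunctor.swap T.op T)) (N := diagonal T)
    (fun x n => Hom.ap (unitRep H l x.2) x.1 n)
    (fun x n w => ap_dif (unitRep H l x.2) x.1 n w)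
    (fun {x y i j n} h e w => by
      induction e using tens_induction with
      | h0 => simp only [map_zero, LinearMap.zero_apply]
      | hadd e e' h₁ h₂ => simp only [map_add, LinearMap.add_apply, h₁, h₂]
      | H p q hpq a c =>
      have e₁ := congrArg (fun t => H.act (x := (x.2, x.1)) (y := (y.2, y.1)) h t w)
        (swap_map_tmul T.op T (x := x) (y := y) hpq a c)
      have e₂ := act_tmul H (x := (x.2, x.1)) (y := (y.2, y.1)) h (show q + p = i by omega)
        (rfl : p + j = p + j) c a w
      have e₃ : Hom.ap (unitRep H l y.2) y.1 n
          (H.act (x := (x.2, x.1)) (y := (y.2, y.1)) h (tmul (show q + p = i by omega) c a) w) =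
          sgn k (p * j) • T.comp (show q + (p + j) = n by omega) c
            (T.comp (show j + p = p + j by omega) (Hom.ap (unitRep H l x.2) x.1 j w) a) := by
        rw [e₂, unitRep_inl H hl, unitRep_inr, map_smul]
      refine (congrArg (Hom.ap (unitRep H l y.2) y.1 n) e₁).trans ?_
      rw [map_smul, LinearMap.smul_apply, map_smul]
      refine (congrArg (sgn k (p * q) • ·) e₃).trans ?_
      refine Eq.trans ?_ (diagonal_act_tmul T (x := x) (x' := y) h hpq
        (show j + p = p + j by omega) a c (Hom.ap (unitRep H l x.2) x.1 j w)).symm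
      rw [smul_smul, mul_add, sgn_add])

/-- Quasi-isomorphisms are tested objectwise, and at `(z, y)` this morphism is `unitRep` for `y`
evaluated at `z`. -/
lemma quasiIso_unitDiagonal
    (hl : DGOp.IsNatHom ⟨fun X => tensorOver X H, mapLeft H⟩ (DGOp.id T.op) l)
    (hq : ∀ X : DGMod T.op, X.IsCofibrant → quasiIso T.op (l X)) :
    quasiIso (T.op.tensor T) (unitDiagonal H l hl) := by
  rw [quasiIso_iff]
  intro x n
  exact (quasiIso_iff _).mp (quasiIso_unitRep H l hq x.2) x.1 n

end Unit

end DGMod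

end

end DG

/-! ### The quasi-retractions attached to a pseudo dg-tensor structure -/

namespace DG

noncomputable section

variable {k : Type u} [CommRing k]

namespace DGMod

variable {T : DGCat k}

/-- Restriction along a dg-functor, as a functor. -/
def pullbackFunctor {A B : DGCat k} (F : DGFunctor A B) : DGMod B ⥤ DGMod A where
  obj M := M.pullback F
  map f := pullbackMap F f

lemma rotate_map_tmul (A B C : DGCat k) {x y : (C.tensor (A.tensor B)).Obj} {p q r pq qr n : ℤ}
    (h : r + pq = n) (h' : p + q = pq) (h'' : q + r = qr) (c : (C.Hom x.1 y.1).X r)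
    (a : (A.Hom x.2.1 y.2.1).X p) (b : (B.Hom x.2.2 y.2.2).X q) :
    (DGFunctor.rotate A B C).map (x := x) (y := y) (tmul h c (tmul h' a b)) =
      sgn k (r * pq) • tmul (show p + qr = n by omega) a (tmul h'' b c) := by
  have e₁ := congrArg ((DGFunctor.assoc A B C).map (x := (x.2, x.1)) (y := (y.2, y.1)))
    (swap_map_tmul C (A.tensor B) (x := x) (y := y) h c (tmul h' a b))
  rw [map_smul] at e₁
  exact e₁.trans (congrArg (sgn k (r * pq) • ·)
    (DGFunctor.assocMap_tmul h' (show pq + r = n by omega) h'' a b c))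

lemma exchange_map_tmul (A B C : DGCat k) {x y : (B.tensor (A.tensor C)).Obj} {p q r qr pr n : ℤ}
    (h : p + qr = n) (h' : q + r = qr) (h'' : p + r = pr) (b : (B.Hom x.1 y.1).X p)
    (a : (A.Hom x.2.1 y.2.1).X q) (c : (C.Hom x.2.2 y.2.2).X r) :
    (DGFunctor.exchange A B C).map (x := x) (y := y) (tmul h b (tmul h' a c)) =
      (sgn k (p * qr) * sgn k (r * p)) • tmul (show q + pr = n by omega) a
        (tmul h'' b c) := by
  have e₁ := congrArg ((DGFunctor.whiskerLeft A (DGFunctor.swap C B)).map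
    (x := (x.2.1, (x.2.2, x.1))) (y := (y.2.1, (y.2.2, y.1))))
    (rotate_map_tmul A C B (x := x) (y := y) h h' (show r + p = pr by omega) b a c)
  rw [map_smul] at e₁
  refine e₁.trans ?_
  have e₂ := whiskerLeft_map_tmul A (DGFunctor.swap C B)
    (x := (x.2.1, (x.2.2, x.1))) (y := (y.2.1, (y.2.2, y.1))) (show q + pr = n by omega) a
    (tmul (show r + p = pr by omega) c b)
  have e₃ := swap_map_tmul C B (x := (x.2.2, x.1)) (y := (y.2.2, y.1))
    (show r + p = pr by omega) c b
  refine (congrArg (sgn k (p * qr) • ·) (e₂.trans (congrArg (tmul _ a) e₃))).trans ?_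
  rw [map_smul, smul_smul]

lemma whiskerLeft_swap_map_tmul (A B C : DGCat k) {x y : (A.tensor (B.tensor C)).Obj}
    {p q r qr n : ℤ} (h : p + qr = n) (h' : q + r = qr) (a : (A.Hom x.1 y.1).X p)
    (b : (B.Hom x.2.1 y.2.1).X q) (c : (C.Hom x.2.2 y.2.2).X r) :
    (DGFunctor.whiskerLeft A (DGFunctor.swap B C)).map (x := x) (y := y)
        (tmul h a (tmul h' b c)) =
      sgn k (q * r) • tmul h a (tmul (show r + q = qr by omega) c b) := by
  have e₂ := whiskerLeft_map_tmul A (DGFunctor.swap B C) (x := x) (y := y) h a (tmul h' b c)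
  have e₃ := swap_map_tmul B C (x := x.2) (y := y.2) h' b c
  refine e₂.trans ((congrArg (tmul h a) e₃).trans ?_)
  rw [map_smul]

/-- The two covariant variables of a 2-fold bimodule can be exchanged. -/
def exchangeInterchange (Γ : Bimod₂ T) :
    Interchange (Γ.pullback (DGFunctor.exchange T T T.op)) Γ where
  equiv _ _ _ _ := LinearEquiv.refl k _
  equiv_dif _ _ _ _ _ := rfl
  equiv_left {s s'} s₂ b {i q n} h a g := by
    have e := exchange_map_tmul T T T.op (x := (s, (s₂, b))) (y := (s', (s₂, b))) (add_zero i)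
      (add_zero 0) (add_zero i) a (T.one s₂) (T.op.one b)
    rw [mul_zero, zero_mul, sgn_zero, one_mul, one_smul] at e
    exact congrArg (fun t => Γ.act (x := (s₂, (s, b))) (y := (s₂, (s', b))) h t g) e
  equiv_right s₁ {s s'} b {i q n} h a g := by
    have e := exchange_map_tmul T T T.op (x := (s₁, (s, b))) (y := (s₁, (s', b))) (zero_add i)
      (add_zero i) (add_zero 0) (T.one s₁) a (T.op.one b)
    rw [mul_zero, zero_mul, sgn_zero, one_mul, one_smul] at e
    exact congrArg (fun t => Γ.act (x := (s, (s₁, b))) (y := (s', (s₁, b))) h t g) e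
  equiv_spectator s₁ s₂ {b b' i q n} h c g := by
    have e := exchange_map_tmul T T T.op (x := (s₁, (s₂, b))) (y := (s₁, (s₂, b'))) (zero_add i)
      (zero_add i) (zero_add i) (T.one s₁) (T.one s₂) c
    rw [mul_zero, zero_mul, sgn_zero, one_mul, one_smul] at e
    exact congrArg (fun t => Γ.act (x := (s₂, (s₁, b))) (y := (s₂, (s₁, b'))) h t g) e

/-- The contravariant and the first covariant variable of a 2-fold bimodule can be exchanged. -/
def rotateInterchange (Γ : Bimod₂ T) :
    Interchange (S₁ := T.op) (Γ.pullback (DGFunctor.rotate T T T.op))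
      (Γ.pullback (DGFunctor.whiskerLeft T (DGFunctor.swap T.op T))) where
  equiv _ _ _ _ := LinearEquiv.refl k _
  equiv_dif _ _ _ _ _ := rfl
  equiv_left {s s'} s₂ b {i q n} h a g := by
    have e := rotate_map_tmul T T T.op (x := (s, (s₂, b))) (y := (s', (s₂, b))) (add_zero i)
      (add_zero 0) (zero_add i) a (T.one s₂) (T.one b)
    have e' := whiskerLeft_swap_map_tmul T T.op T (x := (s₂, (s, b))) (y := (s₂, (s', b)))
      (zero_add i) (add_zero i) (T.one s₂) a (T.one b)
    rw [mul_zero, sgn_zero, one_smul] at e e'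
    exact congrArg (fun t => Γ.act (x := (s₂, (b, s))) (y := (s₂, (b, s'))) h t g)
      (e.trans e'.symm)
  equiv_right s₁ {s s'} b {i q n} h a g := by
    have e := rotate_map_tmul T T T.op (x := (s₁, (s, b))) (y := (s₁, (s', b))) (zero_add i)
      (add_zero i) (add_zero 0) (T.op.one s₁) a (T.one b)
    have e' := whiskerLeft_swap_map_tmul T T.op T (x := (s, (s₁, b))) (y := (s', (s₁, b)))
      (add_zero i) (add_zero 0) a (T.op.one s₁) (T.one b)
    rw [zero_mul, sgn_zero, one_smul] at e e'
    exact congrArg (fun t => Γ.act (x := (s, (b, s₁))) (y := (s', (b, s₁))) h t g)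
      (e.trans e'.symm)
  equiv_spectator s₁ s₂ {b b' i q n} h c g := by
    have e := rotate_map_tmul T T T.op (x := (s₁, (s₂, b))) (y := (s₁, (s₂, b'))) (zero_add i)
      (zero_add i) (add_zero i) (T.op.one s₁) (T.one s₂) c
    have e' := whiskerLeft_swap_map_tmul T T.op T (x := (s₂, (s₁, b))) (y := (s₂, (s₁, b')))
      (zero_add i) (zero_add i) (T.one s₂) (T.op.one s₁) c
    rw [zero_mul, sgn_zero, one_smul] at e e'
    exact congrArg (fun t => Γ.act (x := (s₂, (b, s₁))) (y := (s₂, (b', s₁))) h t g)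
      (e.trans e'.symm)

lemma naturality_of_isNatHom (H : DGMod (T.tensor T.op)) {l : ∀ X : DGMod T.op, tensorOver X H ⟶ X}
    (hl : DGOp.IsNatHom ⟨fun X => tensorOver X H, mapLeft H⟩ (DGOp.id T.op) l)
    {X Y : DGMod T.op} (f : X ⟶ Y) : homLeft f H ≫ l Y = l X ≫ f :=
  hom_ext_ap fun z _ t => ap_mapLeftFun H hl (Hom.toGHom f) z (add_zero _) t

lemma toGHom_homLeft {S B : DGCat k} {X Y : DGMod S.op} (f : X ⟶ Y) (G : DGMod (S.tensor B)) :
    Hom.toGHom (homLeft f G) = mapLeft G (Hom.toGHom f) := by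
  refine GHom.ext ?_
  funext b i j h
  obtain rfl : i = j := by omega
  rfl

lemma toGHom_homRight {S B : DGCat k} (X : DGMod S.op) {G G' : DGMod (S.tensor B)} (f : G ⟶ G') :
    Hom.toGHom (homRight X f) = mapRight X (Hom.toGHom f) := by
  refine GHom.ext ?_
  funext b i j h
  obtain rfl : i = j := by omega
  rfl

/-- Extracts an ordinary commutative square from dg-naturality at a closed morphism of degree `0`,
where the sign is trivial. -/
lemma comp_eq_of_toGHom {A : DGCat k} {K L M N : DGMod A} {a : K ⟶ L} {b : L ⟶ N} {c : K ⟶ M}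
    {d : M ⟶ N} (H : GHom.comp rfl (Hom.toGHom b) (Hom.toGHom a) =
      sgn k (0 * 0) • GHom.comp (add_comm 0 0) (Hom.toGHom d) (Hom.toGHom c)) :
    a ≫ b = c ≫ d :=
  hom_ext_ap fun x n t => by
    have h₁ := congrArg (fun ψ : GHom K N (0 + 0) => ψ.app x (show n + (0 + 0) = n by omega) t) H
    have h₂ (ψ : GHom K N (0 + 0)) : (sgn k (0 * 0) • ψ) = ψ := by
      rw [zero_mul, sgn_zero]
      exact GHom.ext (by funext x i j h; exact one_smul k _)
    rw [h₂] at h₁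
    exact (GHom.app_toGHom_app (Hom.toGHom b) a x rfl _ t).symm.trans
      (h₁.trans (GHom.app_toGHom_app (Hom.toGHom d) c x rfl _ t))

end DGMod

open DGMod

namespace PseudoDGTensor

variable {T : DGCat k} (P : PseudoDGTensor T)

/-- Tensoring with `U` in the first covariant variable recovers a right module `X` from `Γ ⊗ X`,
with `X` in the second covariant variable. -/
def quasiRetraction₂ :
    QuasiRetraction (tensorLeftFunctor (P.Γ.pullback (DGFunctor.exchange T T T.op))) where
  map_homotopic h := h.homLeft _
  map_zero M N := homLeft_zero M N _
  G := tensorRightFunctor P.U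
  G_map_homotopic h := h.homRight P.U
  G_map_zero M N := homRight_zero P.U M N
  q :=
    -- After interchange, `U` and `X` occupy the first and second slots, so the source becomes `U ⊠
    -- X` and `ℓ` applies.
    { app X := (exchangeInterchange P.Γ).hom X P.U ≫ P.ℓ X
      naturality X Y f := by
        have e₁ := (exchangeInterchange P.Γ).hom_naturality P.U f
        have e₂ : homLeft f (tensorOver P.U P.Γ) ≫ P.ℓ Y = P.ℓ X ≫ f :=
          naturality_of_isNatHom _ P.ℓ_nat f
        exact (Category.assoc _ _ _).symm.trans ((congrArg (· ≫ P.ℓ Y) e₁).trans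
          ((Category.assoc _ _ _).trans ((congrArg (_ ≫ ·) e₂).trans
            (Category.assoc _ _ _).symm))) }
  quasiIso_q X hX := (quasiIso T.op).comp_mem _ _ ((exchangeInterchange P.Γ).quasiIso_hom X P.U)
    (P.ℓ_quasiIso X hX)

lemma mapRight_mapLeft_toGHom {X Y : DGMod T.op} (Z : DGMod T.op) (Γ : Bimod₂ T) (f : X ⟶ Y) :
    mapRight Z (mapLeft Γ (Hom.toGHom f)) = Hom.toGHom (homRight Z (homLeft f Γ)) := by
  rw [toGHom_homRight, toGHom_homLeft]

lemma r_naturality {X Y : DGMod T.op} (f : X ⟶ Y) :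
    homRight P.U (homLeft f P.Γ) ≫ P.r Y = P.r X ≫ f := by
  have e := P.r_nat X Y 0 (Hom.toGHom f)
  dsimp only at e
  rw [mapRight_mapLeft_toGHom] at e
  exact comp_eq_of_toGHom e

/-- Tensoring with `U` in the second covariant variable recovers a right module `X` from `Γ ⊗ X`,
with `X` in the first covariant variable. -/
def quasiRetraction₁ : QuasiRetraction (tensorLeftFunctor P.Γ) where
  map_homotopic h := h.homLeft _
  map_zero M N := homLeft_zero M N _
  G := tensorRightFunctor P.U
  G_map_homotopic h := h.homRight P.U
  G_map_zero M N := homRight_zero P.U M N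
  q :=
    -- Here `U` fills the second slot, and the composite functor is `X ↦ X ⊠ U` by definition; no
    -- interchange is needed.
    { app X := P.r X
      naturality _ _ f := P.r_naturality f }
  quasiIso_q X hX := P.r_quasiIso X hX

/-- The morphism from `U ⊗ Γ` to the diagonal bimodule induced by the left unit constraint. -/
def unitMap : tensorOver P.U (P.Γ.pullback (DGFunctor.whiskerLeft T (DGFunctor.swap T.op T))) ⟶
    diagonal T :=
  tensorPullback P.U P.Γ (DGFunctor.swap T.op T) ≫
    unitDiagonal (tensorOver P.U P.Γ) P.ℓ P.ℓ_nat

/-- The restriction isomorphism is bijective, and the rest is the left unit constraint compared with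
the diagonal. -/
lemma quasiIso_unitMap : quasiIso (T.op.tensor T) P.unitMap :=
  (quasiIso _).comp_mem _ _
    (quasiIso_of_bijective _ (tensorPullback_bijective P.U P.Γ (DGFunctor.swap T.op T)))
    (quasiIso_unitDiagonal _ _ P.ℓ_nat P.ℓ_quasiIso)

/-- The morphism `U ⊗ (M ⊗ Γ) → M` for a left module `M`. -/
def leftRetraction (M : DGMod T) : tensorOver P.U (P.Γ.tensorLeft M) ⟶ M :=
  -- The composite is `U ⊗ (M ⊗ Γ) ≅ M ⊗ (U ⊗ Γ) → M ⊗ T ≅ M`.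
  (rotateInterchange P.Γ).hom (M.pullback (DGFunctor.fromOpOp T)) P.U ≫
    homRight _ P.unitMap ≫ evalDiagonal M

lemma leftRetraction_naturality {M N : DGMod T} (f : M ⟶ N) :
    homRight P.U (P.Γ.tensorLeftMap f) ≫ P.leftRetraction N = P.leftRetraction M ≫ f :=
  ((CommSq.mk ((rotateInterchange P.Γ).hom_naturality P.U
    (pullbackMap (DGFunctor.fromOpOp T) f)).symm).horiz_comp
    ((CommSq.mk (homLeft_homRight_comm (pullbackMap (DGFunctor.fromOpOp T) f)
      P.unitMap).symm).horiz_comp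
      (CommSq.mk (evalDiagonal_naturality f).symm))).w.symm

/-- The outer two factors are isomorphisms. The middle one is `M ⊗ -` applied to the
quasi-isomorphism `unitMap`, and here flatness of the cofibrant module `M` enters. -/
lemma quasiIso_leftRetraction {M : DGMod T} (hM : M.IsCofibrant) :
    quasiIso T (P.leftRetraction M) :=
  (quasiIso T).comp_mem _ _ ((rotateInterchange P.Γ).quasiIso_hom _ P.U)
    ((quasiIso T).comp_mem _ _ (quasiIso_homRight hM.pullback_fromOpOp P.quasiIso_unitMap)
      (quasiIso_of_bijective _ (evalDiagonal_bijective M)))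

/-- The functor `- ⊗ Γ` on left modules. -/
def _root_.DG.Bimod₂.tensorLeftModules (Γ : Bimod₂ T) : DGMod T ⥤ DGMod (T.tensor T) where
  obj M := Γ.tensorLeft M
  map f := Γ.tensorLeftMap f
  map_id M := (pullbackFunctor (DGFunctor.fromOpOp T) ⋙ tensorLeftFunctor (S := T.op)
    (Γ.pullback (DGFunctor.rotate T T T.op))).map_id M
  map_comp f g := (pullbackFunctor (DGFunctor.fromOpOp T) ⋙ tensorLeftFunctor (S := T.op)
    (Γ.pullback (DGFunctor.rotate T T T.op))).map_comp f g

/-- The natural transformation `U ⊗ (- ⊗ Γ) → 1`. -/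
def leftRetractionTrans : P.Γ.tensorLeftModules ⋙ tensorRightFunctor P.U ⟶ 𝟭 (DGMod T) where
  app M := P.leftRetraction M
  naturality _ _ f := P.leftRetraction_naturality f

lemma leftRetractionTrans_app (M : DGMod T) :
    P.leftRetractionTrans.app M = P.leftRetraction M := rfl

lemma quasiIso_leftRetractionTrans {M : DGMod T} (hM : M.IsCofibrant) :
    quasiIso T (P.leftRetractionTrans.app M) := by
  rw [leftRetractionTrans_app]
  exact P.quasiIso_leftRetraction hM

set_option maxHeartbeats 1000000 in
/-- Tensoring with `U` in the first covariant variable recovers a left module `M` from `M ⊗ Γ`. -/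
def quasiRetractionLeft : QuasiRetraction P.Γ.tensorLeftModules where
  map_homotopic h := (h.pullbackMap _).homLeft _
  map_zero _ _ := homLeft_zero _ _ _
  G := tensorRightFunctor P.U
  G_map_homotopic h := h.homRight P.U
  G_map_zero M N := homRight_zero P.U M N
  q := P.leftRetractionTrans
  quasiIso_q _ hM := P.quasiIso_leftRetractionTrans hM

end PseudoDGTensor

end

end DG

/-- Let `Γ` be a perfect pseudo dg-tensor structure on a small dg-category `T`.

For `f` a morphism of cofibrant left modules, or `g` a morphism of cofibrant right modules, passing
from `f` to `f ⊗ Γ` (from `g` to `Γ ⊗ g`, in either covariant variable of `Γ`) preserves and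
reflects being zero, an isomorphism or a surjection in the homotopy category.

If the unit object is cofibrant, the same holds in the derived categories for arbitrary morphisms
of modules, the tensor product with `Γ` being computed on cofibrant resolutions. -/
theorem mainTheorem8 {k : Type u} [CommRing k] {T : DG.DGCat k} (P : DG.PseudoDGTensor T)
    (hP : P.IsPerfect) :
    (∀ ⦃M N : DG.DGMod T⦄ (f : M ⟶ N), M.IsCofibrant → N.IsCofibrant →
      (DG.DGMod.Homotopic (P.Γ.tensorLeftMap f) 0 ↔ DG.DGMod.Homotopic f 0) ∧
      (IsIso ((DG.DGMod.toH0 _).map (P.Γ.tensorLeftMap f)) ↔ IsIso ((DG.DGMod.toH0 _).map f)) ∧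
      (Epi ((DG.DGMod.toH0 _).map (P.Γ.tensorLeftMap f)) ↔ Epi ((DG.DGMod.toH0 _).map f))) ∧
    (∀ ⦃M N : DG.DGMod T.op⦄ (g : M ⟶ N), M.IsCofibrant → N.IsCofibrant →
      ((DG.DGMod.Homotopic (P.Γ.tensorRightMap₁ g) 0 ↔ DG.DGMod.Homotopic g 0) ∧
      (IsIso ((DG.DGMod.toH0 _).map (P.Γ.tensorRightMap₁ g)) ↔ IsIso ((DG.DGMod.toH0 _).map g)) ∧
      (Epi ((DG.DGMod.toH0 _).map (P.Γ.tensorRightMap₁ g)) ↔ Epi ((DG.DGMod.toH0 _).map g))) ∧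
      ((DG.DGMod.Homotopic (P.Γ.tensorRightMap₂ g) 0 ↔ DG.DGMod.Homotopic g 0) ∧
      (IsIso ((DG.DGMod.toH0 _).map (P.Γ.tensorRightMap₂ g)) ↔ IsIso ((DG.DGMod.toH0 _).map g)) ∧
      (Epi ((DG.DGMod.toH0 _).map (P.Γ.tensorRightMap₂ g)) ↔ Epi ((DG.DGMod.toH0 _).map g)))) ∧
    (P.U.IsCofibrant →
      (∀ ⦃M N : DG.DGMod T⦄ (f : M ⟶ N) (R : DG.CofRes f),
        ((DG.DGMod.toHo _).map (P.Γ.tensorLeftMap R.lift) = (DG.DGMod.toHo _).map 0 ↔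
          (DG.DGMod.toHo _).map f = (DG.DGMod.toHo _).map 0) ∧
        (IsIso ((DG.DGMod.toHo _).map (P.Γ.tensorLeftMap R.lift)) ↔
          IsIso ((DG.DGMod.toHo _).map f)) ∧
        (Epi ((DG.DGMod.toHo _).map (P.Γ.tensorLeftMap R.lift)) ↔
          Epi ((DG.DGMod.toHo _).map f))) ∧
      (∀ ⦃M N : DG.DGMod T.op⦄ (g : M ⟶ N) (R : DG.CofRes g),
        (((DG.DGMod.toHo _).map (P.Γ.tensorRightMap₁ R.lift) = (DG.DGMod.toHo _).map 0 ↔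
          (DG.DGMod.toHo _).map g = (DG.DGMod.toHo _).map 0) ∧
        (IsIso ((DG.DGMod.toHo _).map (P.Γ.tensorRightMap₁ R.lift)) ↔
          IsIso ((DG.DGMod.toHo _).map g)) ∧
        (Epi ((DG.DGMod.toHo _).map (P.Γ.tensorRightMap₁ R.lift)) ↔
          Epi ((DG.DGMod.toHo _).map g))) ∧
        (((DG.DGMod.toHo _).map (P.Γ.tensorRightMap₂ R.lift) = (DG.DGMod.toHo _).map 0 ↔
          (DG.DGMod.toHo _).map g = (DG.DGMod.toHo _).map 0) ∧
        (IsIso ((DG.DGMod.toHo _).map (P.Γ.tensorRightMap₂ R.lift)) ↔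
          IsIso ((DG.DGMod.toHo _).map g)) ∧
        (Epi ((DG.DGMod.toHo _).map (P.Γ.tensorRightMap₂ R.lift)) ↔
          Epi ((DG.DGMod.toHo _).map g))))) := by
  let R := P.quasiRetractionLeft
  let R₁ := P.quasiRetraction₁
  let R₂ := P.quasiRetraction₂
  refine ⟨fun M N f hM hN => ⟨R.homotopic_zero_iff hM, R.isIso_toH0_map_iff hM hN,
    R.epi_toH0_map_iff hN⟩, fun M N g hM hN =>
    ⟨⟨R₁.homotopic_zero_iff hM, R₁.isIso_toH0_map_iff hM hN, R₁.epi_toH0_map_iff hN⟩,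
      ⟨R₂.homotopic_zero_iff hM, R₂.isIso_toH0_map_iff hM hN, R₂.epi_toH0_map_iff hN⟩⟩,
    fun hU => ?_⟩
  -- Flatness of the cofibrant `U` is what lets `U ⊗ -` descend to the derived categories; the
  -- functor is the same in all three quasi-retractions, up to the choice of `B`.
  have hG (B : DG.DGCat k) ⦃M N : DG.DGMod (T.tensor B)⦄ (w : M ⟶ N)
      (hw : DG.DGMod.quasiIso _ w) :
      DG.DGMod.quasiIso B ((DG.DGMod.tensorRightFunctor P.U).map w) :=
    DG.DGMod.quasiIso_homRight hU hw
  exact ⟨fun M N f S => ⟨R.toHo_lift_eq_zero_iff (hG T) S, R.isIso_toHo_lift_iff (hG T) S,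
    R.epi_toHo_lift_iff (hG T) S⟩, fun M N g S =>
    ⟨⟨R₁.toHo_lift_eq_zero_iff (hG T.op) S, R₁.isIso_toHo_lift_iff (hG T.op) S, R₁.epi_toHo_lift_iff (hG T.op) S⟩,
      ⟨R₂.toHo_lift_eq_zero_iff (hG T.op) S, R₂.isIso_toHo_lift_iff (hG T.op) S,
        R₂.epi_toHo_lift_iff (hG T.op) S⟩⟩⟩
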